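/- Let $d\ge 1$ and let $\mathbb H^d=\mathbb C^d\times\mathbb R\simeq\mathbb R^{2d}\times\mathbb R$ be the Heisenberg group with points $(z,t)$, $z=x+iy\simeq(x,y)$, equipped with Lebesgue measure. Put $X_j=\partial_{x_j}+2y_j\partial_t$, $Y_j=\partial_{y_j}-2x_j\partial_t$, $\nabla_{\mathbb H}=(X_1,\dots,X_d,Y_1,\dots,Y_d)$, $\mathcal L=-\sum_{j=1}^d(X_j^2+Y_j^2)$, $\rho=\rho(z,t)=(|z|^4+t^2)^{1/4}$ and $\partial_\rho=\rho^{-1}(z\cdot\nabla_z+2t\,\partial_t)$, where $z\cdot\nabla_z=\sum_j (x_j\partial_{x_j}+y_j\partial_{y_j})$. Let $H^1(\mathbb H^d)$ be the space of $u\in L^2(\mathbb H^d;\mathbb C)$ whose weak horizontal gradient $\nabla_{\mathbb H}u$ is in $L^2$. For real $a$ write $[a]_\pm=\max\{0,\pm a\}$. Let $V\in L^1_{\mathrm{loc}}(\mathbb H^d;\mathbb C)\cap W^{1,d}_{\mathrm{loc}}(\mathbb H^d;\mathbb C)$, where $W^{1,d}_{\mathrm{loc}}$ is the usual local Sobolev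 space on $\mathbb R^{2d+1}$ (all first-order weak derivatives are in $L^d_{\mathrm{loc}}$). Assume that there are $0\le b_1,b_2<1$ and $b_3$ with $$0\le b_3<-\frac1{8d}-\frac{4d+1}{2}\sqrt{1-b_1^2}+\sqrt{\Big[\frac1{8d}+\frac{4d+1}{2}\sqrt{1-b_1^2}\Big]^2+d\,(1-b_2^2)\sqrt{1-b_1^2}}$$ such that, for all $\psi\in H^1(\mathbb H^d)$, $$\int_{\mathbb H^d}[\operatorname{Re}V]_-|\psi|^2\le b_1^2\int_{\mathbb H^d}|\nabla_{\mathbb H}\psi|^2,\qquad \int_{\mathbb H^d}[\partial_\rho(\rho\operatorname{Re}V)]_+|\psi|^2\le b_2^2\int_{\mathbb H^d}|\nabla_{\mathbb H}\psi|^2,$$ $$\int_{\mathbb H^d}\frac{\rho^4}{|z|^2}|\operatorname{Im}V|^2|\psi|^2\le b_3^2\int_{\mathbb H^d}|\nabla_{\mathbb H}\psi|^2 ,$$ where $\partial_\rho(\rho\operatorname{Re}V)=\operatorname{Re}V+\rho\,\partial_\rho\operatorname{Re}V$ is taken in the weak sense. Then $\mathcal L+V$ has no radial eigenfunctions. That is,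 if $\lambda\in\mathbb C$ and $u\in H^1(\mathbb H^d)$ is radial (there is $g:[0,\infty)\to\mathbb C$ with $u(z,t)=g(\rho(z,t))$ for almost every $(z,t)$), $Vu\in L^1_{\mathrm{loc}}$, and $(\mathcal L+V)u=\lambda u$ weakly, i.e. $$\int_{\mathbb H^d}\overline{\nabla_{\mathbb H}v}\cdot\nabla_{\mathbb H}u+\int_{\mathbb H^d}\overline v\,Vu=\lambda\int_{\mathbb H^d}\overline v\,u\qquad\text{for all }v\in C_c^\infty(\mathbb H^d;\mathbb C),$$ then $u=0$ almost everywhere. -/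

import Mathlib

open MeasureTheory
open scoped ContDiff ENNReal

noncomputable section

/-- The Heisenberg group of dimension `d` as a measure space, `ℂ^d × ℝ ≃ ℝ^{2d} × ℝ`, with points
`(z, t)`, where `z = (x, y)`, `x j = z (Sum.inl j)` and `y j = z (Sum.inr j)`.
Here `‖p.1‖` is the Euclidean norm `|z|`, and `volume` is Lebesgue measure `dz dt`. -/
abbrev Heis (d : ℕ) : Type := EuclideanSpace ℝ (Fin d ⊕ Fin d) × ℝ

namespace Heis

variable {d : ℕ}

/-- The Koranyi norm `ρ = (|z|^4 + t^2)^{1/4}`. -/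
def koranyi (p : Heis d) : ℝ := (‖p.1‖ ^ 4 + p.2 ^ 2) ^ (1 / 4 : ℝ)

/-- The left-invariant horizontal vector fields: index `Sum.inl j` is
`X_j = ∂_{x_j} + 2 y_j ∂_t` and index `Sum.inr j` is `Y_j = ∂_{y_j} - 2 x_j ∂_t`. -/
def hfield (i : Fin d ⊕ Fin d) (p : Heis d) : Heis d :=
  (EuclideanSpace.single i 1,
    Sum.elim (fun j => 2 * p.1 (Sum.inr j)) (fun j => -2 * p.1 (Sum.inl j)) i)

/-- The Euler vector field `z · ∇_z + 2 t ∂_t`. -/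
def euler (p : Heis d) : Heis d := (p.1, 2 * p.2)

/-- The horizontal gradient `(X_1 φ, …, X_d φ, Y_1 φ, …, Y_d φ)` of a differentiable function. -/
def hgrad (φ : Heis d → ℂ) (p : Heis d) : EuclideanSpace ℂ (Fin d ⊕ Fin d) :=
  WithLp.toLp 2 fun i => fderiv ℝ φ p (hfield i p)

/-- `G` is the weak horizontal gradient of `u`. (The fields `X_j`, `Y_j` are divergence free,
so their formal adjoints are `-X_j`, `-Y_j`.) -/
structure HasWeakHGrad (u : Heis d → ℂ) (G : Heis d → EuclideanSpace ℂ (Fin d ⊕ Fin d)) :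
    Prop where
  locInt : LocallyIntegrable u volume
  locInt_grad : LocallyIntegrable G volume
  integral_eq : ∀ φ : Heis d → ℝ, ContDiff ℝ ∞ φ → HasCompactSupport φ →
    ∀ i, ∫ p, (fderiv ℝ φ p (hfield i p)) • u p = -∫ p, φ p • G p i

/-- `u ∈ H^1(ℍ^d)`, with weak horizontal gradient `G`. -/
structure MemH1 (u : Heis d → ℂ) (G : Heis d → EuclideanSpace ℂ (Fin d ⊕ Fin d)) : Prop where
  memLp : MemLp u 2 volume
  memLp_grad : MemLp G 2 volume
  weak : HasWeakHGrad u G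

/-- `f' p` is the full (Euclidean) weak differential of `f` at `p`: for every direction `w`, the
function `p ↦ f' p w` is the weak derivative of `f` in the direction `w`. -/
structure HasWeakFDeriv (f : Heis d → ℂ) (f' : Heis d → Heis d →L[ℝ] ℂ) : Prop where
  locInt : LocallyIntegrable f volume
  locInt_deriv : LocallyIntegrable f' volume
  integral_eq : ∀ φ : Heis d → ℝ, ContDiff ℝ ∞ φ → HasCompactSupport φ →
    ∀ w : Heis d, ∫ p, (fderiv ℝ φ p w) • f p = -∫ p, φ p • f' p w

/-- `f ∈ W^{1,q}_loc(ℍ^d; ℂ)`, with weak differential `f'`. -/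
structure MemW1Loc (q : ℝ≥0∞) (f : Heis d → ℂ) (f' : Heis d → Heis d →L[ℝ] ℂ) : Prop where
  memLp : ∀ K : Set (Heis d), IsCompact K → MemLp f q (volume.restrict K)
  memLp_deriv : ∀ K : Set (Heis d), IsCompact K → MemLp f' q (volume.restrict K)
  weak : HasWeakFDeriv f f'

/-- The radial derivative `∂_ρ = ρ⁻¹ (z · ∇_z + 2 t ∂_t)` at `p`, applied to a function whose
differential at `p` is `L`. -/
def radialDeriv (p : Heis d) (L : Heis d →L[ℝ] ℂ) : ℂ := ((koranyi p)⁻¹ : ℝ) • L (euler p)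

/-- `∂_ρ(ρ Re V) = Re V + ρ ∂_ρ (Re V)`, where `V' p` is the (weak) differential of `V` at `p`. -/
def radialDerivRho (V : Heis d → ℂ) (V' : Heis d → Heis d →L[ℝ] ℂ) (p : Heis d) : ℝ :=
  (V p).re + koranyi p * (radialDeriv p (V' p)).re

/-- `∫ W |ψ|² ≤ b² ∫ |∇_ℍ ψ|²` for every `ψ ∈ H^1(ℍ^d)`, where `W ≥ 0`
(the integrals are `[0, ∞]`-valued). -/
def FormBounded (W : Heis d → ℝ) (b : ℝ) : Prop :=
  ∀ (ψ : Heis d → ℂ) (G : Heis d → EuclideanSpace ℂ (Fin d ⊕ Fin d)), MemH1 ψ G →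
    ∫⁻ p, ENNReal.ofReal (W p) * ‖ψ p‖ₑ ^ 2 ≤ ENNReal.ofReal (b ^ 2) * ∫⁻ p, ‖G p‖ₑ ^ 2

/-- `u` is a radial function: it depends only on the Koranyi norm (up to a null set). -/
def IsRadial (u : Heis d → ℂ) : Prop :=
  ∃ g : ℝ → ℂ, ∀ᵐ p ∂(volume : Measure (Heis d)), u p = g (koranyi p)

/-- `u` is an eigenfunction of `𝓛 + V` with eigenvalue `lam`: a nonzero `u ∈ H^1(ℍ^d)` with `V u`
locally integrable that solves `(𝓛 + V) u = lam u` weakly, i.e.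
`⟨∇_ℍ v, ∇_ℍ u⟩ + ⟨v, V u⟩ = lam ⟨v, u⟩` for all test functions `v ∈ C_c^∞(ℍ^d; ℂ)`. -/
def IsEigenfunction (V : Heis d → ℂ) (lam : ℂ) (u : Heis d → ℂ) : Prop :=
  ∃ G : Heis d → EuclideanSpace ℂ (Fin d ⊕ Fin d), MemH1 u G ∧
    ¬ (u =ᵐ[volume] 0) ∧
    LocallyIntegrable (fun p => V p * u p) volume ∧
    ∀ v : Heis d → ℂ, ContDiff ℝ ∞ v → HasCompactSupport v →
      (∫ p, inner ℂ (hgrad v p) (G p)) + (∫ p, inner ℂ (v p) (V p * u p))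
        = lam * ∫ p, inner ℂ (v p) (u p)

end Heis

end

/-! Write `tau` = ρ⁴. On functions of `tau` the sub-Laplacian is |z|² times a second-order operator
in `tau`, so a radial solution u = g(`tau`) forces V - λ to look, on each Koranyi sphere, like a
multiple of |z|² as far as certain moments can tell. The moment used is that of `qpoly`, q = |z|⁴ -
(d+1)/(d+2) τ. It is annihilated by the sub-Laplacian, and the sub-Laplacian of k(τ) q is again |z|²
q times a function of τ (`hlap_comp_tau_mul_qpoly`). Since |z|² q has mean zero over the spheres
(`integral_normSq_mul_qpoly`), testing the equation with k(τ) q gives ∫ (V - λ) q g(τ) k(τ) = 0. A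
nonzero g vanishes only on a null set, because it solves a linear second-order equation, so it can
be cancelled: ∫ (V - λ) q k(τ) = 0 for every k (`IsProfile.integral_mul_qpoly_eq_zero`). The mean of
q itself is -τ/((d+1)(d+2)), not zero (`integral_qpoly`), so this relation ties Re λ to Re V.

If Re λ > 0 (`not_pos_of_virial`), the bound on [Re V]₋ is tested with a(τ)|z|², and |z|⁴ is split
as q + (d+1)/(d+2) τ. The q-part becomes a positive multiple of Re λ ∫ τ a², and the rest is a
radial moment of Re V. The bound on ∂_ρ(ρ Re V), tested with s(τ), controls another radial moment
(`virial_le`). For s a cut-off power τ^(-(2d+1)/8) and a matching a, the two moments cancel outside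
a fixed compact set. At scale M the errors stay bounded while ∫ τ a² grows at least like M^(1/4), a
contradiction.

If Re λ ≤ 0 (`IsProfile.eq_zero`), then Re (V - λ) ≥ -[Re V]₋, which is subcritical since b₁ < 1.
Testing the equation with u itself leaves only the error of the cutoff, and logarithmic cutoffs make
it tend to zero.

Both cases rest on an ordinary differential equation for g with merely locally integrable
coefficients. The image of (V - λ) dz dt under `tau` has a density m (`exists_isTauDensity`), and g
satisfies (x^(d/2+1) g')' = m g / (16 c) with c = `polarConst d 2` (`exists_isProfile`). This
supplies the regularity that the weak formulation with smooth test functions does not give directly.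
-/

namespace Heis

variable {d : ℕ} {E : Type*} [NormedAddCommGroup E] [NormedSpace ℝ E]

/-! ### Differential calculus on the Heisenberg group -/

/-- Half of the vertical component of the `i`-th horizontal vector field. -/
noncomputable def omega (i : Fin d ⊕ Fin d) (p : Heis d) : ℝ :=
  Sum.elim (fun j => p.1 (Sum.inr j)) (fun j => -p.1 (Sum.inl j)) i

/-- The fourth power of the Koranyi norm. -/
noncomputable def tau (p : Heis d) : ℝ := ‖p.1‖ ^ 4 + p.2 ^ 2

/-- The derivative of `f` along the `i`-th horizontal vector field. -/
noncomputable def hderiv (i : Fin d ⊕ Fin d) (f : Heis d → E) (p : Heis d) : E := fderiv ℝ f p (hfield i p)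

lemma hfield_eq (i : Fin d ⊕ Fin d) (p : Heis d) :
    hfield i p = (EuclideanSpace.single i 1, 2 * omega i p) := by
  cases i <;> simp [hfield, omega]

lemma contDiff_coord {n : WithTop ℕ∞} (i : Fin d ⊕ Fin d) :
    ContDiff ℝ n (fun p : Heis d => p.1 i) := by
  have : ContDiff ℝ n (fun x : EuclideanSpace ℝ (Fin d ⊕ Fin d) => x i) :=
    (EuclideanSpace.proj (𝕜 := ℝ) i).contDiff
  exact this.comp contDiff_fst

lemma contDiff_omega {n : WithTop ℕ∞} (i : Fin d ⊕ Fin d) : ContDiff ℝ n (omega (d := d) i) := by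
  cases i with
  | inl j => exact contDiff_coord (Sum.inr j)
  | inr j => exact (contDiff_coord (Sum.inl j)).neg

lemma contDiff_hfield {n : WithTop ℕ∞} (i : Fin d ⊕ Fin d) : ContDiff ℝ n (hfield (d := d) i) := by
  have : hfield (d := d) i = fun p => (EuclideanSpace.single i 1, 2 * omega i p) :=
    funext (hfield_eq i)
  rw [this]
  exact contDiff_const.prodMk (contDiff_const.mul (contDiff_omega i))

lemma contDiff_normSq {n : WithTop ℕ∞} : ContDiff ℝ n (fun p : Heis d => ‖p.1‖ ^ 2) :=
  (contDiff_norm_sq ℝ).comp contDiff_fst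

lemma tau_eq (p : Heis d) : tau p = (‖p.1‖ ^ 2) ^ 2 + p.2 ^ 2 := by unfold tau; ring

lemma contDiff_tau {n : WithTop ℕ∞} : ContDiff ℝ n (tau (d := d)) := by
  have : tau (d := d) = fun p => (‖p.1‖ ^ 2) ^ 2 + p.2 ^ 2 := funext tau_eq
  rw [this]
  exact (contDiff_normSq.pow 2).add (contDiff_snd.pow 2)

lemma continuous_tau : Continuous (tau (d := d)) := (contDiff_tau (n := 0)).continuous

lemma measurable_tau : Measurable (tau (d := d)) := continuous_tau.measurable

lemma tau_nonneg (p : Heis d) : 0 ≤ tau p := by unfold tau; positivity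

lemma tau_pos {p : Heis d} (hp : p ≠ 0) : 0 < tau p := by
  rcases (tau_nonneg p).lt_or_eq with h | h
  · exact h
  · exfalso
    apply hp
    have h1 : ‖p.1‖ ^ 4 = 0 := by unfold tau at h; nlinarith [sq_nonneg p.2, pow_nonneg (norm_nonneg p.1) 4]
    have h2 : p.2 ^ 2 = 0 := by unfold tau at h; nlinarith [sq_nonneg p.2, pow_nonneg (norm_nonneg p.1) 4]
    have h3 : p.1 = 0 := by simpa using h1
    have h4 : p.2 = 0 := by simpa using h2
    exact Prod.ext h3 h4

lemma tau_zero : tau (0 : Heis d) = 0 := by simp [tau]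

lemma isCompact_tau_le (R : ℝ) : IsCompact {p : Heis d | tau p ≤ R} := by
  refine Metric.isCompact_of_isClosed_isBounded (isClosed_le continuous_tau continuous_const) ?_
  refine (Metric.isBounded_closedBall (x := (0 : Heis d)) (r := 1 + |R|)).subset fun p hp => ?_
  have hp' : ‖p.1‖ ^ 4 + p.2 ^ 2 ≤ R := hp
  have hR : R ≤ |R| := le_abs_self R
  have h0 := norm_nonneg p.1
  have hR0 := abs_nonneg R
  rw [mem_closedBall_zero_iff, Prod.norm_def, max_le_iff]
  constructor
  · by_contra! h
    have h1 : 1 < ‖p.1‖ := by linarith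
    have : ‖p.1‖ ≤ ‖p.1‖ ^ 4 := by
      simpa using pow_le_pow_right₀ h1.le (show 1 ≤ 4 by norm_num)
    nlinarith [sq_nonneg p.2]
  · rw [Real.norm_eq_abs]
    by_contra! h
    nlinarith [sq_abs p.2, pow_nonneg h0 4]

lemma hasCompactSupport_comp_tau {F : Type*} [Zero F] {φ : ℝ → F} (hφ : HasCompactSupport φ) :
    HasCompactSupport (fun p : Heis d => φ (tau p)) := by
  obtain ⟨R, hR⟩ := hφ.isCompact.isBounded.subset_closedBall 0
  refine HasCompactSupport.intro (isCompact_tau_le R) fun p hp => ?_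
  by_contra h
  have := hR (subset_tsupport _ h)
  rw [mem_closedBall_zero_iff, Real.norm_eq_abs] at this
  exact hp (le_trans (le_abs_self _) this)

lemma eq_sum_single (p : Heis d) :
    p = (∑ i, p.1 i • EuclideanSpace.single i (1 : ℝ), p.2) := by
  refine Prod.ext ?_ rfl
  ext j
  simp [Pi.single_apply, -Fintype.sum_sum_type]

lemma sum_sq (p : Heis d) : ∑ i, p.1 i ^ 2 = ‖p.1‖ ^ 2 := by
  rw [EuclideanSpace.norm_sq_eq]
  simp

lemma sum_omega_sq (p : Heis d) : ∑ i, omega i p ^ 2 = ‖p.1‖ ^ 2 := by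
  rw [← sum_sq]
  simp [omega, Fintype.sum_sum_type, add_comm]

lemma sum_mul_omega (p : Heis d) : ∑ i, p.1 i * omega i p = 0 := by
  simp only [omega, Fintype.sum_sum_type, Sum.elim_inl, Sum.elim_inr]
  rw [← Finset.sum_add_distrib]
  exact Finset.sum_eq_zero fun j _ => by ring

/-! ### Integration by parts -/

instance isAddHaarMeasure_volume : (volume : Measure (Heis d)).IsAddHaarMeasure :=
  inferInstanceAs (((volume : Measure (EuclideanSpace ℝ (Fin d ⊕ Fin d))).prod
    (volume : Measure ℝ)).IsAddHaarMeasure)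


lemma integral_fderiv_eq_zero {F : Heis d → E} (hF : ContDiff ℝ 1 F) (hc : HasCompactSupport F)
    (w : Heis d) : ∫ p, fderiv ℝ F p w = 0 := by
  have h1 : Continuous fun p => fderiv ℝ F p w :=
    (hF.continuous_fderiv one_ne_zero).clm_apply continuous_const
  have h2 : HasCompactSupport fun p => fderiv ℝ F p w := by
    refine (hc.fderiv (𝕜 := ℝ)).mono' fun p hp => subset_tsupport _ ?_
    intro h
    exact hp (by simp [h])
  have := integral_smul_fderiv_eq_neg_fderiv_smul_of_integrable (μ := (volume : Measure (Heis d)))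
    (f := fun _ : Heis d => (1 : ℝ)) (g := F) (v := w) (by simp)
    (by simpa using h1.integrable_of_hasCompactSupport h2)
    (by simpa using hF.continuous.integrable_of_hasCompactSupport hc)
    (fun p _ => differentiableAt_const _) (fun p _ => hF.differentiable one_ne_zero p)
  simpa using this

lemma hasCompactSupport_fderiv_apply {F : Heis d → E} (hc : HasCompactSupport F)
    (B : Heis d → Heis d) : HasCompactSupport fun p => fderiv ℝ F p (B p) := by
  refine (hc.fderiv (𝕜 := ℝ)).mono' fun p hp => subset_tsupport _ ?_
  intro h
  exact hp (by simp [h])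

lemma continuous_fderiv_apply {F : Heis d → E} (hF : ContDiff ℝ 1 F) {B : Heis d → Heis d}
    (hB : Continuous B) : Continuous fun p => fderiv ℝ F p (B p) :=
  (hF.continuous_fderiv one_ne_zero).clm_apply hB

lemma integrable_fderiv_apply {F : Heis d → E} (hF : ContDiff ℝ 1 F) (hc : HasCompactSupport F)
    {B : Heis d → Heis d} (hB : Continuous B) : Integrable fun p => fderiv ℝ F p (B p) :=
  (continuous_fderiv_apply hF hB).integrable_of_hasCompactSupport
    (hasCompactSupport_fderiv_apply hc B)

lemma fderiv_coord (i : Fin d ⊕ Fin d) (p w : Heis d) :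
    fderiv ℝ (fun p : Heis d => p.1 i) p w = w.1 i := by
  have : (fun p : Heis d => p.1 i) = ((EuclideanSpace.proj (𝕜 := ℝ) i).comp
    (ContinuousLinearMap.fst ℝ (EuclideanSpace ℝ (Fin d ⊕ Fin d)) ℝ) : Heis d → ℝ) := rfl
  rw [this, ContinuousLinearMap.fderiv]
  rfl

lemma fderiv_omega_vertical (i : Fin d ⊕ Fin d) (p : Heis d) (s : ℝ) :
    fderiv ℝ (omega i) p ((0, s) : Heis d) = 0 := by
  cases i with
  | inl j => exact fderiv_coord (Sum.inr j) p _
  | inr j =>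
    have : omega (d := d) (Sum.inr j) = fun p => -p.1 (Sum.inl j) := rfl
    rw [this, fderiv_fun_neg, neg_apply, fderiv_coord]
    simp

lemma fderiv_omega_single (i : Fin d ⊕ Fin d) (p : Heis d) (s : ℝ) :
    fderiv ℝ (omega i) p ((EuclideanSpace.single i 1, s) : Heis d) = 0 := by
  cases i with
  | inl j => exact (fderiv_coord (Sum.inr j) p _).trans (by simp)
  | inr j =>
    have : omega (d := d) (Sum.inr j) = fun p => -p.1 (Sum.inl j) := rfl
    rw [this, fderiv_fun_neg, neg_apply, fderiv_coord]
    simp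

lemma hderiv_omega (i : Fin d ⊕ Fin d) (p : Heis d) : hderiv i (omega i) p = 0 := by
  rw [hderiv, hfield_eq, fderiv_omega_single]

/-- Since `omega i` does not depend on t, the derivative of F is ∂_i F + ∂_t(2 ω_i F), a sum of
constant-direction derivatives of compactly supported functions. -/
lemma integral_hderiv_eq_zero {F : Heis d → E} (hF : ContDiff ℝ 1 F) (hc : HasCompactSupport F)
    (i : Fin d ⊕ Fin d) : ∫ p, hderiv i F p = 0 := by
  have h1 : ContDiff ℝ 1 fun p => (2 * omega i p) • F p :=
    (contDiff_const.mul (contDiff_omega i)).smul hF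
  have h2 : HasCompactSupport fun p => (2 * omega i p) • F p := hc.smul_left
  have key : ∀ p, hderiv i F p = fderiv ℝ F p (EuclideanSpace.single i 1, 0) +
      fderiv ℝ (fun p => (2 * omega i p) • F p) p (0, 1) := by
    intro p
    have hd1 : DifferentiableAt ℝ (fun p : Heis d => 2 * omega i p) p :=
      (contDiff_const.mul (contDiff_omega (n := 1) i)).differentiable one_ne_zero p
    rw [fderiv_fun_smul hd1 (hF.differentiable one_ne_zero p),
      fderiv_const_mul ((contDiff_omega (n := 1) i).differentiable one_ne_zero p)]
    simp only [add_apply, smul_apply,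
      ContinuousLinearMap.smulRight_apply, fderiv_omega_vertical, smul_zero, zero_smul, add_zero]
    rw [hderiv, hfield_eq, ← map_smul, ← map_add]
    simp
  simp_rw [key]
  rw [integral_add, integral_fderiv_eq_zero hF hc, integral_fderiv_eq_zero h1 h2, add_zero]
  · exact integrable_fderiv_apply hF hc continuous_const
  · exact integrable_fderiv_apply h1 h2 continuous_const

/-- Integration by parts against the radial field `z · ∇_z`. -/
lemma integral_fderiv_fst {F : Heis d → E} (hF : ContDiff ℝ 1 F) (hc : HasCompactSupport F) :
    ∫ p, fderiv ℝ F p (p.1, 0) = -(2 * (d : ℝ)) • ∫ p, F p := by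
  have hG : ∀ i, ContDiff ℝ 1 fun p : Heis d => p.1 i • F p := fun i => (contDiff_coord i).smul hF
  have hGc : ∀ i, HasCompactSupport fun p : Heis d => p.1 i • F p := fun i => hc.smul_left
  -- The field z · ∇_z has divergence 2d, the number of horizontal coordinates.
  have key : ∀ p : Heis d, fderiv ℝ F p (p.1, 0) =
      (∑ i, fderiv ℝ (fun p : Heis d => p.1 i • F p) p (EuclideanSpace.single i 1, 0))
        - (2 * (d : ℝ)) • F p := by
    intro p
    have h1 : ∀ i, fderiv ℝ (fun p : Heis d => p.1 i • F p) p (EuclideanSpace.single i 1, 0)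
        = p.1 i • fderiv ℝ F p (EuclideanSpace.single i 1, 0) + F p := by
      intro i
      rw [fderiv_fun_smul ((contDiff_coord (n := 1) i).differentiable one_ne_zero p)
        (hF.differentiable one_ne_zero p)]
      simp only [add_apply, smul_apply,
        ContinuousLinearMap.smulRight_apply, fderiv_coord]
      simp
    have h2 : ((p.1, 0) : Heis d) = ∑ i, p.1 i • ((EuclideanSpace.single i 1, 0) : Heis d) := by
      have := congrArg Prod.fst (eq_sum_single p)
      refine Prod.ext ?_ ?_
      · rw [Prod.fst_sum]; simpa using this
      · rw [Prod.snd_sum]; simp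
    simp_rw [h1]
    rw [Finset.sum_add_distrib, Finset.sum_const, h2, map_sum]
    simp only [map_smul, Finset.card_univ, Fintype.card_sum, Fintype.card_fin]
    rw [← Nat.cast_smul_eq_nsmul ℝ]
    push_cast
    rw [← two_mul, add_sub_cancel_right]
  simp_rw [key]
  rw [integral_sub, integral_finsetSum, integral_smul]
  · rw [Finset.sum_eq_zero fun i _ => integral_fderiv_eq_zero (hG i) (hGc i) _, zero_sub, neg_smul]
  · intro i _
    exact integrable_fderiv_apply (hG i) (hGc i) continuous_const
  · exact integrable_finsetSum _ fun i _ => integrable_fderiv_apply (hG i) (hGc i) continuous_const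
  · exact (hF.continuous.integrable_of_hasCompactSupport hc).smul _

/-! ### Rules for horizontal derivatives -/

lemma hderiv_mul {f g : Heis d → ℝ} {p : Heis d} (i : Fin d ⊕ Fin d)
    (hf : DifferentiableAt ℝ f p) (hg : DifferentiableAt ℝ g p) :
    hderiv i (fun p => f p * g p) p = f p * hderiv i g p + hderiv i f p * g p := by
  simp only [hderiv]
  rw [fderiv_fun_mul hf hg]
  simp only [add_apply, smul_apply, smul_eq_mul]
  ring

lemma hderiv_add {f g : Heis d → E} {p : Heis d} (i : Fin d ⊕ Fin d)
    (hf : DifferentiableAt ℝ f p) (hg : DifferentiableAt ℝ g p) :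
    hderiv i (fun p => f p + g p) p = hderiv i f p + hderiv i g p := by
  simp only [hderiv]
  rw [fderiv_fun_add hf hg]
  simp only [add_apply]

lemma fderiv_comp_real {φ : ℝ → E} {f : Heis d → ℝ} {p w : Heis d}
    (hφ : DifferentiableAt ℝ φ (f p)) (hf : DifferentiableAt ℝ f p) :
    fderiv ℝ (fun p => φ (f p)) p w = fderiv ℝ f p w • deriv φ (f p) := by
  have := (hφ.hasDerivAt.hasFDerivAt.comp p hf.hasFDerivAt).fderiv
  have h2 : (φ ∘ f) = fun p => φ (f p) := rfl
  rw [h2] at this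
  rw [this]
  simp

lemma hderiv_comp {φ : ℝ → E} {f : Heis d → ℝ} {p : Heis d} (i : Fin d ⊕ Fin d)
    (hφ : DifferentiableAt ℝ φ (f p)) (hf : DifferentiableAt ℝ f p) :
    hderiv i (fun p => φ (f p)) p = hderiv i f p • deriv φ (f p) :=
  fderiv_comp_real hφ hf

lemma contDiff_hderiv {n m : WithTop ℕ∞} {f : Heis d → E} (hf : ContDiff ℝ n f) (hmn : m + 1 ≤ n)
    (i : Fin d ⊕ Fin d) : ContDiff ℝ m (hderiv i f) :=
  (hf.fderiv_right hmn).clm_apply (contDiff_hfield i)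

lemma hasCompactSupport_hderiv {f : Heis d → E} (hf : HasCompactSupport f) (i : Fin d ⊕ Fin d) :
    HasCompactSupport (hderiv i f) := hasCompactSupport_fderiv_apply hf _

lemma differentiable_coord (i : Fin d ⊕ Fin d) : Differentiable ℝ (fun p : Heis d => p.1 i) :=
  (contDiff_coord (n := 1) i).differentiable one_ne_zero

lemma differentiable_omega (i : Fin d ⊕ Fin d) : Differentiable ℝ (omega (d := d) i) :=
  (contDiff_omega (n := 1) i).differentiable one_ne_zero

lemma differentiable_normSq : Differentiable ℝ (fun p : Heis d => ‖p.1‖ ^ 2) :=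
  (contDiff_normSq (n := 1)).differentiable one_ne_zero

lemma differentiable_tau : Differentiable ℝ (tau (d := d)) :=
  (contDiff_tau (n := 1)).differentiable one_ne_zero

lemma fderiv_normSq (p w : Heis d) :
    fderiv ℝ (fun p : Heis d => ‖p.1‖ ^ 2) p w = 2 * inner ℝ p.1 w.1 := by
  have h1 : HasFDerivAt (fun p : Heis d => p.1)
    (ContinuousLinearMap.fst ℝ (EuclideanSpace ℝ (Fin d ⊕ Fin d)) ℝ) p := hasFDerivAt_fst
  rw [h1.norm_sq.fderiv]
  simp

lemma fderiv_tau (p w : Heis d) :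
    fderiv ℝ (tau (d := d)) p w = 4 * ‖p.1‖ ^ 2 * inner ℝ p.1 w.1 + 2 * p.2 * w.2 := by
  have h : tau (d := d) = fun p => (‖p.1‖ ^ 2) ^ 2 + p.2 ^ 2 := funext tau_eq
  rw [h, fderiv_fun_add ((differentiable_normSq p).fun_pow 2) (differentiableAt_snd.fun_pow 2),
    fderiv_fun_pow (𝔸 := ℝ) (f := fun p : Heis d => ‖p.1‖ ^ 2) 2 (differentiable_normSq p),
    fderiv_fun_pow (𝔸 := ℝ) (f := fun p : Heis d => p.2) 2 differentiableAt_snd]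
  simp only [add_apply, smul_apply, smul_eq_mul, fderiv_normSq, fderiv_snd]
  simp
  ring

lemma hderiv_coord (i : Fin d ⊕ Fin d) (p : Heis d) :
    hderiv i (fun p : Heis d => p.1 i) p = 1 := by
  rw [hderiv, hfield_eq, fderiv_coord]; simp

lemma hderiv_snd (i : Fin d ⊕ Fin d) (p : Heis d) :
    hderiv i (fun p : Heis d => p.2) p = 2 * omega i p := by
  rw [hderiv, hfield_eq, fderiv_snd]; rfl

lemma hderiv_normSq (i : Fin d ⊕ Fin d) (p : Heis d) :
    hderiv i (fun p : Heis d => ‖p.1‖ ^ 2) p = 2 * p.1 i := by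
  rw [hderiv, fderiv_normSq, hfield_eq]
  simp [EuclideanSpace.inner_single_right]

/-- The horizontal derivative of `tau`. -/
noncomputable def tauGrad (i : Fin d ⊕ Fin d) (p : Heis d) : ℝ :=
  4 * (‖p.1‖ ^ 2 * p.1 i) + 4 * (p.2 * omega i p)

lemma hderiv_tau (i : Fin d ⊕ Fin d) : hderiv (d := d) i tau = tauGrad i := by
  funext p
  rw [hderiv, fderiv_tau, hfield_eq, tauGrad]
  simp [EuclideanSpace.inner_single_right]
  ring

lemma contDiff_tauGrad {n : WithTop ℕ∞} (i : Fin d ⊕ Fin d) : ContDiff ℝ n (tauGrad (d := d) i) :=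
  (contDiff_const.mul (contDiff_normSq.mul (contDiff_coord i))).add
    (contDiff_const.mul (contDiff_snd.mul (contDiff_omega i)))

/-- The vectors z and ω are orthogonal and both have length |z|, so the cross term drops out. The
factor |z|² is why radial functions see the weight |z|² in all energies below. -/
lemma sum_tauGrad_sq (p : Heis d) : ∑ i, tauGrad i p ^ 2 = 16 * ‖p.1‖ ^ 2 * tau p := by
  have : ∀ i, tauGrad i p ^ 2 = 16 * (‖p.1‖ ^ 2) ^ 2 * p.1 i ^ 2 +
      32 * ‖p.1‖ ^ 2 * p.2 * (p.1 i * omega i p) + 16 * p.2 ^ 2 * omega i p ^ 2 := by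
    intro i; unfold tauGrad; ring
  simp_rw [this]
  rw [Finset.sum_add_distrib, Finset.sum_add_distrib, ← Finset.mul_sum, ← Finset.mul_sum,
    ← Finset.mul_sum, sum_sq, sum_omega_sq, sum_mul_omega, tau_eq]
  ring

lemma hderiv_tauGrad (i : Fin d ⊕ Fin d) (p : Heis d) :
    hderiv i (tauGrad i) p = 8 * p.1 i ^ 2 + 4 * ‖p.1‖ ^ 2 + 8 * omega i p ^ 2 := by
  have h1 : tauGrad (d := d) i = fun p => 4 * (‖p.1‖ ^ 2 * p.1 i) + 4 * (p.2 * omega i p) := rfl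
  have d1 := differentiable_normSq p
  have d2 := differentiable_coord i p
  have d3 := differentiable_omega i p
  have d4 : DifferentiableAt ℝ (fun p : Heis d => p.2) p := differentiableAt_snd
  rw [h1, hderiv_add i ((differentiableAt_const _).fun_mul (d1.fun_mul d2))
    ((differentiableAt_const _).fun_mul (d4.fun_mul d3)),
    hderiv_mul i (differentiableAt_const _) (d1.fun_mul d2),
    hderiv_mul i (differentiableAt_const _) (d4.fun_mul d3), hderiv_mul i d1 d2, hderiv_mul i d4 d3,
    hderiv_coord, hderiv_normSq, hderiv_snd, hderiv_omega]
  have h0 : hderiv i (fun _ : Heis d => (4 : ℝ)) p = 0 := by simp [hderiv]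
  rw [h0]
  ring

/-! ### The sub-Laplacian of functions of `tau`, alone and multiplied by `qpoly` -/

lemma deriv_contDiff {n m : ℕ∞} {f : ℝ → E} (hf : ContDiff ℝ n f) (hm : (m : ℕ∞) + 1 ≤ n) :
    ContDiff ℝ m (deriv f) := by
  have h : ContDiff ℝ ((m : WithTop ℕ∞) + 1) f := hf.of_le (by exact_mod_cast hm)
  exact (contDiff_succ_iff_deriv.1 h).2.2

lemma contDiff_deriv_infty {f : ℝ → E} (hf : ContDiff ℝ ∞ f) : ContDiff ℝ ∞ (deriv f) :=
  deriv_contDiff (n := ⊤) (m := ⊤) hf (by simp)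

/-- The sub-Laplacian `∑ X_j² + ∑ Y_j²`. -/
noncomputable def hlap (v : Heis d → ℝ) (p : Heis d) : ℝ := ∑ i, hderiv i (hderiv i v) p

lemma hderiv_comp_tau_mul {h : ℝ → ℝ} (hh : Differentiable ℝ h) {w : Heis d → ℝ}
    (hw : Differentiable ℝ w) (i : Fin d ⊕ Fin d) :
    hderiv i (fun p => h (tau p) * w p) =
      fun p => deriv h (tau p) * (tauGrad i p * w p) + h (tau p) * hderiv i w p := by
  funext p
  rw [hderiv_mul (f := fun p => h (tau p)) i ((hh _).comp p (differentiable_tau p)) (hw p),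
    hderiv_comp i (hh _) (differentiable_tau p), hderiv_tau, smul_eq_mul]
  ring

/-- Product and chain rule, with the squared gradient 16|z|²τ and the sub-Laplacian (8d+16)|z|² of
`tau`. It is needed for w = 1 and w = `qpoly`. -/
lemma hlap_comp_tau_mul {h : ℝ → ℝ} (hh : ContDiff ℝ ∞ h) {w : Heis d → ℝ}
    (hw : ContDiff ℝ ∞ w) (p : Heis d) :
    hlap (fun p => h (tau p) * w p) p =
      deriv (deriv h) (tau p) * (16 * ‖p.1‖ ^ 2 * tau p) * w p
      + deriv h (tau p) * ((8 * d + 16) * ‖p.1‖ ^ 2 * w p + 2 * ∑ i, tauGrad i p * hderiv i w p)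
      + h (tau p) * hlap w p := by
  have dh := hh.differentiable (by simp)
  have dh' := (contDiff_deriv_infty hh).differentiable (by simp)
  have dw := hw.differentiable (by simp)
  have dt : ∀ i, Differentiable ℝ (tauGrad (d := d) i) :=
    fun i => (contDiff_tauGrad (n := 1) i).differentiable one_ne_zero
  have key : ∀ i, hderiv i (hderiv i fun p => h (tau p) * w p) p =
      deriv (deriv h) (tau p) * w p * tauGrad i p ^ 2 +
      deriv h (tau p) * w p * (8 * p.1 i ^ 2 + 4 * ‖p.1‖ ^ 2 + 8 * omega i p ^ 2) +
      2 * deriv h (tau p) * (tauGrad i p * hderiv i w p) +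
      h (tau p) * hderiv i (hderiv i w) p := by
    intro i
    have dwi : Differentiable ℝ (hderiv i w) :=
      (contDiff_hderiv (m := 1) hw (by norm_cast) i).differentiable one_ne_zero
    rw [hderiv_comp_tau_mul dh dw,
      hderiv_add i (((dh' _).fun_comp' p (differentiable_tau p)).fun_mul ((dt i p).fun_mul (dw p)))
        (((dh _).fun_comp' p (differentiable_tau p)).fun_mul (dwi p)),
      congrFun (hderiv_comp_tau_mul dh' ((dt i).fun_mul dw) i) p,
      congrFun (hderiv_comp_tau_mul dh dwi i) p, hderiv_mul i (dt i p) (dw p), hderiv_tauGrad]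
    ring
  unfold hlap
  simp_rw [key]
  simp only [Finset.sum_add_distrib, ← Finset.mul_sum, sum_tauGrad_sq, sum_sq, sum_omega_sq,
    Finset.sum_const, Finset.card_univ, Fintype.card_sum, Fintype.card_fin, nsmul_eq_mul]
  push_cast
  ring

lemma hlap_comp_tau {h : ℝ → ℝ} (hh : ContDiff ℝ ∞ h) (p : Heis d) :
    hlap (fun p => h (tau p)) p =
      ‖p.1‖ ^ 2 * (16 * tau p * deriv (deriv h) (tau p) + (8 * d + 16) * deriv h (tau p)) := by
  have := hlap_comp_tau_mul hh (w := fun _ : Heis d => 1) contDiff_const p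
  have h0 : ∀ i, hderiv i (fun _ : Heis d => (1 : ℝ)) = fun _ => 0 := by
    intro i; funext p; simp [hderiv]
  have h1 : hlap (fun _ : Heis d => (1 : ℝ)) p = 0 := by
    unfold hlap
    refine Finset.sum_eq_zero fun i _ => ?_
    rw [h0]; simp [hderiv]
  simp only [h0, h1, mul_one] at this
  rw [this]
  simp
  ring

/-- The polynomial `|z|⁴ - (d+1)/(d+2) τ`, which integrates to zero against `|z|² φ(τ)`. -/
noncomputable def qpoly (p : Heis d) : ℝ := ‖p.1‖ ^ 4 - ((d : ℝ) + 1) / (d + 2) * tau p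

lemma contDiff_norm_pow_four {n : WithTop ℕ∞} : ContDiff ℝ n (fun p : Heis d => ‖p.1‖ ^ 4) := by
  have : (fun p : Heis d => ‖p.1‖ ^ 4) = fun p => (‖p.1‖ ^ 2) ^ 2 := by funext p; ring
  rw [this]
  exact contDiff_normSq.pow 2

lemma contDiff_qpoly {n : WithTop ℕ∞} : ContDiff ℝ n (qpoly (d := d)) :=
  contDiff_norm_pow_four.sub (contDiff_const.mul contDiff_tau)

lemma hderiv_norm_pow_four (i : Fin d ⊕ Fin d) :
    hderiv i (fun p : Heis d => ‖p.1‖ ^ 4) = fun p => 4 * (‖p.1‖ ^ 2 * p.1 i) := by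
  funext p
  have h : (fun p : Heis d => ‖p.1‖ ^ 4) = fun p => ‖p.1‖ ^ 2 * ‖p.1‖ ^ 2 := by funext p; ring
  rw [h, hderiv_mul i (differentiable_normSq p) (differentiable_normSq p), hderiv_normSq]
  ring

lemma hderiv_const_mul {f : Heis d → ℝ} {p : Heis d} (i : Fin d ⊕ Fin d) (c : ℝ)
    (hf : DifferentiableAt ℝ f p) : hderiv i (fun p => c * f p) p = c * hderiv i f p := by
  rw [hderiv_mul i (differentiableAt_const c) hf]
  simp [hderiv]

lemma hderiv_qpoly (i : Fin d ⊕ Fin d) : hderiv (d := d) i qpoly =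
    fun p => 4 * (‖p.1‖ ^ 2 * p.1 i) + (-(((d : ℝ) + 1) / (d + 2))) * tauGrad i p := by
  funext p
  have h : qpoly (d := d) =
      fun p => ‖p.1‖ ^ 4 + (-(((d : ℝ) + 1) / (d + 2))) * tau p := by
    funext p; unfold qpoly; ring
  rw [h, hderiv_add i ((contDiff_norm_pow_four (n := 1)).differentiable one_ne_zero p)
    ((differentiableAt_const _).fun_mul (differentiable_tau p)), hderiv_norm_pow_four,
    hderiv_const_mul i _ (differentiable_tau p), hderiv_tau]

/-- The sub-Laplacians of |z|⁴ and of `tau` are (8d+8)|z|² and (8d+16)|z|². Their quotient is the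
coefficient in `qpoly`. -/
lemma hlap_qpoly (p : Heis d) : hlap qpoly p = 0 := by
  have key : ∀ i, hderiv i (hderiv (d := d) i qpoly) p = 8 * p.1 i ^ 2 + 4 * ‖p.1‖ ^ 2 +
      (-(((d : ℝ) + 1) / (d + 2))) * (8 * p.1 i ^ 2 + 4 * ‖p.1‖ ^ 2 + 8 * omega i p ^ 2) := by
    intro i
    have d1 := differentiable_normSq p
    have d2 := differentiable_coord i p
    have d3 := (contDiff_tauGrad (d := d) (n := 1) i).differentiable one_ne_zero p
    rw [hderiv_qpoly, hderiv_add i ((differentiableAt_const _).fun_mul (d1.fun_mul d2))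
      ((differentiableAt_const _).fun_mul d3), hderiv_const_mul i _ (d1.fun_mul d2),
      hderiv_const_mul i _ d3, hderiv_mul i d1 d2, hderiv_normSq, hderiv_coord, hderiv_tauGrad]
    ring
  unfold hlap
  simp_rw [key]
  simp only [Finset.sum_add_distrib, ← Finset.mul_sum, sum_sq, sum_omega_sq, Finset.sum_const,
    Finset.card_univ, Fintype.card_sum, Fintype.card_fin, nsmul_eq_mul]
  have : (d : ℝ) + 2 ≠ 0 := by positivity
  push_cast
  field_simp
  ring

/-- Pairing the gradient of `tau` with those of |z|⁴ and `tau` multiplies each of these two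
functions by 16|z|², hence also their combination q. -/
lemma sum_tauGrad_mul_hderiv_qpoly (p : Heis d) :
    ∑ i, tauGrad i p * hderiv i qpoly p = 16 * ‖p.1‖ ^ 2 * qpoly p := by
  have key : ∀ i, tauGrad i p * hderiv i qpoly p = 16 * (‖p.1‖ ^ 2) ^ 2 * p.1 i ^ 2 +
      16 * ‖p.1‖ ^ 2 * p.2 * (p.1 i * omega i p) +
      (-(((d : ℝ) + 1) / (d + 2))) * tauGrad i p ^ 2 := by
    intro i
    rw [hderiv_qpoly]
    unfold tauGrad
    ring
  simp_rw [key]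
  rw [Finset.sum_add_distrib, Finset.sum_add_distrib, ← Finset.mul_sum, ← Finset.mul_sum,
    ← Finset.mul_sum, sum_tauGrad_sq, sum_sq, sum_mul_omega, qpoly]
  ring

/-- The term with the sub-Laplacian of q vanishes and the cross term is a multiple of |z|² q, so the
result stays in |z|² q times functions of `tau`. The constant is 8d + 48 = (8d + 16) + 2 · 16. -/
lemma hlap_comp_tau_mul_qpoly {h : ℝ → ℝ} (hh : ContDiff ℝ ∞ h) (p : Heis d) :
    hlap (fun p => h (tau p) * qpoly p) p = ‖p.1‖ ^ 2 * qpoly p *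
      (16 * tau p * deriv (deriv h) (tau p) + (8 * d + 48) * deriv h (tau p)) := by
  rw [hlap_comp_tau_mul hh contDiff_qpoly, hlap_qpoly, sum_tauGrad_mul_hderiv_qpoly]
  ring

/-! ### Weak derivatives of test functions -/

lemma hgrad_apply (ψ : Heis d → ℂ) (p : Heis d) (i : Fin d ⊕ Fin d) :
    hgrad ψ p i = hderiv i ψ p := rfl

lemma continuous_hgrad {ψ : Heis d → ℂ} (hψ : ContDiff ℝ 1 ψ) : Continuous (hgrad ψ) :=
  (PiLp.continuous_toLp 2 _).comp <| continuous_pi fun i =>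
    (contDiff_hderiv (m := 0) hψ (by simp) i).continuous

lemma hasCompactSupport_hgrad {ψ : Heis d → ℂ} (hc : HasCompactSupport ψ) :
    HasCompactSupport (hgrad ψ) := by
  refine (hc.fderiv (𝕜 := ℝ)).mono' fun p hp => subset_tsupport _ ?_
  intro h
  refine hp ?_
  ext i
  simp [hgrad, h]

lemma norm_hgrad_sq (ψ : Heis d → ℂ) (p : Heis d) :
    ‖hgrad ψ p‖ ^ 2 = ∑ i, ‖hderiv i ψ p‖ ^ 2 := by
  rw [EuclideanSpace.norm_sq_eq]; rfl

lemma hderiv_smul {φ : Heis d → ℝ} {ψ : Heis d → E} {p : Heis d} (i : Fin d ⊕ Fin d)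
    (hf : DifferentiableAt ℝ φ p) (hg : DifferentiableAt ℝ ψ p) :
    hderiv i (fun p => φ p • ψ p) p = φ p • hderiv i ψ p + hderiv i φ p • ψ p := by
  simp only [hderiv]
  rw [fderiv_fun_smul hf hg]
  simp only [add_apply, smul_apply, ContinuousLinearMap.smulRight_apply]

lemma memH1_of_contDiff {ψ : Heis d → ℂ} (hψ : ContDiff ℝ 1 ψ) (hc : HasCompactSupport ψ) :
    MemH1 ψ (hgrad ψ) where
  memLp := hψ.continuous.memLp_of_hasCompactSupport hc
  memLp_grad := (continuous_hgrad hψ).memLp_of_hasCompactSupport (hasCompactSupport_hgrad hc)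
  weak :=
    { locInt := hψ.continuous.locallyIntegrable
      locInt_grad := (continuous_hgrad hψ).locallyIntegrable
      integral_eq := by
        intro φ hφ hφc i
        have hφ1 : ContDiff ℝ 1 φ := hφ.of_le (by norm_cast)
        have h0 := integral_hderiv_eq_zero (hφ1.smul hψ) (hφc.smul_right (f' := ψ)) i
        have h1 : ∀ p, hderiv i (fun p => φ p • ψ p) p = φ p • hderiv i ψ p + hderiv i φ p • ψ p :=
          fun p => hderiv_smul i (hφ1.differentiable one_ne_zero p) (hψ.differentiable one_ne_zero p)
        have c1 : Continuous (hderiv i ψ) := (contDiff_hderiv (m := 0) hψ (by simp) i).continuous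
        have c2 : Continuous (hderiv i φ) := (contDiff_hderiv (m := 0) hφ1 (by simp) i).continuous
        have h2 : ∫ p, hderiv i (fun p => φ p • ψ p) p = 0 := h0
        simp_rw [h1] at h2
        have i1 : Integrable fun p => φ p • hderiv i ψ p :=
          (hφ1.continuous.smul c1).integrable_of_hasCompactSupport hφc.smul_right
        have i2 : Integrable fun p => hderiv i φ p • ψ p :=
          (c2.smul hψ.continuous).integrable_of_hasCompactSupport
            (hasCompactSupport_hderiv hφc i).smul_right
        rw [integral_add i1 i2] at h2
        exact eq_neg_of_add_eq_zero_right h2 }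

lemma _root_.MeasureTheory.LocallyIntegrable.integrable_mul_continuous {W f : Heis d → ℝ}
    (hW : LocallyIntegrable W volume) (hf : Continuous f) (hc : HasCompactSupport f) :
    Integrable fun p => W p * f p := by
  have := hW.integrable_smul_left_of_hasCompactSupport hf hc
  simpa [mul_comm] using this

lemma hasCompactSupport_norm_sq {F : Type*} [NormedAddCommGroup F] {f : Heis d → F}
    (hc : HasCompactSupport f) : HasCompactSupport fun p => ‖f p‖ ^ 2 :=
  HasCompactSupport.intro hc fun p hp => by simp [image_eq_zero_of_notMem_tsupport hp]

/-- The form bounds are used only for C¹ functions of compact support. There both sides are finite,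
so the `[0, ∞]`-valued inequality becomes one between real integrals. -/
lemma FormBounded.integral_le {W : Heis d → ℝ} {b : ℝ} (h : FormBounded W b)
    (hW : LocallyIntegrable W volume) (hW0 : ∀ p, 0 ≤ W p) {ψ : Heis d → ℂ}
    (hψ : ContDiff ℝ 1 ψ) (hc : HasCompactSupport ψ) :
    ∫ p, W p * ‖ψ p‖ ^ 2 ≤ b ^ 2 * ∫ p, ‖hgrad ψ p‖ ^ 2 := by
  have h1 := h ψ (hgrad ψ) (memH1_of_contDiff hψ hc)
  have i1 : Integrable fun p => W p * ‖ψ p‖ ^ 2 :=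
    hW.integrable_mul_continuous (hψ.continuous.norm.pow 2)
      (hasCompactSupport_norm_sq hc)
  have i2 : Integrable fun p => ‖hgrad ψ p‖ ^ 2 :=
    ((continuous_hgrad hψ).norm.pow 2).integrable_of_hasCompactSupport
      (hasCompactSupport_norm_sq (hasCompactSupport_hgrad hc))
  have e1 : ∫⁻ p, ENNReal.ofReal (W p) * ‖ψ p‖ₑ ^ 2 = ENNReal.ofReal (∫ p, W p * ‖ψ p‖ ^ 2) := by
    rw [ofReal_integral_eq_lintegral_ofReal i1
      (Filter.Eventually.of_forall fun p => mul_nonneg (hW0 p) (sq_nonneg _))]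
    refine lintegral_congr fun p => ?_
    rw [ENNReal.ofReal_mul (hW0 p), ENNReal.ofReal_pow (norm_nonneg _), ofReal_norm]
  have e2 : ∫⁻ p, ‖hgrad ψ p‖ₑ ^ 2 = ENNReal.ofReal (∫ p, ‖hgrad ψ p‖ ^ 2) := by
    rw [ofReal_integral_eq_lintegral_ofReal i2 (Filter.Eventually.of_forall fun p => sq_nonneg _)]
    refine lintegral_congr fun p => ?_
    rw [ENNReal.ofReal_pow (norm_nonneg _), ofReal_norm]
  rw [e1, e2, ← ENNReal.ofReal_mul (sq_nonneg b)] at h1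
  exact (ENNReal.ofReal_le_ofReal_iff (mul_nonneg (sq_nonneg b)
    (integral_nonneg fun p => sq_nonneg _))).1 h1

lemma norm_hgrad_comp_tau_sq {f : ℝ → ℂ} (hf : Differentiable ℝ f) (p : Heis d) :
    ‖hgrad (fun p => f (tau p)) p‖ ^ 2 = 16 * ‖p.1‖ ^ 2 * tau p * ‖deriv f (tau p)‖ ^ 2 := by
  rw [norm_hgrad_sq, ← sum_tauGrad_sq, Finset.sum_mul]
  refine Finset.sum_congr rfl fun i _ => ?_
  rw [hderiv_comp i (hf _) (differentiable_tau p), hderiv_tau, norm_smul, mul_pow,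
    Real.norm_eq_abs, sq_abs]

lemma hderiv_ofReal {f : Heis d → ℝ} {p : Heis d} (i : Fin d ⊕ Fin d)
    (hf : DifferentiableAt ℝ f p) :
    hderiv i (fun p => (f p : ℂ)) p = ((hderiv i f p : ℝ) : ℂ) := by
  have := (Complex.ofRealCLM.hasFDerivAt.comp p hf.hasFDerivAt).fderiv
  have h2 : (Complex.ofRealCLM ∘ f) = fun p => (f p : ℂ) := rfl
  rw [h2] at this
  rw [hderiv, this]
  rfl

/-! ### Functions tangent to the spheres of the Koranyi norm -/

/-- The field |z|^(2k) (t² z · ∇_z - 2|z|⁴ t ∂_t) annihilates `tau`, that is, it is tangent to the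
Koranyi spheres. The factor of φ(τ) is its divergence, so the derivatives of φ cancel after
integration by parts. -/
lemma integral_tangent {φ : ℝ → ℝ} (hφ : ContDiff ℝ ∞ φ) (hc : HasCompactSupport φ) (k : ℕ) :
    ∫ p : Heis d, φ (tau p) * ((‖p.1‖ ^ 2) ^ k * ((2 * d + 2 * k) * p.2 ^ 2 - 2 * ‖p.1‖ ^ 4)) = 0 := by
  have hφτ : ContDiff ℝ ∞ fun p : Heis d => φ (tau p) := hφ.comp contDiff_tau
  have hcτ : HasCompactSupport fun p : Heis d => φ (tau p) := hasCompactSupport_comp_tau hc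
  have s1 : ContDiff ℝ 1 fun p : Heis d => φ (tau p) * ((‖p.1‖ ^ 2) ^ k * p.2 ^ 2) :=
    (hφτ.of_le (by norm_cast)).mul ((contDiff_normSq.pow k).mul (contDiff_snd.pow 2))
  have s2 : ContDiff ℝ 1 fun p : Heis d => φ (tau p) * ((‖p.1‖ ^ 2) ^ (k + 2) * p.2) :=
    (hφτ.of_le (by norm_cast)).mul ((contDiff_normSq.pow (k + 2)).mul contDiff_snd)
  have c1 : HasCompactSupport fun p : Heis d => φ (tau p) * ((‖p.1‖ ^ 2) ^ k * p.2 ^ 2) :=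
    hcτ.mul_right
  have c2 : HasCompactSupport fun p : Heis d => φ (tau p) * ((‖p.1‖ ^ 2) ^ (k + 2) * p.2) :=
    hcτ.mul_right
  have e1 := integral_fderiv_fst s1 c1
  have e2 := integral_fderiv_eq_zero s2 c2 (0, 1)
  have dφ : ∀ p : Heis d, DifferentiableAt ℝ (fun p : Heis d => φ (tau p)) p :=
    hφτ.differentiable (by simp)
  have dn : ∀ m : ℕ, ∀ p : Heis d, DifferentiableAt ℝ (fun p : Heis d => (‖p.1‖ ^ 2) ^ m) p :=
    fun m p => (differentiable_normSq p).fun_pow m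
  have ds : ∀ p : Heis d, DifferentiableAt ℝ (fun p : Heis d => p.2) p :=
    fun p => differentiableAt_snd
  have fφ : ∀ p w : Heis d, fderiv ℝ (fun p : Heis d => φ (tau p)) p w =
      (4 * ‖p.1‖ ^ 2 * inner ℝ p.1 w.1 + 2 * p.2 * w.2) * deriv φ (tau p) := by
    intro p w
    rw [fderiv_comp_real (hφ.differentiable (by simp) _) (differentiable_tau p), fderiv_tau,
      smul_eq_mul]
  have fn : ∀ m : ℕ, ∀ p w : Heis d, fderiv ℝ (fun p : Heis d => (‖p.1‖ ^ 2) ^ m) p w =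
      m * (‖p.1‖ ^ 2) ^ (m - 1) * (2 * inner ℝ p.1 w.1) := by
    intro m p w
    rw [fderiv_fun_pow (𝔸 := ℝ) (f := fun p : Heis d => ‖p.1‖ ^ 2) m (differentiable_normSq p),
      smul_apply, fderiv_normSq, smul_eq_mul, nsmul_eq_mul]
  have k1 : ∀ p : Heis d, fderiv ℝ (fun p : Heis d => φ (tau p) * ((‖p.1‖ ^ 2) ^ k * p.2 ^ 2)) p
      (p.1, 0) = 4 * ‖p.1‖ ^ 4 * deriv φ (tau p) * ((‖p.1‖ ^ 2) ^ k * p.2 ^ 2) +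
        2 * k * (φ (tau p) * ((‖p.1‖ ^ 2) ^ k * p.2 ^ 2)) := by
    intro p
    rw [fderiv_fun_mul (dφ p) ((dn k p).fun_mul ((ds p).fun_pow 2)),
      fderiv_fun_mul (dn k p) ((ds p).fun_pow 2),
      fderiv_fun_pow (𝔸 := ℝ) (f := fun p : Heis d => p.2) 2 (ds p)]
    simp only [add_apply, smul_apply, smul_eq_mul, fφ, fn, fderiv_snd, real_inner_self_eq_norm_sq,
      ContinuousLinearMap.coe_snd']
    rcases k with _ | k
    · simp; ring
    · simp; ring
  have k2 : ∀ p : Heis d, fderiv ℝ (fun p : Heis d => φ (tau p) * ((‖p.1‖ ^ 2) ^ (k + 2) * p.2)) p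
      (0, 1) = 2 * p.2 * deriv φ (tau p) * ((‖p.1‖ ^ 2) ^ (k + 2) * p.2) +
        φ (tau p) * (‖p.1‖ ^ 2) ^ (k + 2) := by
    intro p
    rw [fderiv_fun_mul (dφ p) ((dn (k + 2) p).fun_mul (ds p)), fderiv_fun_mul (dn (k + 2) p) (ds p)]
    simp only [add_apply, smul_apply, smul_eq_mul, fφ, fn, fderiv_snd,
      ContinuousLinearMap.coe_snd', inner_zero_right]
    ring
  have i0 := s1.continuous.integrable_of_hasCompactSupport (μ := volume) c1
  have i1 : Integrable fun p : Heis d => fderiv ℝ (fun p : Heis d => φ (tau p) *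
      ((‖p.1‖ ^ 2) ^ k * p.2 ^ 2)) p (p.1, 0) :=
    integrable_fderiv_apply s1 c1 (continuous_fst.prodMk continuous_const)
  have i2 := integrable_fderiv_apply s2 c2 (B := fun _ => (0, 1)) continuous_const
  have : ∀ p : Heis d,
      φ (tau p) * ((‖p.1‖ ^ 2) ^ k * ((2 * d + 2 * k) * p.2 ^ 2 - 2 * ‖p.1‖ ^ 4)) =
      (fderiv ℝ (fun p : Heis d => φ (tau p) * ((‖p.1‖ ^ 2) ^ k * p.2 ^ 2)) p (p.1, 0) +
        (2 * (d : ℝ)) • (φ (tau p) * ((‖p.1‖ ^ 2) ^ k * p.2 ^ 2))) -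
      2 * fderiv ℝ (fun p : Heis d => φ (tau p) * ((‖p.1‖ ^ 2) ^ (k + 2) * p.2)) p (0, 1) := by
    intro p
    rw [k1, k2, smul_eq_mul]
    ring
  simp_rw [this]
  have i3 : Integrable fun p : Heis d => (2 * (d : ℝ)) • (φ (tau p) * ((‖p.1‖ ^ 2) ^ k * p.2 ^ 2)) :=
    i0.smul (2 * (d : ℝ))
  have i4 : Integrable fun p : Heis d => fderiv ℝ (fun p : Heis d => φ (tau p) *
      ((‖p.1‖ ^ 2) ^ k * p.2 ^ 2)) p (p.1, 0) +
        (2 * (d : ℝ)) • (φ (tau p) * ((‖p.1‖ ^ 2) ^ k * p.2 ^ 2)) := i1.add i3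
  rw [integral_sub i4 (i2.const_mul 2), integral_add i1 i3,
    integral_const_mul, e2, e1, integral_smul]
  simp

/-- Case k = 1 of `integral_tangent`: with t² = τ - |z|⁴ the bracket becomes -2(d+2) q. -/
lemma integral_normSq_mul_qpoly {φ : ℝ → ℝ} (hφ : ContDiff ℝ ∞ φ) (hc : HasCompactSupport φ) :
    ∫ p : Heis d, (‖p.1‖ ^ 2 * qpoly p) * φ (tau p) = 0 := by
  have h := integral_tangent (d := d) hφ hc 1
  have h2 : ((d : ℝ) + 2) ≠ 0 := by positivity
  have : ∀ p : Heis d, (‖p.1‖ ^ 2 * qpoly p) * φ (tau p) = (-(1 / (2 * ((d : ℝ) + 2)))) *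
      (φ (tau p) * ((‖p.1‖ ^ 2) ^ 1 *
        ((2 * d + 2 * (1 : ℕ)) * p.2 ^ 2 - 2 * ‖p.1‖ ^ 4))) := by
    intro p
    rw [qpoly, tau]
    field_simp
    push_cast
    ring
  simp_rw [this]
  rw [integral_const_mul, h, mul_zero]

/-- Case k = 0 of `integral_tangent` says that |z|⁴ averages to d/(d+1) τ, and d/(d+1) - (d+1)/(d+2)
= -1/((d+1)(d+2)). That this is negative, not zero, is what brings Re λ into the argument. -/
lemma integral_qpoly {φ : ℝ → ℝ} (hφ : ContDiff ℝ ∞ φ) (hc : HasCompactSupport φ) :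
    ∫ p : Heis d, qpoly p * φ (tau p) =
      -(1 / (((d : ℝ) + 1) * (d + 2))) * ∫ p : Heis d, tau p * φ (tau p) := by
  have h := integral_tangent (d := d) hφ hc 0
  have h1 : ((d : ℝ) + 1) ≠ 0 := by positivity
  have h2 : ((d : ℝ) + 2) ≠ 0 := by positivity
  have : ∀ p : Heis d, qpoly p * φ (tau p) = -(1 / (((d : ℝ) + 1) * (d + 2))) *
      (tau p * φ (tau p)) + (-(1 / (2 * ((d : ℝ) + 1)))) *
      (φ (tau p) * ((‖p.1‖ ^ 2) ^ 0 *
        ((2 * d + 2 * (0 : ℕ)) * p.2 ^ 2 - 2 * ‖p.1‖ ^ 4))) := by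
    intro p
    rw [qpoly, tau]
    field_simp
    push_cast
    ring
  have cφ : Continuous fun p : Heis d => φ (tau p) := hφ.continuous.comp continuous_tau
  have c4 : Continuous fun p : Heis d => ‖p.1‖ := continuous_fst.norm
  simp_rw [this]
  rw [integral_add, integral_const_mul, integral_const_mul, h, mul_zero, add_zero]
  · refine (Continuous.integrable_of_hasCompactSupport (continuous_tau.mul cφ) ?_).const_mul _
    exact (hasCompactSupport_comp_tau hc).mul_left
  · refine (Continuous.integrable_of_hasCompactSupport
      (cφ.mul (by fun_prop)) ?_).const_mul _
    exact (hasCompactSupport_comp_tau hc).mul_right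

/-! ### The Euler field and the weak eigenvalue equation -/

lemma euler_eq_sum (p : Heis d) :
    euler p = ∑ i, p.1 i • ((EuclideanSpace.single i 1, 0) : Heis d) + (2 * p.2) • (0, 1) := by
  have := congrArg Prod.fst (eq_sum_single p)
  refine Prod.ext ?_ ?_
  · rw [Prod.fst_add, Prod.fst_sum]; simpa [euler] using this
  · rw [Prod.snd_add, Prod.snd_sum]; simp [euler]

lemma continuous_euler : Continuous (euler (d := d)) :=
  continuous_fst.prodMk (continuous_const.mul continuous_snd)

/-- The divergence of φ times the Euler field, with the homogeneous dimension 2d + 2. It is spelled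
out in coordinates because weak derivatives are tested in constant directions only. -/
lemma sum_fderiv_mul_coord {φ : Heis d → ℝ} {p : Heis d} (hφ : DifferentiableAt ℝ φ p) :
    ∑ i, fderiv ℝ (fun p => φ p * p.1 i) p (EuclideanSpace.single i 1, 0)
      + fderiv ℝ (fun p => φ p * (2 * p.2)) p (0, 1)
      = fderiv ℝ φ p (euler p) + (2 * d + 2) * φ p := by
  have h1 : ∀ i, fderiv ℝ (fun p : Heis d => φ p * p.1 i) p (EuclideanSpace.single i 1, 0)
      = p.1 i * fderiv ℝ φ p (EuclideanSpace.single i 1, 0) + φ p := by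
    intro i
    rw [fderiv_fun_mul hφ (differentiable_coord i p)]
    simp only [add_apply, smul_apply, smul_eq_mul, fderiv_coord]
    simp
    ring
  have h2 : fderiv ℝ (fun p : Heis d => φ p * (2 * p.2)) p (0, 1)
      = 2 * p.2 * fderiv ℝ φ p (0, 1) + 2 * φ p := by
    have ds : DifferentiableAt ℝ (fun p : Heis d => p.2) p := differentiableAt_snd
    rw [fderiv_fun_mul hφ ((differentiableAt_const _).fun_mul ds), fderiv_const_mul ds]
    simp only [add_apply, smul_apply, smul_eq_mul, fderiv_snd]
    simp
    ring
  simp_rw [h1]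
  rw [h2, euler_eq_sum, map_add, map_sum, map_smul, Finset.sum_add_distrib, Finset.sum_const]
  simp only [map_smul, smul_eq_mul, Finset.card_univ, Fintype.card_sum, Fintype.card_fin,
    nsmul_eq_mul]
  push_cast
  ring

lemma HasWeakFDeriv.integral_euler {f : Heis d → ℂ} {f' : Heis d → Heis d →L[ℝ] ℂ}
    (hf : HasWeakFDeriv f f') {φ : Heis d → ℝ} (hφ : ContDiff ℝ ∞ φ) (hc : HasCompactSupport φ) :
    ∫ p, φ p • f' p (euler p) = -∫ p, (fderiv ℝ φ p (euler p) + (2 * d + 2) * φ p) • f p := by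
  have hs : ∀ i, ContDiff ℝ ∞ fun p : Heis d => φ p * p.1 i := fun i => hφ.mul (contDiff_coord i)
  have hsc : ∀ i, HasCompactSupport fun p : Heis d => φ p * p.1 i := fun i => hc.mul_right
  have ht : ContDiff ℝ ∞ fun p : Heis d => φ p * (2 * p.2) :=
    hφ.mul (contDiff_const.mul contDiff_snd)
  have htc : HasCompactSupport fun p : Heis d => φ p * (2 * p.2) := hc.mul_right
  have int1 : ∀ {χ : Heis d → ℝ}, ContDiff ℝ ∞ χ → HasCompactSupport χ → ∀ w : Heis d,
      Integrable fun p => χ p • f' p w := by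
    intro χ hχ hχc w
    exact (ContinuousLinearMap.apply ℝ ℂ w).integrable_comp
      (hf.locInt_deriv.integrable_smul_left_of_hasCompactSupport hχ.continuous hχc)
  have int2 : ∀ {χ : Heis d → ℝ}, ContDiff ℝ ∞ χ → HasCompactSupport χ → ∀ w : Heis d,
      Integrable fun p => fderiv ℝ χ p w • f p := by
    intro χ hχ hχc w
    exact hf.locInt.integrable_smul_left_of_hasCompactSupport
      (continuous_fderiv_apply (hχ.of_le (by norm_cast)) continuous_const)
      (hasCompactSupport_fderiv_apply hχc _)
  have e1 : ∀ p, φ p • f' p (euler p) =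
      ∑ i, (φ p * p.1 i) • f' p (EuclideanSpace.single i 1, 0) + (φ p * (2 * p.2)) • f' p (0, 1) := by
    intro p
    rw [euler_eq_sum, map_add, map_sum, map_smul, smul_add, Finset.smul_sum]
    simp only [map_smul, smul_smul]
  have e2 : ∀ p, (fderiv ℝ φ p (euler p) + (2 * d + 2) * φ p) • f p =
      ∑ i, fderiv ℝ (fun p => φ p * p.1 i) p (EuclideanSpace.single i 1, 0) • f p +
      fderiv ℝ (fun p => φ p * (2 * p.2)) p (0, 1) • f p := by
    intro p
    rw [← sum_fderiv_mul_coord (hφ.differentiable (by simp) p), add_smul, Finset.sum_smul]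
  simp_rw [e1, e2]
  rw [integral_add (integrable_finsetSum _ fun i _ => int1 (hs i) (hsc i) _) (int1 ht htc _),
    integral_add (integrable_finsetSum _ fun i _ => int2 (hs i) (hsc i) _) (int2 ht htc _),
    integral_finsetSum _ (fun i _ => int1 (hs i) (hsc i) _),
    integral_finsetSum _ (fun i _ => int2 (hs i) (hsc i) _), neg_add, ← Finset.sum_neg_distrib,
    hf.integral_eq _ ht htc, neg_neg]
  congr 1
  refine Finset.sum_congr rfl fun i _ => ?_
  rw [hf.integral_eq _ (hs i) (hsc i), neg_neg]

lemma koranyi_eq (p : Heis d) : koranyi p = tau p ^ (1 / 4 : ℝ) := rfl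

/-- Off the origin the factors ρ and ρ⁻¹ cancel. At the origin the Euler field vanishes, so the
convention 0⁻¹ = 0 does no harm. -/
lemma radialDerivRho_eq (V : Heis d → ℂ) (V' : Heis d → Heis d →L[ℝ] ℂ) (p : Heis d) :
    radialDerivRho V V' p = (V p).re + (V' p (euler p)).re := by
  unfold radialDerivRho radialDeriv
  rw [Complex.smul_re, smul_eq_mul, ← mul_assoc]
  by_cases hp : p = 0
  · subst hp
    have : euler (0 : Heis d) = 0 := by simp [euler]
    simp [this]
  · have : koranyi p ≠ 0 := by
      rw [koranyi_eq]; exact (Real.rpow_pos_of_pos (tau_pos hp) _).ne'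
    rw [mul_inv_cancel₀ this, one_mul]

lemma locallyIntegrable_clm_apply {f' : Heis d → Heis d →L[ℝ] ℂ}
    (hf : LocallyIntegrable f' volume) {B : Heis d → Heis d} (hB : Continuous B) :
    LocallyIntegrable (fun p => f' p (B p)) volume := by
  rw [locallyIntegrable_iff]
  intro K hK
  obtain ⟨C, hC⟩ := hK.exists_bound_of_continuousOn hB.continuousOn
  have h1 := hf.integrableOn_isCompact hK
  refine Integrable.mono' (h1.norm.mul_const C) ?_ ?_
  · have hc : Continuous fun q : (Heis d →L[ℝ] ℂ) × Heis d => q.1 q.2 :=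
      isBoundedBilinearMap_apply.continuous
    exact hc.comp_aestronglyMeasurable
      (AEStronglyMeasurable.prodMk h1.aestronglyMeasurable hB.aestronglyMeasurable)
  · filter_upwards [ae_restrict_mem hK.measurableSet] with p hp
    exact (f' p).le_opNorm_of_le (hC p hp)

lemma _root_.MeasureTheory.LocallyIntegrable.complex_re {f : Heis d → ℂ}
    (hf : LocallyIntegrable f volume) : LocallyIntegrable (fun p => (f p).re) volume := by
  rw [locallyIntegrable_iff]
  intro K hK
  exact (hf.integrableOn_isCompact hK).re

lemma _root_.MeasureTheory.LocallyIntegrable.max_zero {f : Heis d → ℝ}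
    (hf : LocallyIntegrable f volume) : LocallyIntegrable (fun p => max 0 (f p)) volume := by
  rw [locallyIntegrable_iff]
  intro K hK
  have := (hf.integrableOn_isCompact hK).pos_part
  simpa only [IntegrableOn, max_comm] using this

/-- The virial inequality obtained from the bound on the radial derivative of the potential. -/
lemma virial_le {V : Heis d → ℂ} {V' : Heis d → Heis d →L[ℝ] ℂ} (hV : HasWeakFDeriv V V')
    {b : ℝ} (h : FormBounded (fun p => max 0 (radialDerivRho V V' p)) b) {s : ℝ → ℝ}
    (hs : ContDiff ℝ ∞ s) (hc : HasCompactSupport s) :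
    -∫ p, ((2 * d + 1) * s (tau p) ^ 2 + 8 * tau p * (s (tau p) * deriv s (tau p))) * (V p).re ≤
      b ^ 2 * ∫ p : Heis d, 16 * ‖p.1‖ ^ 2 * tau p * deriv s (tau p) ^ 2 := by
  have hsd := hs.differentiable (by simp)
  have hφ : ContDiff ℝ ∞ fun p : Heis d => s (tau p) ^ 2 := (hs.comp contDiff_tau).pow 2
  have hcτ : HasCompactSupport fun p : Heis d => s (tau p) := hasCompactSupport_comp_tau hc
  have hφc : HasCompactSupport fun p : Heis d => s (tau p) ^ 2 :=
    HasCompactSupport.intro hcτ fun p hp => by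
      have : s (tau p) = 0 := image_eq_zero_of_notMem_tsupport (f := fun p : Heis d => s (tau p)) hp
      simp [this]
  have lE : LocallyIntegrable (fun p => (V' p (euler p)).re) volume :=
    (locallyIntegrable_clm_apply hV.locInt_deriv continuous_euler).complex_re
  have lV := hV.locInt.complex_re
  have lR : LocallyIntegrable (fun p => radialDerivRho V V' p) volume := by
    simp_rw [radialDerivRho_eq]
    exact lV.add lE
  have hψ : ContDiff ℝ 1 fun p : Heis d => ((s (tau p) : ℝ) : ℂ) :=
    Complex.ofRealCLM.contDiff.comp ((hs.of_le (by norm_cast)).comp contDiff_tau)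
  have hψc : HasCompactSupport fun p : Heis d => ((s (tau p) : ℝ) : ℂ) :=
    hcτ.comp_left (g := fun x : ℝ => (x : ℂ)) (by simp)
  have h1 := h.integral_le lR.max_zero (fun p => le_max_left _ _) hψ hψc
  have h2 : ∀ p : Heis d, ‖hgrad (fun p : Heis d => ((s (tau p) : ℝ) : ℂ)) p‖ ^ 2 =
      16 * ‖p.1‖ ^ 2 * tau p * deriv s (tau p) ^ 2 := by
    intro p
    have hd : Differentiable ℝ fun x => ((s x : ℝ) : ℂ) :=
      Complex.ofRealCLM.differentiable.comp hsd
    have := norm_hgrad_comp_tau_sq (f := fun x => ((s x : ℝ) : ℂ)) hd p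
    rw [this, ((hsd (tau p)).hasDerivAt.ofReal_comp).deriv]
    simp
  simp_rw [h2] at h1
  have i1 : Integrable fun p => radialDerivRho V V' p * s (tau p) ^ 2 :=
    lR.integrable_mul_continuous hφ.continuous hφc
  have i2 : Integrable fun p => max 0 (radialDerivRho V V' p) * s (tau p) ^ 2 :=
    lR.max_zero.integrable_mul_continuous hφ.continuous hφc
  have h3 : ∫ p, radialDerivRho V V' p * s (tau p) ^ 2 ≤
      ∫ p, max 0 (radialDerivRho V V' p) * ‖((s (tau p) : ℝ) : ℂ)‖ ^ 2 := by
    have : ∀ p : Heis d, ‖((s (tau p) : ℝ) : ℂ)‖ ^ 2 = s (tau p) ^ 2 := by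
      intro p; rw [Complex.norm_real, Real.norm_eq_abs, sq_abs]
    simp_rw [this]
    exact integral_mono i1 i2 fun p => mul_le_mul_of_nonneg_right (le_max_right _ _) (sq_nonneg _)
  -- An identity remains. Integrating the Euler derivative by parts against s(τ)² gives the weight
  -- -(2d+2) s² - 8 τ s s', and the undifferentiated Re V adds s², whence 2d + 1.
  refine le_trans (le_of_eq ?_) (h3.trans h1)
  have h4 := congrArg Complex.re (hV.integral_euler hφ hφc)
  have i3 : Integrable fun p => (s (tau p) ^ 2) • V' p (euler p) :=
    (locallyIntegrable_clm_apply hV.locInt_deriv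
      continuous_euler).integrable_smul_left_of_hasCompactSupport hφ.continuous hφc
  have cE : Continuous fun p : Heis d => fderiv ℝ (fun p : Heis d => s (tau p) ^ 2) p (euler p) +
      (2 * d + 2) * s (tau p) ^ 2 :=
    (continuous_fderiv_apply (hφ.of_le (by norm_cast)) continuous_euler).add
      (continuous_const.mul hφ.continuous)
  have sE : HasCompactSupport fun p : Heis d =>
      fderiv ℝ (fun p : Heis d => s (tau p) ^ 2) p (euler p) + (2 * d + 2) * s (tau p) ^ 2 :=
    (hasCompactSupport_fderiv_apply hφc _).add hφc.mul_left
  have i4 : Integrable fun p : Heis d => (fderiv ℝ (fun p : Heis d => s (tau p) ^ 2) p (euler p) +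
      (2 * d + 2) * s (tau p) ^ 2) • V p :=
    hV.locInt.integrable_smul_left_of_hasCompactSupport cE sE
  have r3 : (∫ p, (s (tau p) ^ 2) • V' p (euler p)).re =
      ∫ p, (V' p (euler p)).re * s (tau p) ^ 2 := by
    rw [← RCLike.re_eq_complex_re, ← integral_re i3]
    refine integral_congr_ae (Filter.Eventually.of_forall fun p => ?_)
    simp only [RCLike.re_eq_complex_re, Complex.smul_re, smul_eq_mul]
    ring
  have r4 : (∫ p : Heis d, (fderiv ℝ (fun p : Heis d => s (tau p) ^ 2) p (euler p) +
      (2 * d + 2) * s (tau p) ^ 2) • V p).re =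
      ∫ p : Heis d, (fderiv ℝ (fun p : Heis d => s (tau p) ^ 2) p (euler p) +
      (2 * d + 2) * s (tau p) ^ 2) * (V p).re := by
    rw [← RCLike.re_eq_complex_re, ← integral_re i4]
    refine integral_congr_ae (Filter.Eventually.of_forall fun p => ?_)
    simp only [RCLike.re_eq_complex_re, Complex.smul_re, smul_eq_mul]
  rw [Complex.neg_re, r3, r4] at h4
  simp_rw [radialDerivRho_eq, add_mul] at i1 ⊢
  have i5 : Integrable fun p => (V p).re * s (tau p) ^ 2 :=
    lV.integrable_mul_continuous hφ.continuous hφc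
  have i6 : Integrable fun p => (V' p (euler p)).re * s (tau p) ^ 2 :=
    lE.integrable_mul_continuous hφ.continuous hφc
  have i7 : Integrable fun p : Heis d => (fderiv ℝ (fun p : Heis d => s (tau p) ^ 2) p (euler p) +
      (2 * d + 2) * s (tau p) ^ 2) * (V p).re := by
    simpa [mul_comm] using lV.integrable_mul_continuous cE sE
  rw [integral_add i5 i6, h4, ← sub_eq_add_neg, ← integral_sub i5 i7, ← integral_neg]
  refine integral_congr_ae (Filter.Eventually.of_forall fun p => ?_)
  have hE : fderiv ℝ (fun p : Heis d => s (tau p) ^ 2) p (euler p) =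
      8 * tau p * (s (tau p) * deriv s (tau p)) := by
    rw [fderiv_fun_pow (𝔸 := ℝ) (f := fun p : Heis d => s (tau p)) 2
      ((hsd _).fun_comp' p (differentiable_tau p)), smul_apply,
      fderiv_comp_real (hsd _) (differentiable_tau p), fderiv_tau, euler, real_inner_self_eq_norm_sq]
    simp only [smul_eq_mul, nsmul_eq_mul, tau]
    push_cast
    ring
  simp only [hE]
  ring

/-- The weak eigenvalue equation, tested with real functions and integrated by parts. -/
lemma weak_equation {V : Heis d → ℂ} {lam : ℂ} {u : Heis d → ℂ}
    {G : Heis d → EuclideanSpace ℂ (Fin d ⊕ Fin d)} (hu : HasWeakHGrad u G)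
    (hVu : LocallyIntegrable (fun p => V p * u p) volume)
    (heq : ∀ v : Heis d → ℂ, ContDiff ℝ ∞ v → HasCompactSupport v →
      (∫ p, inner ℂ (hgrad v p) (G p)) + (∫ p, inner ℂ (v p) (V p * u p))
        = lam * ∫ p, inner ℂ (v p) (u p))
    {v : Heis d → ℝ} (hv : ContDiff ℝ ∞ v) (hc : HasCompactSupport v) :
    ∫ p, ((V p - lam) * u p) * (v p : ℂ) = ∫ p, u p * (hlap v p : ℂ) := by
  have hvd := hv.differentiable (by simp)
  have h1 := heq (fun p => (v p : ℂ)) (Complex.ofRealCLM.contDiff.comp hv)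
    (hc.comp_left (g := fun x : ℝ => (x : ℂ)) (by simp))
  have hsi : ∀ i, ContDiff ℝ ∞ (hderiv i v) := fun i => contDiff_hderiv hv (by simp) i
  have hci : ∀ i, HasCompactSupport (hderiv i v) := fun i => hasCompactSupport_hderiv hc i
  have g1 : ∀ p, inner ℂ (hgrad (fun p => (v p : ℂ)) p) (G p) = ∑ i, hderiv i v p • G p i := by
    intro p
    rw [PiLp.inner_apply]
    refine Finset.sum_congr rfl fun i _ => ?_
    rw [hgrad_apply, hderiv_ofReal i (hvd p)]
    simp [mul_comm]
  have lGi : ∀ i, LocallyIntegrable (fun p => G p i) volume := by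
    intro i
    rw [locallyIntegrable_iff]
    intro K hK
    exact (EuclideanSpace.proj (𝕜 := ℂ) i).integrable_comp (hu.locInt_grad.integrableOn_isCompact hK)
  have i1 : ∀ i, Integrable fun p => hderiv i v p • G p i := fun i =>
    (lGi i).integrable_smul_left_of_hasCompactSupport (hsi i).continuous (hci i)
  have i2 : ∀ i, Integrable fun p => hderiv i (hderiv i v) p • u p := fun i =>
    hu.locInt.integrable_smul_left_of_hasCompactSupport
      (contDiff_hderiv (m := 0) (hsi i) (by simp) i).continuous (hasCompactSupport_hderiv (hci i) i)
  have e1 : ∫ p, inner ℂ (hgrad (fun p => (v p : ℂ)) p) (G p) = -∫ p, u p * (hlap v p : ℂ) := by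
    simp_rw [g1]
    rw [integral_finsetSum _ fun i _ => i1 i]
    have : ∀ p, u p * (hlap v p : ℂ) = ∑ i, hderiv i (hderiv i v) p • u p := by
      intro p
      rw [← Finset.sum_smul, mul_comm, ← Complex.real_smul]
      rfl
    simp_rw [this]
    rw [integral_finsetSum _ fun i _ => i2 i, ← Finset.sum_neg_distrib]
    refine Finset.sum_congr rfl fun i _ => ?_
    -- The weak gradient of u is tested with the i-th horizontal derivative of v, so both
    -- derivatives end up on v.
    have := hu.integral_eq _ (hsi i) (hci i) i
    rw [eq_comm, neg_eq_iff_eq_neg]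
    exact this
  have i3 : Integrable fun p => V p * u p * (v p : ℂ) := by
    simpa [mul_comm] using hVu.integrable_smul_left_of_hasCompactSupport hv.continuous hc
  have i4 : Integrable fun p => u p * (v p : ℂ) := by
    simpa [mul_comm] using hu.locInt.integrable_smul_left_of_hasCompactSupport hv.continuous hc
  have e2 : ∀ f : Heis d → ℂ, ∫ p, inner ℂ (v p : ℂ) (f p) = ∫ p, f p * (v p : ℂ) := by
    intro f
    simp
  rw [e1, e2, e2] at h1
  have : ∀ p, ((V p - lam) * u p) * (v p : ℂ) = V p * u p * (v p : ℂ) - lam * (u p * (v p : ℂ)) := by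
    intro p; ring
  simp_rw [this]
  rw [integral_sub i3 (i4.const_mul lam), integral_const_mul, ← h1]
  ring

end Heis

namespace Heis

variable {d : ℕ}

/-! ### Polar coordinates -/

/-- The dilation `(z, t) ↦ (r z, r² t)`. -/
noncomputable def dilation (r : ℝ) : Heis d →ₗ[ℝ] Heis d :=
  LinearMap.prodMap (r • LinearMap.id) (r ^ 2 • LinearMap.id)

lemma dilation_apply (r : ℝ) (p : Heis d) : dilation r p = (r • p.1, r ^ 2 * p.2) := rfl

lemma det_dilation (r : ℝ) : LinearMap.det (dilation (d := d) r) = r ^ (2 * d + 2) := by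
  rw [dilation, LinearMap.det_prodMap, LinearMap.det_smul, LinearMap.det_smul]
  simp [← two_mul, pow_add]

lemma tau_dilation (r : ℝ) (p : Heis d) : tau (dilation r p) = r ^ 4 * tau p := by
  rw [dilation_apply, tau, tau]
  simp only [norm_smul, Real.norm_eq_abs, mul_pow]
  rw [show |r| ^ 4 = r ^ 4 by rw [show 4 = 2 * 2 by norm_num, pow_mul, pow_mul, sq_abs]]
  ring

lemma lintegral_dilation {r : ℝ} (hr : 0 < r) {f : Heis d → ℝ≥0∞} (hf : Measurable f) :
    ∫⁻ p, f p = ENNReal.ofReal (r ^ (2 * d + 2)) * ∫⁻ p, f (dilation r p) := by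
  have hdet : LinearMap.det (dilation (d := d) r) ≠ 0 := by
    rw [det_dilation]; positivity
  have h := Measure.map_linearMap_addHaar_eq_smul_addHaar (volume : Measure (Heis d)) hdet
  have hm : Measurable (dilation (d := d) r) :=
    (LinearMap.continuous_of_finiteDimensional (dilation (d := d) r)).measurable
  have h2 : ∫⁻ p, f (dilation r p) = ∫⁻ p, f p ∂(Measure.map (dilation r) volume) :=
    (lintegral_map hf hm).symm
  rw [h2, h, lintegral_smul_measure, det_dilation, smul_eq_mul, ← mul_assoc,
    ← ENNReal.ofReal_mul (by positivity), abs_of_pos (by positivity), mul_inv_cancel₀ (by positivity)]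
  simp

/-- The measure `|z|^k dz dt`. -/
noncomputable def weightMeasure (d k : ℕ) : Measure (Heis d) :=
  volume.withDensity fun p => ENNReal.ofReal (‖p.1‖ ^ k)

lemma measurable_weight (k : ℕ) :
    Measurable fun p : Heis d => ENNReal.ofReal (‖p.1‖ ^ k) :=
  ((continuous_fst.norm.pow k).measurable).ennreal_ofReal

/-- The dilation with r = s^(1/4) carries {τ ≤ 1} onto {τ ≤ s}. Its Jacobian is r^(2d+2) and the
weight contributes r^k. -/
lemma weightMeasure_tau_le {k : ℕ} {s : ℝ} (hs : 0 < s) :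
    weightMeasure d k {p | tau p ≤ s} =
      ENNReal.ofReal (s ^ ((2 * d + 2 + k : ℝ) / 4)) * weightMeasure d k {p | tau p ≤ 1} := by
  have hm : ∀ s : ℝ, MeasurableSet {p : Heis d | tau p ≤ s} :=
    fun s => (isCompact_tau_le s).isClosed.measurableSet
  have hr : 0 < s ^ (1 / 4 : ℝ) := Real.rpow_pos_of_pos hs _
  have hr4 : (s ^ (1 / 4 : ℝ)) ^ 4 = s := by
    rw [← Real.rpow_natCast, ← Real.rpow_mul hs.le]; norm_num
  set r := s ^ (1 / 4 : ℝ) with hrdef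
  rw [weightMeasure, withDensity_apply _ (hm s), withDensity_apply _ (hm 1),
    ← lintegral_indicator (hm s), ← lintegral_indicator (hm 1),
    lintegral_dilation hr ((measurable_weight k).indicator (hm s))]
  have : ∀ p : Heis d, {p : Heis d | tau p ≤ s}.indicator
      (fun p => ENNReal.ofReal (‖p.1‖ ^ k)) (dilation r p) =
      ENNReal.ofReal (r ^ k) *
        {p : Heis d | tau p ≤ 1}.indicator (fun p => ENNReal.ofReal (‖p.1‖ ^ k)) p := by
    intro p
    have h1 : (tau (dilation r p) ≤ s) ↔ tau p ≤ 1 := by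
      rw [tau_dilation, hr4]
      constructor
      · intro h; by_contra! h'; nlinarith
      · intro h; nlinarith
    by_cases hp : tau p ≤ 1
    · rw [Set.indicator_of_mem (show _ ∈ {p : Heis d | tau p ≤ s} from h1.2 hp),
        Set.indicator_of_mem (show _ ∈ {p : Heis d | tau p ≤ 1} from hp), dilation_apply,
        ← ENNReal.ofReal_mul (by positivity)]
      simp only [norm_smul, Real.norm_eq_abs, abs_of_pos hr, mul_pow]
    · rw [Set.indicator_of_notMem (show ¬ _ ∈ {p : Heis d | tau p ≤ s} from fun h => hp (h1.1 h)),
        Set.indicator_of_notMem (show ¬ _ ∈ {p : Heis d | tau p ≤ 1} from hp), mul_zero]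
  simp_rw [this]
  rw [lintegral_const_mul _ ((measurable_weight k).indicator (hm 1)), ← mul_assoc,
    ← ENNReal.ofReal_mul (by positivity), ← pow_add]
  congr 2
  rw [hrdef, ← Real.rpow_natCast, ← Real.rpow_mul hs.le]
  congr 1
  push_cast
  ring

lemma weightMeasure_tau_le_one_lt_top (k : ℕ) : weightMeasure d k {p | tau p ≤ 1} < ⊤ := by
  rw [weightMeasure, withDensity_apply _ (isCompact_tau_le 1).isClosed.measurableSet]
  have : IntegrableOn (fun p : Heis d => ‖p.1‖ ^ k) {p | tau p ≤ 1} :=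
    (continuous_fst.norm.pow k).continuousOn.integrableOn_compact (isCompact_tau_le 1)
  exact this.lintegral_lt_top

lemma weightMeasure_tau_le_one_pos (hd : 1 ≤ d) (k : ℕ) :
    0 < weightMeasure d k {p | tau p ≤ 1} := by
  have hU : IsOpen {p : Heis d | tau p < 1 ∧ 1 / 4 < ‖p.1‖} :=
    (isOpen_lt continuous_tau continuous_const).inter
      (isOpen_lt continuous_const continuous_fst.norm)
  have hne : {p : Heis d | tau p < 1 ∧ 1 / 4 < ‖p.1‖}.Nonempty := by
    -- Here |z| = 1/2 and `tau` is 1/16; a nonzero z exists because d ≥ 1.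
    refine ⟨(EuclideanSpace.single (Sum.inl ⟨0, hd⟩) (1 / 2), 0), ?_, ?_⟩
    · simp [tau]; norm_num
    · simp; norm_num
  have hpos := hU.measure_pos volume hne
  have hsub : {p : Heis d | tau p < 1 ∧ 1 / 4 < ‖p.1‖} ⊆ {p | tau p ≤ 1} := fun p hp => hp.1.le
  refine lt_of_lt_of_le ?_ (measure_mono hsub)
  rw [weightMeasure, withDensity_apply _ hU.measurableSet]
  refine lt_of_lt_of_le ?_ (setLIntegral_mono (f := fun _ => ENNReal.ofReal ((1 / 4) ^ k))
    (measurable_weight k) fun p hp => ENNReal.ofReal_le_ofReal ?_)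
  · rw [setLIntegral_const]
    exact ENNReal.mul_pos (by simp) hpos.ne'
  · exact pow_le_pow_left₀ (by norm_num) hp.2.le k

/-- The constant in the polar coordinate formula for the measure `|z|^k dz dt`. -/
noncomputable def polarConst (d k : ℕ) : ℝ :=
  (2 * d + 2 + k : ℝ) / 4 * (weightMeasure d k {p | tau p ≤ 1}).toReal

lemma polarConst_pos (hd : 1 ≤ d) (k : ℕ) : 0 < polarConst d k :=
  mul_pos (by positivity) (ENNReal.toReal_pos (weightMeasure_tau_le_one_pos hd k).ne'
    (weightMeasure_tau_le_one_lt_top k).ne)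

lemma polarConst_nonneg (k : ℕ) : 0 ≤ polarConst d k :=
  mul_nonneg (by positivity) ENNReal.toReal_nonneg

lemma tau_le_zero {s : ℝ} (hs : s ≤ 0) : volume {p : Heis d | tau p ≤ s} = 0 := by
  refine measure_mono_null (t := {0}) (fun p hp => ?_) ?_
  · by_contra h
    exact absurd (tau_pos h) (not_lt.2 (le_trans hp hs))
  · have : ({0} : Set (Heis d)) ⊆ Set.univ ×ˢ {0} := by rintro p rfl; simp
    refine measure_mono_null this ?_
    rw [Measure.volume_eq_prod, Measure.prod_prod]
    simp

lemma _root_.MeasureTheory.Measure.ext_of_Iic_of_lt_top (μ ν : Measure ℝ)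
    (hμ : ∀ s, μ (Set.Iic s) < ⊤) (h : ∀ s, μ (Set.Iic s) = ν (Set.Iic s)) : μ = ν := by
  refine Measure.ext_of_Ioc' μ ν (fun a b _ => ?_) fun a b hab => ?_
  · exact ((measure_mono Set.Ioc_subset_Iic_self).trans_lt (hμ b)).ne
  · rw [← Set.Iic_sdiff_Iic, measure_sdiff (Set.Iic_subset_Iic.2 hab.le)
      measurableSet_Iic.nullMeasurableSet (hμ a).ne,
      measure_sdiff (Set.Iic_subset_Iic.2 hab.le) measurableSet_Iic.nullMeasurableSet
      (by rw [← h]; exact (hμ a).ne), h, h]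

/-- The density of the image of `|z|^k dz dt` under `tau`. -/
noncomputable def polarDensity (d k : ℕ) (x : ℝ) : ℝ :=
  polarConst d k * x ^ ((2 * d + 2 + k : ℝ) / 4 - 1)

lemma measurable_polarDensity (k : ℕ) : Measurable (polarDensity d k) :=
  (measurable_id.pow_const _).const_mul _

lemma polarDensity_nonneg (k : ℕ) {x : ℝ} (hx : 0 ≤ x) : 0 ≤ polarDensity d k x :=
  mul_nonneg (polarConst_nonneg k) (Real.rpow_nonneg hx _)

lemma polarDensity_pos (hd : 1 ≤ d) (k : ℕ) {x : ℝ} (hx : 0 < x) : 0 < polarDensity d k x :=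
  mul_pos (polarConst_pos hd k) (Real.rpow_pos_of_pos hx _)

/-- Two measures finite on the half-lines (-∞, s] agree once they agree there. On the left this is
the scaling law s^κ with κ = (2d+2+k)/4, and `polarDensity` is the derivative of that power. -/
lemma map_tau_weightMeasure (k : ℕ) :
    (weightMeasure d k).map tau = (volume.restrict (Set.Ioi 0)).withDensity
      fun x => ENNReal.ofReal (polarDensity d k x) := by
  set κ : ℝ := (2 * d + 2 + k : ℝ) / 4 with hκ
  have hκ0 : 0 < κ := by positivity
  have e1 : ∀ s, (weightMeasure d k).map tau (Set.Iic s) =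
      weightMeasure d k {p | tau p ≤ s} := fun s => Measure.map_apply measurable_tau measurableSet_Iic
  have e0 : ∀ s ≤ 0, weightMeasure d k {p | tau p ≤ s} = 0 := fun s hs =>
    withDensity_absolutelyContinuous _ _ (tau_le_zero hs)
  refine Measure.ext_of_Iic_of_lt_top _ _ (fun s => ?_) fun s => ?_
  · rw [e1]
    rcases le_or_gt s 0 with hs | hs
    · rw [e0 s hs]; simp
    · rw [weightMeasure_tau_le hs]
      exact ENNReal.mul_lt_top ENNReal.ofReal_lt_top (weightMeasure_tau_le_one_lt_top k)
  · rw [e1, withDensity_apply _ measurableSet_Iic, Measure.restrict_restrict measurableSet_Iic]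
    rcases le_or_gt s 0 with hs | hs
    · have : Set.Iic s ∩ Set.Ioi 0 = ∅ := by
        ext x; simp only [Set.mem_inter_iff, Set.mem_Iic, Set.mem_Ioi, Set.mem_empty_iff_false]
        constructor
        · rintro ⟨h1, h2⟩; linarith
        · exact False.elim
      rw [e0 s hs, this]; simp
    · have hset : Set.Iic s ∩ Set.Ioi 0 = Set.Ioc 0 s := by ext x; simp [and_comm]
      have hint : IntervalIntegrable (fun x : ℝ => x ^ (κ - 1)) volume 0 s :=
        intervalIntegral.intervalIntegrable_rpow' (by linarith)
      have hint' : IntegrableOn (fun x : ℝ => polarDensity d k x) (Set.Ioc 0 s) :=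
        ((intervalIntegrable_iff_integrableOn_Ioc_of_le hs.le).1 hint).const_mul _
      have hval : ∫ x in Set.Ioc 0 s, polarDensity d k x =
          s ^ κ * (weightMeasure d k {p | tau p ≤ 1}).toReal := by
        have h1 : ∫ x in Set.Ioc 0 s, x ^ (κ - 1) = s ^ κ / κ := by
          rw [← intervalIntegral.integral_of_le hs.le, integral_rpow (Or.inl (by linarith))]
          simp [Real.zero_rpow hκ0.ne']
        unfold polarDensity
        rw [integral_const_mul, ← hκ, h1, polarConst, ← hκ]
        field_simp
      rw [hset, ← ofReal_integral_eq_lintegral_ofReal hint', hval,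
        ENNReal.ofReal_mul (Real.rpow_nonneg hs.le _), weightMeasure_tau_le hs,
        ENNReal.ofReal_toReal (weightMeasure_tau_le_one_lt_top k).ne]
      filter_upwards [ae_restrict_mem measurableSet_Ioc] with x hx
      exact polarDensity_nonneg k hx.1.le

section
variable {E : Type*} [NormedAddCommGroup E] [NormedSpace ℝ E]

/-- Used with k = 0 for the L² norm of u and with k = 2 for energies, since the squared gradient of
f(τ) carries the factor |z|². -/
lemma integrable_polar_iff (k : ℕ) {f : ℝ → E} (hf : StronglyMeasurable f) :
    Integrable (fun p : Heis d => ‖p.1‖ ^ k • f (tau p)) ↔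
      IntegrableOn (fun x => polarDensity d k x • f x) (Set.Ioi 0) := by
  have h1 : Integrable f ((weightMeasure d k).map tau) ↔
      Integrable (f ∘ tau) (weightMeasure d k) :=
    integrable_map_measure hf.aestronglyMeasurable measurable_tau.aemeasurable
  rw [weightMeasure, integrable_withDensity_iff_integrable_smul' (measurable_weight k)
    (Filter.Eventually.of_forall fun _ => ENNReal.ofReal_lt_top), ← weightMeasure,
    map_tau_weightMeasure, integrable_withDensity_iff_integrable_smul'
    (measurable_polarDensity k).ennreal_ofReal
    (Filter.Eventually.of_forall fun _ => ENNReal.ofReal_lt_top)] at h1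
  have h2 : ∀ p : Heis d, (ENNReal.ofReal (‖p.1‖ ^ k)).toReal = ‖p.1‖ ^ k :=
    fun p => ENNReal.toReal_ofReal (by positivity)
  simp only [h2, Function.comp_apply] at h1
  rw [← h1]
  refine integrable_congr ?_
  filter_upwards [ae_restrict_mem measurableSet_Ioi] with x hx
  rw [ENNReal.toReal_ofReal (polarDensity_nonneg k (le_of_lt hx))]

lemma integral_polar (k : ℕ) {f : ℝ → E} (hf : StronglyMeasurable f) :
    ∫ p : Heis d, ‖p.1‖ ^ k • f (tau p) = ∫ x in Set.Ioi 0, polarDensity d k x • f x := by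
  have h1 : ∫ x, f x ∂((weightMeasure d k).map tau) = ∫ p, f (tau p) ∂(weightMeasure d k) :=
    integral_map measurable_tau.aemeasurable hf.aestronglyMeasurable
  rw [weightMeasure, integral_withDensity_eq_integral_toReal_smul (measurable_weight k)
    (Filter.Eventually.of_forall fun _ => ENNReal.ofReal_lt_top), ← weightMeasure,
    map_tau_weightMeasure, integral_withDensity_eq_integral_toReal_smul
    (measurable_polarDensity k).ennreal_ofReal
    (Filter.Eventually.of_forall fun _ => ENNReal.ofReal_lt_top)] at h1
  have h2 : ∀ p : Heis d, (ENNReal.ofReal (‖p.1‖ ^ k)).toReal = ‖p.1‖ ^ k :=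
    fun p => ENNReal.toReal_ofReal (by positivity)
  simp only [h2] at h1
  rw [← h1]
  refine integral_congr_ae ?_
  filter_upwards [ae_restrict_mem measurableSet_Ioi] with x hx
  rw [ENNReal.toReal_ofReal (polarDensity_nonneg k (le_of_lt hx))]

end

lemma map_tau_absolutelyContinuous :
    (volume : Measure (Heis d)).map tau ≪ volume.restrict (Set.Ioi 0) := by
  have h := map_tau_weightMeasure (d := d) 0
  have h2 : weightMeasure d 0 = volume := by simp [weightMeasure]
  rw [h2] at h
  rw [h]
  exact withDensity_absolutelyContinuous _ _

lemma ae_comp_tau {P : ℝ → Prop} (h : ∀ᵐ x ∂(volume.restrict (Set.Ioi (0 : ℝ))), P x) :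
    ∀ᵐ p : Heis d, P (tau p) :=
  ae_of_ae_map measurable_tau.aemeasurable (map_tau_absolutelyContinuous.ae_le h)

/-! ### Densities of images under `tau` -/

/-- The function f need not be radial: m is its spherical mean times the polar density. The image
measure is finite on (-∞, s], as sublevel sets of `tau` are compact, and absolutely continuous, as
the image of Lebesgue measure is. The Radon–Nikodym theorem gives m. -/
lemma exists_density_of_nonneg {f : Heis d → ℝ} (hf : LocallyIntegrable f volume)
    (hf0 : ∀ p, 0 ≤ f p) :
    ∃ m : ℝ → ℝ, Measurable m ∧ ∀ h : ℝ → ℂ, Measurable h →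
      Integrable (fun p : Heis d => f p * h (tau p)) →
      IntegrableOn (fun x => m x * h x) (Set.Ioi 0) ∧
      ∫ p : Heis d, f p * h (tau p) = ∫ x in Set.Ioi 0, m x * h x := by
  have hfm : AEMeasurable (fun p => ENNReal.ofReal (f p)) volume :=
    hf.aestronglyMeasurable.aemeasurable.ennreal_ofReal
  set σ := ((volume : Measure (Heis d)).withDensity fun p => ENNReal.ofReal (f p)).map tau with hσ
  have hfin : ∀ s, σ (Set.Iic s) < ⊤ := by
    intro s
    rw [hσ, Measure.map_apply measurable_tau measurableSet_Iic,
      withDensity_apply _ (measurable_tau measurableSet_Iic)]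
    exact (hf.integrableOn_isCompact (isCompact_tau_le s)).lintegral_lt_top
  have : IsLocallyFiniteMeasure σ := ⟨fun x => ⟨Set.Iic (x + 1), Iic_mem_nhds (by linarith), hfin _⟩⟩
  have hac : σ ≪ volume.restrict (Set.Ioi 0) :=
    ((withDensity_absolutelyContinuous _ _).map measurable_tau).trans map_tau_absolutelyContinuous
  have hD := Measure.withDensity_rnDeriv_eq σ (volume.restrict (Set.Ioi (0 : ℝ))) hac
  have hlt := Measure.rnDeriv_lt_top σ (volume.restrict (Set.Ioi (0 : ℝ)))
  have hDm := Measure.measurable_rnDeriv σ (volume.restrict (Set.Ioi (0 : ℝ)))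
  refine ⟨fun x => (σ.rnDeriv (volume.restrict (Set.Ioi 0)) x).toReal, hDm.ennreal_toReal,
    fun h hh hi => ?_⟩
  have h2 : ∀ p : Heis d, (ENNReal.ofReal (f p)).toReal = f p :=
    fun p => ENNReal.toReal_ofReal (hf0 p)
  have hhs : StronglyMeasurable h := hh.stronglyMeasurable
  have i1 : Integrable h σ := by
    rw [hσ, integrable_map_measure hhs.aestronglyMeasurable measurable_tau.aemeasurable,
      integrable_withDensity_iff_integrable_smul₀' hfm
        (Filter.Eventually.of_forall fun _ => ENNReal.ofReal_lt_top)]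
    simpa [h2] using hi
  have i2 : ∫ x, h x ∂σ = ∫ p : Heis d, f p * h (tau p) := by
    rw [hσ, integral_map measurable_tau.aemeasurable hhs.aestronglyMeasurable,
      integral_withDensity_eq_integral_toReal_smul₀ hfm
        (Filter.Eventually.of_forall fun _ => ENNReal.ofReal_lt_top)]
    simp [h2]
  rw [← i2]
  rw [← hD, integrable_withDensity_iff_integrable_smul' hDm hlt] at i1
  refine ⟨by simpa [IntegrableOn] using i1, ?_⟩
  conv_lhs => rw [← hD]
  rw [integral_withDensity_eq_integral_toReal_smul hDm hlt]
  simp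

/-- `m` is the density of the image under `tau` of the complex measure `f dz dt`. -/
structure IsTauDensity (f : Heis d → ℂ) (m : ℝ → ℂ) : Prop where
  measurable : Measurable m
  spec : ∀ h : ℝ → ℂ, Measurable h → Integrable (fun p : Heis d => f p * h (tau p)) →
      IntegrableOn (fun x => m x * h x) (Set.Ioi 0) ∧
      ∫ p : Heis d, f p * h (tau p) = ∫ x in Set.Ioi 0, m x * h x

lemma integral_sub_add_mul_sub {α : Type*} [MeasurableSpace α] {μ : Measure α} {a b c e : α → ℂ}
    (ha : Integrable a μ) (hb : Integrable b μ) (hc : Integrable c μ) (he : Integrable e μ)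
    (w : ℂ) : ∫ x, (a x - b x + w * (c x - e x)) ∂μ =
      (∫ x, a x ∂μ) - (∫ x, b x ∂μ) + w * ((∫ x, c x ∂μ) - ∫ x, e x ∂μ) := by
  have h1 : Integrable (fun x => a x - b x) μ := ha.sub hb
  have h2 : Integrable (fun x => w * (c x - e x)) μ := (hc.sub he).const_mul w
  rw [integral_add h1 h2, integral_sub ha hb, integral_const_mul, integral_sub hc he]

/-- Positive and negative parts of the real and imaginary parts are treated separately. Each is
dominated by |f|, so integrability of f h(τ) passes to all four. -/
lemma exists_isTauDensity {f : Heis d → ℂ} (hf : LocallyIntegrable f volume) :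
    ∃ m : ℝ → ℂ, IsTauDensity f m := by
  have hre := hf.complex_re
  have him : LocallyIntegrable (fun p => (f p).im) volume := by
    rw [locallyIntegrable_iff]
    intro K hK
    exact (hf.integrableOn_isCompact hK).im
  obtain ⟨m1, hm1, k1⟩ := exists_density_of_nonneg hre.max_zero fun p => le_max_left _ _
  obtain ⟨m2, hm2, k2⟩ := exists_density_of_nonneg hre.neg.max_zero fun p => le_max_left _ _
  obtain ⟨m3, hm3, k3⟩ := exists_density_of_nonneg him.max_zero fun p => le_max_left _ _
  obtain ⟨m4, hm4, k4⟩ := exists_density_of_nonneg him.neg.max_zero fun p => le_max_left _ _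
  refine ⟨fun x => m1 x - m2 x + Complex.I * (m3 x - m4 x), by fun_prop, fun h hh hi => ?_⟩
  have hhτ : AEStronglyMeasurable (fun p : Heis d => h (tau p)) volume :=
    (hh.comp measurable_tau).aestronglyMeasurable
  have key : ∀ {g : Heis d → ℝ}, LocallyIntegrable g volume → (∀ p, |g p| ≤ ‖f p‖) →
      Integrable (fun p : Heis d => (g p : ℂ) * h (tau p)) := by
    intro g hg hle
    refine hi.mono ?_ (Filter.Eventually.of_forall fun p => ?_)
    · exact (Complex.continuous_ofReal.comp_aestronglyMeasurable hg.aestronglyMeasurable).mul hhτ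
    · rw [norm_mul, norm_mul, Complex.norm_real, Real.norm_eq_abs]
      exact mul_le_mul_of_nonneg_right (hle p) (norm_nonneg _)
  have habs : ∀ x : ℝ, |max 0 x| ≤ |x| := by
    intro x
    rw [abs_of_nonneg (le_max_left _ _)]
    exact max_le (abs_nonneg _) (le_abs_self _)
  have j1 := key hre.max_zero fun p => (habs _).trans (Complex.abs_re_le_norm _)
  have j2 := key hre.neg.max_zero fun p => by
    simpa using (habs (-(f p).re)).trans ((abs_neg _).le.trans (Complex.abs_re_le_norm _))
  have j3 := key him.max_zero fun p => (habs _).trans (Complex.abs_im_le_norm _)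
  have j4 := key him.neg.max_zero fun p => by
    simpa using (habs (-(f p).im)).trans ((abs_neg _).le.trans (Complex.abs_im_le_norm _))
  obtain ⟨l1, r1⟩ := k1 h hh j1
  obtain ⟨l2, r2⟩ := k2 h hh j2
  obtain ⟨l3, r3⟩ := k3 h hh j3
  obtain ⟨l4, r4⟩ := k4 h hh j4
  have hmax : ∀ x : ℝ, max 0 x - max 0 (-x) = x := by
    intro x; rcases le_total 0 x with h | h <;> simp [h]
  have e1 : ∀ p, f p * h (tau p) =
      ((max 0 (f p).re : ℝ) * h (tau p) - (max 0 ((-fun p => (f p).re) p) : ℝ) * h (tau p)) +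
      Complex.I * ((max 0 (f p).im : ℝ) * h (tau p) -
        (max 0 ((-fun p => (f p).im) p) : ℝ) * h (tau p)) := by
    intro p
    rw [← sub_mul, ← sub_mul, ← Complex.ofReal_sub, ← Complex.ofReal_sub, Pi.neg_apply,
      Pi.neg_apply, hmax, hmax]
    conv_lhs => rw [← Complex.re_add_im (f p)]
    ring
  have e2 : ∀ x, (m1 x - m2 x + Complex.I * (m3 x - m4 x)) * h x =
      (m1 x * h x - m2 x * h x) + Complex.I * (m3 x * h x - m4 x * h x) := by
    intro x; ring
  simp_rw [e1, e2]
  refine ⟨(l1.sub l2).add ((l3.sub l4).const_mul _), ?_⟩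
  rw [integral_sub_add_mul_sub j1 j2 j3 j4, integral_sub_add_mul_sub l1 l2 l3 l4, r1, r2, r3, r4]

/-! ### The profile of a radial function -/

/-- On the line over a fixed z, the value x = |z|⁴ + t² is attained at t = √(x - |z|⁴), so there g
is read off from the measurable function u. The exceptional set stays null because t ↦ |z|⁴ + t² is
smooth. -/
lemma aemeasurable_profile {u : Heis d → ℂ} (hu : Measurable u) {g : ℝ → ℂ}
    {z : EuclideanSpace ℝ (Fin d ⊕ Fin d)} (h : ∀ᵐ t : ℝ, u (z, t) = g (‖z‖ ^ 4 + t ^ 2)) :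
    AEMeasurable g (volume.restrict (Set.Ioi (‖z‖ ^ 4))) := by
  refine ⟨fun x => u (z, √(x - ‖z‖ ^ 4)), hu.comp (by fun_prop), ?_⟩
  rw [Filter.EventuallyEq, ae_restrict_iff' measurableSet_Ioi, ae_iff]
  have hnull : volume ((fun t : ℝ => ‖z‖ ^ 4 + t ^ 2) '' {t | ¬ u (z, t) = g (‖z‖ ^ 4 + t ^ 2)}) = 0 :=
    addHaar_image_eq_zero_of_differentiableOn_of_addHaar_eq_zero volume
      (by fun_prop) (ae_iff.1 h)
  refine measure_mono_null (fun x hx => ?_) hnull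
  simp only [Set.mem_ofPred_eq, Classical.not_imp, Set.mem_Ioi] at hx
  have hs : √(x - ‖z‖ ^ 4) ^ 2 = x - ‖z‖ ^ 4 := Real.sq_sqrt (by linarith [hx.1])
  refine ⟨√(x - ‖z‖ ^ 4), ?_, ?_⟩
  · simp only [Set.mem_ofPred_eq, hs]
    rw [add_sub_cancel]
    exact fun h => hx.2 h.symm
  · simp only [hs]; ring

/-- `IsRadial` provides a profile without any measurability. By Fubini there are good lines over
points z tending to 0, and the half-lines (|z|⁴, ∞) they control exhaust (0, ∞). -/
lemma exists_measurable_profile {u : Heis d → ℂ} (hu : AEStronglyMeasurable u volume)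
    (hr : IsRadial u) : ∃ g : ℝ → ℂ, Measurable g ∧ ∀ᵐ p : Heis d, u p = g (tau p) := by
  obtain ⟨g₁, hg₁⟩ := hr
  set g₀ : ℝ → ℂ := fun x => g₁ (x ^ (1 / 4 : ℝ)) with hg₀
  have h0 : ∀ᵐ p : Heis d, hu.mk u p = g₀ (tau p) := by
    filter_upwards [hg₁, hu.ae_eq_mk] with p h1 h2
    rw [← h2, h1]; rfl
  have h1 : ∀ᵐ z : EuclideanSpace ℝ (Fin d ⊕ Fin d), ∀ᵐ t : ℝ,
      hu.mk u (z, t) = g₀ (‖z‖ ^ 4 + t ^ 2) := Measure.ae_ae_of_ae_prod h0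
  have h2 : ∀ n : ℕ, ∃ z : EuclideanSpace ℝ (Fin d ⊕ Fin d),
      z ∈ Metric.ball 0 (1 / ((n : ℝ) + 1)) ∧
      ∀ᵐ t : ℝ, hu.mk u (z, t) = g₀ (‖z‖ ^ 4 + t ^ 2) := by
    intro n
    have : ∃ᵐ z ∂(volume : Measure (EuclideanSpace ℝ (Fin d ⊕ Fin d))),
        z ∈ Metric.ball 0 (1 / ((n : ℝ) + 1)) :=
      frequently_ae_mem_iff.2 (Metric.measure_ball_pos _ _ (by positivity)).ne'
    exact (this.and_eventually h1).exists
  choose z hz hzt using h2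
  have hcov : (⋃ n, Set.Ioi (‖z n‖ ^ 4)) = Set.Ioi (0 : ℝ) := by
    ext x
    simp only [Set.mem_iUnion, Set.mem_Ioi]
    constructor
    · rintro ⟨n, hn⟩
      exact lt_of_le_of_lt (by positivity) hn
    · intro hx
      obtain ⟨n, hn⟩ := exists_nat_one_div_lt (lt_min hx one_pos)
      refine ⟨n, ?_⟩
      have h3 : ‖z n‖ < 1 / ((n : ℝ) + 1) := by simpa using hz n
      have h4 : ‖z n‖ ≤ 1 := by linarith [min_le_right x 1]
      have h5 : ‖z n‖ ^ 4 ≤ ‖z n‖ := pow_le_of_le_one (norm_nonneg _) h4 (by norm_num)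
      linarith [min_le_left x 1]
  have h3 : AEMeasurable g₀ (volume.restrict (Set.Ioi 0)) := by
    rw [← hcov, aemeasurable_iUnion_iff]
    exact fun n => aemeasurable_profile hu.stronglyMeasurable_mk.measurable (hzt n)
  refine ⟨h3.mk g₀, h3.measurable_mk, ?_⟩
  filter_upwards [hu.ae_eq_mk, h0, ae_comp_tau h3.ae_eq_mk] with p e1 e2 e3
  rw [e1, e2, e3]

/-! ### Distributions on the half line -/

/-- Smooth functions with compact support in `(0, ∞)`. -/
structure IsTest (h : ℝ → ℝ) : Prop where
  contDiff : ContDiff ℝ ∞ h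
  compact : HasCompactSupport h
  subset : tsupport h ⊆ Set.Ioi 0

lemma exists_Ioo_of_tsupport {E : Type*} [Zero E] {h : ℝ → E} (hc : HasCompactSupport h)
    (hs : tsupport h ⊆ Set.Ioi 0) :
    ∃ a b : ℝ, 0 < a ∧ a < b ∧ ∀ x, x ∉ Set.Ioo a b → h x = 0 := by
  rcases (tsupport h).eq_empty_or_nonempty with he | hne
  · refine ⟨1, 2, one_pos, one_lt_two, fun x _ => image_eq_zero_of_notMem_tsupport ?_⟩
    rw [he]; simp
  · obtain ⟨A, hA, hAle⟩ := hc.isCompact.exists_isLeast hne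
    obtain ⟨B, hB, hBle⟩ := hc.isCompact.exists_isGreatest hne
    have hA0 : 0 < A := hs hA
    have hAB : A ≤ B := hAle hB
    refine ⟨A / 2, B + 1, by linarith, by linarith, fun x hx =>
      image_eq_zero_of_notMem_tsupport fun hxs => hx ⟨?_, ?_⟩⟩
    · linarith [hAle hxs]
    · linarith [hBle hxs]

lemma tsupport_subset_Icc {E : Type*} [Zero E] {h : ℝ → E} {a b : ℝ}
    (h0 : ∀ x, x ∉ Set.Ioo a b → h x = 0) : tsupport h ⊆ Set.Icc a b :=
  closure_minimal (fun x hx => by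
    by_contra hx'
    exact hx (h0 x fun h => hx' (Set.Ioo_subset_Icc_self h))) isClosed_Icc

lemma hasCompactSupport_of_Ioo {E : Type*} [Zero E] {h : ℝ → E} {a b : ℝ}
    (h0 : ∀ x, x ∉ Set.Ioo a b → h x = 0) : HasCompactSupport h :=
  HasCompactSupport.of_support_subset_isCompact (isCompact_Icc (a := a) (b := b))
    ((subset_tsupport h).trans (tsupport_subset_Icc h0))

lemma IsTest.of_Ioo {h : ℝ → ℝ} (hh : ContDiff ℝ ∞ h) {a b : ℝ} (ha : 0 < a)
    (h0 : ∀ x, x ∉ Set.Ioo a b → h x = 0) : IsTest h :=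
  ⟨hh, hasCompactSupport_of_Ioo h0, (tsupport_subset_Icc h0).trans fun _ hx => ha.trans_le hx.1⟩

lemma IsTest.deriv {h : ℝ → ℝ} (hh : IsTest h) : IsTest (deriv h) :=
  ⟨contDiff_deriv_infty hh.contDiff, hh.compact.deriv,
    (tsupport_deriv_subset).trans hh.subset⟩

lemma IsTest.sub {h k : ℝ → ℝ} (hh : IsTest h) (hk : IsTest k) : IsTest (fun x => h x - k x) :=
  ⟨hh.contDiff.sub hk.contDiff, hh.compact.sub hk.compact,
    (tsupport_sub h k).trans (Set.union_subset hh.subset hk.subset)⟩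

lemma IsTest.const_mul {h : ℝ → ℝ} (hh : IsTest h) (c : ℝ) : IsTest (fun x => c * h x) :=
  ⟨contDiff_const.mul hh.contDiff, hh.compact.mul_left,
    (tsupport_mul_subset_right (f := fun _ => c) (g := h)).trans hh.subset⟩

lemma contDiff_of_tsupport {E F : Type*} [NormedAddCommGroup E] [NormedSpace ℝ E]
    [NormedAddCommGroup F] [NormedSpace ℝ F] {n : WithTop ℕ∞} {f : E → F}
    (h : ∀ x ∈ tsupport f, ContDiffAt ℝ n f x) : ContDiff ℝ n f := by
  refine contDiff_iff_contDiffAt.2 fun x => ?_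
  by_cases hx : x ∈ tsupport f
  · exact h x hx
  · exact contDiffAt_const.congr_of_eventuallyEq (notMem_tsupport_iff_eventuallyEq.1 hx)

lemma IsTest.rpow_mul {h : ℝ → ℝ} (hh : IsTest h) (r : ℝ) : IsTest (fun x => x ^ r * h x) := by
  have hs : tsupport (fun x => x ^ r * h x) ⊆ tsupport h :=
    tsupport_mul_subset_right (f := fun x : ℝ => x ^ r) (g := h)
  refine ⟨contDiff_of_tsupport fun x hx => ?_, hh.compact.mul_left, hs.trans hh.subset⟩
  have hx0 : x ≠ 0 := (hh.subset (hs hx)).ne'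
  exact (Real.contDiffAt_rpow_const_of_ne hx0).mul hh.contDiff.contDiffAt

lemma IsTest.exists_integral_eq_one : ∃ θ : ℝ → ℝ, IsTest θ ∧ ∫ x, θ x = 1 := by
  let f : ContDiffBump (2 : ℝ) := ⟨1 / 2, 1, by norm_num, by norm_num⟩
  refine ⟨f.normed volume, ⟨f.contDiff_normed, f.hasCompactSupport_normed, ?_⟩, f.integral_normed⟩
  rw [f.tsupport_normed_eq, Real.closedBall_eq_Icc]
  intro x hx
  have := hx.1
  norm_num [f] at this
  exact Set.mem_Ioi.2 (by linarith)

/-- The primitive from the left end of the support is constant to the right of the support, with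
value the total integral, which is zero. -/
lemma IsTest.exists_primitive {θ : ℝ → ℝ} (hθ : IsTest θ) (h0 : ∫ x, θ x = 0) :
    ∃ k, IsTest k ∧ _root_.deriv k = θ := by
  obtain ⟨a, b, ha, hab, hz⟩ := exists_Ioo_of_tsupport hθ.compact hθ.subset
  have hcont := hθ.contDiff.continuous
  have hd : ∀ x, HasDerivAt (fun x => ∫ y in a..x, θ y) (θ x) x := fun x =>
    intervalIntegral.integral_hasDerivAt_right (hcont.intervalIntegrable _ _)
      (hcont.stronglyMeasurableAtFilter _ _) hcont.continuousAt
  have hder : _root_.deriv (fun x => ∫ y in a..x, θ y) = θ := funext fun x => (hd x).deriv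
  refine ⟨fun x => ∫ y in a..x, θ y, IsTest.of_Ioo (b := b) ?_ ha fun x hx => ?_, hder⟩
  · exact contDiff_infty_iff_deriv.2 ⟨fun x => (hd x).differentiableAt, by rw [hder]; exact hθ.contDiff⟩
  · simp only [Set.mem_Ioo, not_and_or, not_lt] at hx
    rcases hx with hx | hx
    · refine intervalIntegral.integral_zero_ae (Filter.Eventually.of_forall fun y hy => hz y ?_)
      rw [Set.uIoc_of_ge hx] at hy
      exact fun h => absurd hy.2 (not_le.2 h.1)
    · rw [intervalIntegral.integral_of_le (hab.le.trans hx),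
        setIntegral_eq_integral_of_forall_compl_eq_zero, h0]
      intro y hy
      exact hz y fun h => hy ⟨h.1, h.2.le.trans hx⟩

lemma setIntegral_Ioi_eq {E : Type*} [NormedAddCommGroup E] [NormedSpace ℝ E] {f : ℝ → E} {a b : ℝ}
    (ha : 0 < a) (hab : a ≤ b) (h0 : ∀ x, x ∉ Set.Ioo a b → f x = 0) :
    ∫ x in Set.Ioi 0, f x = ∫ x in a..b, f x := by
  rw [intervalIntegral.integral_of_le hab]
  refine setIntegral_eq_of_subset_of_forall_sdiff_eq_zero measurableSet_Ioi
    (fun x hx => ha.trans hx.1) fun x hx => h0 x fun h => hx.2 ⟨h.1, h.2.le⟩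

lemma intervalIntegrable_of_Ioi {E : Type*} [NormedAddCommGroup E] {f : ℝ → E}
    (hf : LocallyIntegrableOn f (Set.Ioi 0)) {a b : ℝ} (ha : 0 < a) (hb : 0 < b) :
    IntervalIntegrable f volume a b := by
  rw [intervalIntegrable_iff' enorm_ne_top]
  refine hf.integrableOn_compact_subset (fun x hx => ?_) isCompact_uIcc
  exact (lt_min ha hb).trans_le hx.1

/-- Integration by parts for a primitive of a locally integrable function. -/
lemma integral_primitive_mul {f F : ℝ → ℂ} (hf : LocallyIntegrableOn f (Set.Ioi 0))
    (hF : ∀ x y, 0 < x → 0 < y → F y - F x = ∫ s in x..y, f s) {w w' : ℝ → ℂ}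
    (hw : ∀ x, HasDerivAt w (w' x) x) (hw' : Continuous w') (hc : HasCompactSupport w)
    (hs : tsupport w ⊆ Set.Ioi 0) :
    ∫ x in Set.Ioi 0, F x * w' x = -∫ x in Set.Ioi 0, f x * w x := by
  obtain ⟨a, b, ha, hab, hz⟩ := exists_Ioo_of_tsupport hc hs
  have hb := ha.trans hab
  have hwc : Continuous w := continuous_iff_continuousAt.2 fun x => (hw x).continuousAt
  have hz' : ∀ x, x ∉ Set.Icc a b → w' x = 0 := by
    intro x hx
    have h1 : w =ᶠ[nhds x] fun _ => 0 := by
      filter_upwards [isClosed_Icc.isOpen_compl.mem_nhds hx] with y hy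
      exact hz y fun h => hy (Set.Ioo_subset_Icc_self h)
    rw [← (hw x).deriv, h1.deriv_eq, deriv_const]
  have e1 : ∫ x in Set.Ioi 0, f x * w x = ∫ x in a..b, f x * w x :=
    setIntegral_Ioi_eq ha hab.le fun x hx => by rw [hz x hx, mul_zero]
  have e2 : ∫ x in Set.Ioi 0, F x * w' x = ∫ x in a..b, F x * w' x := by
    rw [intervalIntegral.integral_of_le hab.le, ← integral_Icc_eq_integral_Ioc]
    exact setIntegral_eq_of_subset_of_forall_sdiff_eq_zero measurableSet_Ioi
      (fun x hx => ha.trans_le hx.1) fun x hx => by rw [hz' x hx.2, mul_zero]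
  have wi : ∀ c e, IntervalIntegrable w' volume c e := fun c e => hw'.intervalIntegrable c e
  have wa : w a = 0 := hz a (by simp)
  have wb : w b = 0 := hz b (by simp)
  have ftc : ∀ c e, ∫ x in c..e, w' x = w e - w c := fun c e =>
    intervalIntegral.integral_eq_sub_of_hasDerivAt (fun x _ => hw x) (wi c e)
  have fi := intervalIntegrable_of_Ioi hf ha hb
  have fi' : IntegrableOn f (Set.Ioc a b) := (intervalIntegrable_iff_integrableOn_Ioc_of_le hab.le).1 fi
  have wi' : IntegrableOn w' (Set.Ioc a b) :=
    (intervalIntegrable_iff_integrableOn_Ioc_of_le hab.le).1 (wi a b)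
  -- Fubini for w'(x) f(y) on the triangle y ≤ x. Integrating in y first gives (F x - F a) w' x;
  -- integrating in x first gives -f y w y, because w b = 0. No differentiability of F is needed.
  have prodInt : Integrable (Function.uncurry fun x y =>
      Set.indicator {q : ℝ × ℝ | q.2 ≤ q.1} (fun q => w' q.1 * f q.2) (x, y))
      ((volume.restrict (Set.Ioc a b)).prod (volume.restrict (Set.Ioc a b))) :=
    (wi'.mul_prod fi').indicator (measurableSet_le measurable_snd measurable_fst)
  have swap := integral_integral_swap prodInt
  have left : ∀ x ∈ Set.Ioc a b, (∫ y in Set.Ioc a b,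
      Set.indicator {q : ℝ × ℝ | q.2 ≤ q.1} (fun q => w' q.1 * f q.2) (x, y)) =
      (F x - F a) * w' x := by
    intro x hx
    have : ∀ y, Set.indicator {q : ℝ × ℝ | q.2 ≤ q.1} (fun q => w' q.1 * f q.2) (x, y) =
        Set.indicator (Set.Iic x) (fun y => w' x * f y) y := by
      intro y; simp only [Set.indicator, Set.mem_ofPred_eq, Set.mem_Iic]
    simp_rw [this]
    rw [integral_indicator measurableSet_Iic, Measure.restrict_restrict measurableSet_Iic,
      show Set.Iic x ∩ Set.Ioc a b = Set.Ioc a x by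
        ext y; simp only [Set.mem_inter_iff, Set.mem_Iic, Set.mem_Ioc]
        exact ⟨fun h => ⟨h.2.1, h.1⟩, fun h => ⟨h.2, h.1, h.2.trans hx.2⟩⟩,
      integral_const_mul, hF a x ha (ha.trans hx.1), intervalIntegral.integral_of_le hx.1.le, mul_comm]
  have right : ∀ y ∈ Set.Ioc a b, (∫ x in Set.Ioc a b,
      Set.indicator {q : ℝ × ℝ | q.2 ≤ q.1} (fun q => w' q.1 * f q.2) (x, y)) =
      -(f y * w y) := by
    intro y hy
    have : ∀ x, Set.indicator {q : ℝ × ℝ | q.2 ≤ q.1} (fun q => w' q.1 * f q.2) (x, y) =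
        Set.indicator (Set.Ici y) (fun x => w' x * f y) x := by
      intro x; simp only [Set.indicator, Set.mem_ofPred_eq, Set.mem_Ici]
    simp_rw [this]
    rw [integral_indicator measurableSet_Ici, Measure.restrict_restrict measurableSet_Ici,
      show Set.Ici y ∩ Set.Ioc a b = Set.Icc y b by
        ext x; simp only [Set.mem_inter_iff, Set.mem_Ici, Set.mem_Ioc, Set.mem_Icc]
        exact ⟨fun h => ⟨h.1, h.2.2⟩, fun h => ⟨h.1, hy.1.trans_le h.1, h.2⟩⟩,
      integral_Icc_eq_integral_Ioc, integral_mul_const,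
      ← intervalIntegral.integral_of_le hy.2, ftc, wb]
    ring
  rw [setIntegral_congr_fun measurableSet_Ioc left, setIntegral_congr_fun measurableSet_Ioc right,
    integral_neg, ← intervalIntegral.integral_of_le hab.le,
    ← intervalIntegral.integral_of_le hab.le] at swap
  rw [e1, e2, ← swap]
  have hFc : ContinuousOn F (Set.uIcc a b) := by
    have h1 : ContinuousOn (fun x => F a + ∫ s in a..x, f s) (Set.uIcc a b) :=
      continuousOn_const.add
        (intervalIntegral.continuousOn_primitive_interval ((intervalIntegrable_iff' enorm_ne_top).1 fi))
    refine h1.congr fun x hx => ?_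
    rw [Set.uIcc_of_le hab.le] at hx
    simp only [← hF a x ha (ha.trans_le hx.1), add_sub_cancel]
  have i1 : IntervalIntegrable (fun x => F x * w' x) volume a b :=
    (hFc.mul hw'.continuousOn).intervalIntegrable
  have i2 : IntervalIntegrable (fun x => F a * w' x) volume a b := (wi a b).const_mul _
  simp_rw [sub_mul]
  rw [intervalIntegral.integral_sub i1 i2, intervalIntegral.integral_const_mul, ftc, wa, wb]
  simp

lemma integrableOn_mul_of_hasCompactSupport {e k : ℝ → ℂ} (he : LocallyIntegrableOn e (Set.Ioi 0))
    (hk : Continuous k) (hc : HasCompactSupport k) (hs : tsupport k ⊆ Set.Ioi 0) :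
    IntegrableOn (fun x => e x * k x) (Set.Ioi 0) := by
  obtain ⟨a, b, ha, hab, hz⟩ := exists_Ioo_of_tsupport hc hs
  have h1 : IntegrableOn e (Set.Icc a b) :=
    he.integrableOn_compact_subset (fun x hx => ha.trans_le hx.1) isCompact_Icc
  have h2 : IntegrableOn (fun x => e x * k x) (Set.Icc a b) :=
    h1.mul_continuousOn hk.continuousOn isCompact_Icc
  refine h2.of_forall_sdiff_eq_zero measurableSet_Ioi fun x hx => ?_
  rw [hz x fun h => hx.2 (Set.Ioo_subset_Icc_self h), mul_zero]

lemma tsupport_ofReal_subset (k : ℝ → ℝ) : tsupport (fun x => (k x : ℂ)) ⊆ tsupport k :=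
  closure_mono fun x hx h => hx (by simp [h])

lemma IsTest.integrableOn {e : ℝ → ℂ} (he : LocallyIntegrableOn e (Set.Ioi 0)) {k : ℝ → ℝ}
    (hk : IsTest k) : IntegrableOn (fun x => e x * (k x : ℂ)) (Set.Ioi 0) := by
  exact integrableOn_mul_of_hasCompactSupport he
    (Complex.continuous_ofReal.comp hk.contDiff.continuous)
    (hk.compact.comp_left (g := fun x : ℝ => (x : ℂ)) (by simp)) ((tsupport_ofReal_subset k).trans hk.subset)

/-- The lemma of du Bois-Reymond. -/
lemma exists_eq_const_of_integral_deriv {e : ℝ → ℂ} (he : LocallyIntegrableOn e (Set.Ioi 0))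
    (h : ∀ k, IsTest k → ∫ x in Set.Ioi 0, e x * ((deriv k x : ℝ) : ℂ) = 0) :
    ∃ c : ℂ, ∀ᵐ x ∂(volume.restrict (Set.Ioi (0 : ℝ))), e x = c := by
  obtain ⟨θ₀, hθ₀, h1⟩ := IsTest.exists_integral_eq_one
  refine ⟨∫ x in Set.Ioi 0, e x * (θ₀ x : ℂ), ?_⟩
  set c := ∫ x in Set.Ioi 0, e x * (θ₀ x : ℂ) with hc
  have hl : LocallyIntegrableOn (fun x => e x - c) (Set.Ioi 0) :=
    he.sub (locallyIntegrableOn_const c)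
  have := isOpen_Ioi.ae_eq_zero_of_integral_contDiff_smul_eq_zero hl fun θ hθ hθc hθs => by
    have ht : IsTest θ := ⟨hθ, hθc, hθs⟩
    have hzero : ∀ x ∉ Set.Ioi (0 : ℝ), θ x = 0 := fun x hx =>
      image_eq_zero_of_notMem_tsupport fun h => hx (hθs h)
    have hzero₀ : ∀ x ∉ Set.Ioi (0 : ℝ), θ₀ x = 0 := fun x hx =>
      image_eq_zero_of_notMem_tsupport fun h => hx (hθ₀.subset h)
    have hI : ∫ x, θ x = ∫ x in Set.Ioi 0, θ x :=
      (setIntegral_eq_integral_of_forall_compl_eq_zero hzero).symm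
    -- Subtracting the right multiple of θ₀ makes the mean zero, so the difference is the derivative
    -- of a test function.
    obtain ⟨k, hk, hkd⟩ := (ht.sub (hθ₀.const_mul (∫ x, θ x))).exists_primitive (by
      rw [integral_sub (ht.contDiff.continuous.integrable_of_hasCompactSupport ht.compact)
        ((hθ₀.contDiff.continuous.integrable_of_hasCompactSupport hθ₀.compact).const_mul _),
        integral_const_mul, h1]
      ring)
    have h2 := h k hk
    rw [hkd] at h2
    have i1 := ht.integrableOn he
    have i2 := hθ₀.integrableOn he
    have i3 : IntegrableOn (fun x => (c * (θ x : ℂ))) (Set.Ioi 0) :=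
      ht.integrableOn (locallyIntegrableOn_const c)
    have e1 : ∀ x, e x * (((θ x - (∫ x, θ x) * θ₀ x : ℝ)) : ℂ) =
        e x * (θ x : ℂ) - ((∫ x, θ x : ℝ) : ℂ) * (e x * (θ₀ x : ℂ)) := by
      intro x; push_cast; ring
    simp_rw [e1] at h2
    rw [integral_sub i1 (i2.const_mul _), integral_const_mul, ← hc] at h2
    have e2 : ∀ x, θ x • (e x - c) = e x * (θ x : ℂ) - c * (θ x : ℂ) := by
      intro x; rw [Complex.real_smul]; ring
    rw [← setIntegral_eq_integral_of_forall_compl_eq_zero (s := Set.Ioi (0 : ℝ))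
      fun x hx => by rw [hzero x hx, zero_smul]]
    simp_rw [e2]
    rw [integral_sub i1 i3, integral_const_mul, integral_complex_ofReal, ← hI,
      sub_eq_zero.1 h2, mul_comm, sub_self]
  rw [ae_restrict_iff' measurableSet_Ioi]
  filter_upwards [this] with x hx h0
  exact sub_eq_zero.1 (hx h0)

lemma ae_eq_zero_of_integral_test {e : ℝ → ℂ} (he : LocallyIntegrableOn e (Set.Ioi 0))
    (h : ∀ k, IsTest k → ∫ x in Set.Ioi 0, e x * (k x : ℂ) = 0) :
    ∀ᵐ x ∂(volume.restrict (Set.Ioi (0 : ℝ))), e x = 0 := by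
  have := isOpen_Ioi.ae_eq_zero_of_integral_contDiff_smul_eq_zero he fun θ hθ hθc hθs => by
    rw [← setIntegral_eq_integral_of_forall_compl_eq_zero (s := Set.Ioi (0 : ℝ)) fun x hx => by
      rw [image_eq_zero_of_notMem_tsupport fun h => hx (hθs h), zero_smul]]
    simpa [mul_comm] using h θ ⟨hθ, hθc, hθs⟩
  rw [ae_restrict_iff' measurableSet_Ioi]
  exact this

/-! ### Second-order equations on the half line: regularity and uniqueness -/

lemma hasDerivAt_primitive_Ioi {f : ℝ → ℂ} (hf : ContinuousOn f (Set.Ioi 0)) {x : ℝ} (hx : 0 < x) :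
    HasDerivAt (fun y => ∫ s in (1 : ℝ)..y, f s) (f x) x := by
  have hc : ContinuousAt f x := hf.continuousAt (Ioi_mem_nhds hx)
  refine intervalIntegral.integral_hasDerivAt_right ?_ ?_ hc
  · exact intervalIntegrable_of_Ioi (hf.locallyIntegrableOn measurableSet_Ioi) one_pos hx
  · exact hf.stronglyMeasurableAtFilter isOpen_Ioi x hx

lemma integral_sub_integral_Ioi {f : ℝ → ℂ} (hf : LocallyIntegrableOn f (Set.Ioi 0)) (x y : ℝ)
    (hx : 0 < x) (hy : 0 < y) :
    (∫ s in (1 : ℝ)..y, f s) - ∫ s in (1 : ℝ)..x, f s = ∫ s in x..y, f s :=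
  intervalIntegral.integral_interval_sub_left (intervalIntegrable_of_Ioi hf one_pos hy)
    (intervalIntegrable_of_Ioi hf one_pos hx)

lemma continuousOn_of_primitive {f F : ℝ → ℂ} (hf : LocallyIntegrableOn f (Set.Ioi 0))
    (hF : ∀ x y, 0 < x → 0 < y → F y - F x = ∫ s in x..y, f s) : ContinuousOn F (Set.Ioi 0) := by
  intro x hx
  have hx0 : (0 : ℝ) < x := hx
  refine ContinuousAt.continuousWithinAt ?_
  have hi : IntervalIntegrable f volume (x / 2) (x + 1) :=
    intervalIntegrable_of_Ioi hf (by linarith) (by linarith)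
  have h1 : ContinuousOn (fun y => F (x / 2) + ∫ s in (x / 2)..y, f s)
      (Set.uIcc (x / 2) (x + 1)) :=
    continuousOn_const.add (intervalIntegral.continuousOn_primitive_interval
      ((intervalIntegrable_iff' enorm_ne_top).1 hi))
  have hmem : Set.uIcc (x / 2) (x + 1) ∈ nhds x := by
    rw [Set.uIcc_of_le (by linarith)]
    exact Icc_mem_nhds (by linarith) (by linarith)
  refine (h1.continuousAt hmem).congr ?_
  filter_upwards [Ioi_mem_nhds hx0] with y hy
  rw [← hF (x / 2) y (by linarith) hy, add_sub_cancel]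

lemma IsTest.hasDerivAt_ofReal {k : ℝ → ℝ} (hk : IsTest k) (x : ℝ) :
    HasDerivAt (fun x => (k x : ℂ)) ((_root_.deriv k x : ℝ) : ℂ) x :=
  ((hk.contDiff.differentiable (by simp) x).hasDerivAt).ofReal_comp

lemma IsTest.integral_primitive_mul {f F : ℝ → ℂ} (hf : LocallyIntegrableOn f (Set.Ioi 0))
    (hF : ∀ x y, 0 < x → 0 < y → F y - F x = ∫ s in x..y, f s) {k : ℝ → ℝ} (hk : IsTest k) :
    ∫ x in Set.Ioi 0, F x * ((_root_.deriv k x : ℝ) : ℂ) = -∫ x in Set.Ioi 0, f x * (k x : ℂ) :=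
  Heis.integral_primitive_mul hf hF hk.hasDerivAt_ofReal
    (Complex.continuous_ofReal.comp hk.deriv.contDiff.continuous)
    (hk.compact.comp_left (g := fun x : ℝ => (x : ℂ)) (by simp))
    ((tsupport_ofReal_subset k).trans hk.subset)

/-- Regularity of weak solutions of `(x^a g')' = f` on the half line. -/
lemma exists_regular_solution {g f : ℝ → ℂ} (hg : LocallyIntegrableOn g (Set.Ioi 0))
    (hf : LocallyIntegrableOn f (Set.Ioi 0)) (a : ℝ)
    (h : ∀ k, IsTest k → ∫ x in Set.Ioi 0, g x *
      ((x ^ (a - 1) * (x * deriv (deriv k) x + a * deriv k x) : ℝ) : ℂ) =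
      ∫ x in Set.Ioi 0, f x * (k x : ℂ)) :
    ∃ G K : ℝ → ℂ, (∀ x, 0 < x → HasDerivAt G (K x * ((x ^ (-a) : ℝ) : ℂ)) x) ∧
      (∀ x y, 0 < x → 0 < y → K y - K x = ∫ s in x..y, f s) ∧
      ∀ᵐ x ∂(volume.restrict (Set.Ioi (0 : ℝ))), g x = G x := by
  have cp : ContinuousOn (fun x : ℝ => ((x ^ (-a) : ℝ) : ℂ)) (Set.Ioi 0) :=
    Complex.continuous_ofReal.comp_continuousOn
      (continuousOn_id.rpow_const fun x hx => Or.inl (ne_of_gt hx))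
  set F : ℝ → ℂ := fun x => ∫ s in (1 : ℝ)..x, f s with hFdef
  have hF := integral_sub_integral_Ioi hf
  have cF : ContinuousOn F (Set.Ioi 0) := continuousOn_of_primitive hf hF
  have cFp : ContinuousOn (fun x => F x * ((x ^ (-a) : ℝ) : ℂ)) (Set.Ioi 0) := cF.mul cp
  have lFp := cFp.locallyIntegrableOn (μ := volume) measurableSet_Ioi
  have lp := cp.locallyIntegrableOn (μ := volume) measurableSet_Ioi
  -- Φ solves (x^a Φ')' = f and P solves the homogeneous equation. The aim is g = Φ - b P + c almost
  -- everywhere.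
  set Φ : ℝ → ℂ := fun x => ∫ s in (1 : ℝ)..x, F s * ((s ^ (-a) : ℝ) : ℂ) with hΦdef
  set P : ℝ → ℂ := fun x => ∫ s in (1 : ℝ)..x, ((s ^ (-a) : ℝ) : ℂ) with hPdef
  have hΦ := integral_sub_integral_Ioi lFp
  have hP := integral_sub_integral_Ioi lp
  have lΦ := (continuousOn_of_primitive lFp hΦ).locallyIntegrableOn (μ := volume) measurableSet_Ioi
  have lP := (continuousOn_of_primitive lp hP).locallyIntegrableOn (μ := volume) measurableSet_Ioi
  -- Under this condition x^(-a) k = q' for a test function q. Then k' = (x^a q')' is the expression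
  -- the hypothesis tests g against, and g and Φ give the same value.
  have step1 : ∀ k, IsTest k → ∫ x, x ^ (-a) * k x = 0 →
      ∫ x in Set.Ioi 0, (g x - Φ x) * ((deriv k x : ℝ) : ℂ) = 0 := by
    intro k hk hk0
    obtain ⟨q, hq, hqd⟩ := (hk.rpow_mul (-a)).exists_primitive hk0
    have hkq : ∀ x, 0 < x → k x = x ^ a * deriv q x := by
      intro x hx
      rw [hqd, ← mul_assoc, ← Real.rpow_add hx]; simp
    have hkd : ∀ x, 0 < x → deriv k x = x ^ (a - 1) * (x * deriv (deriv q) x + a * deriv q x) := by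
      intro x hx
      have h1 : k =ᶠ[nhds x] fun x => x ^ a * deriv q x := by
        filter_upwards [Ioi_mem_nhds hx] with y hy using hkq y hy
      have h2 : HasDerivAt (fun x : ℝ => x ^ a * deriv q x)
          (a * x ^ (a - 1) * deriv q x + x ^ a * deriv (deriv q) x) x :=
        (Real.hasDerivAt_rpow_const (Or.inl hx.ne')).mul
          ((hq.deriv.contDiff.differentiable (by simp) x).hasDerivAt)
      rw [h1.deriv_eq, h2.deriv, show x ^ a = x ^ (a - 1) * x by
        rw [Real.rpow_sub_one hx.ne']; field_simp]
      ring
    have h3 := h q hq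
    have h4 : ∫ x in Set.Ioi 0, g x * ((deriv k x : ℝ) : ℂ) = ∫ x in Set.Ioi 0, f x * (q x : ℂ) := by
      rw [← h3]
      refine setIntegral_congr_fun measurableSet_Ioi fun x hx => ?_
      simp only [hkd x hx]
    have h5 : ∫ x in Set.Ioi 0, f x * (q x : ℂ) =
        -∫ x in Set.Ioi 0, F x * ((deriv q x : ℝ) : ℂ) := by
      rw [hq.integral_primitive_mul hf hF, neg_neg]
    have h6 : ∫ x in Set.Ioi 0, Φ x * ((deriv k x : ℝ) : ℂ) =
        -∫ x in Set.Ioi 0, F x * ((deriv q x : ℝ) : ℂ) := by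
      rw [hk.integral_primitive_mul lFp hΦ]
      congr 1
      refine setIntegral_congr_fun measurableSet_Ioi fun x _ => ?_
      simp only [hqd]
      push_cast
      ring
    simp_rw [sub_mul]
    rw [integral_sub (hk.deriv.integrableOn hg) (hk.deriv.integrableOn lΦ), h4, h5, h6, sub_self]
  obtain ⟨θ₁, hθ₁, h1⟩ := IsTest.exists_integral_eq_one
  have hθ₀ := hθ₁.rpow_mul a
  set θ₀ : ℝ → ℝ := fun x => x ^ a * θ₁ x with hθ₀def
  have h1' : ∫ x, x ^ (-a) * θ₀ x = 1 := by
    rw [← h1]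
    refine integral_congr_ae (Filter.Eventually.of_forall fun x => ?_)
    by_cases hx : 0 < x
    · simp only [hθ₀def]
      rw [← mul_assoc, ← Real.rpow_add hx]; simp
    · have : θ₁ x = 0 := image_eq_zero_of_notMem_tsupport fun h => hx (hθ₁.subset h)
      simp [hθ₀def, this]
  -- For general k, subtracting J θ₀ with J = ∫ x^(-a) k restores the condition of `step1`, at the
  -- cost of the term J b. Since J = -∫ P k', adding b P to g - Φ absorbs it.
  set b : ℂ := ∫ x in Set.Ioi 0, (g x - Φ x) * ((deriv θ₀ x : ℝ) : ℂ) with hb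
  have lgΦ : LocallyIntegrableOn (fun x => g x - Φ x) (Set.Ioi 0) := hg.sub lΦ
  have lE : LocallyIntegrableOn (fun x => g x - Φ x + b * P x) (Set.Ioi 0) :=
    lgΦ.add ((continuousOn_const.mul (continuousOn_of_primitive lp hP)).locallyIntegrableOn
      measurableSet_Ioi)
  obtain ⟨c, hc⟩ := exists_eq_const_of_integral_deriv lE fun k hk => by
    set J : ℝ := ∫ x, x ^ (-a) * k x with hJ
    have hk' := hk.sub (hθ₀.const_mul J)
    have hint : ∀ q, IsTest q → Integrable q := fun q hq =>
      hq.contDiff.continuous.integrable_of_hasCompactSupport hq.compact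
    have h2 := step1 _ hk' (by
      have : ∀ x, x ^ (-a) * (k x - J * θ₀ x) = x ^ (-a) * k x - J * (x ^ (-a) * θ₀ x) := by
        intro x; ring
      simp_rw [this]
      rw [integral_sub (hint _ (hk.rpow_mul _)) ((hint _ (hθ₀.rpow_mul _)).const_mul J),
        integral_const_mul, h1', ← hJ]
      ring)
    have hd : ∀ x, deriv (fun x => k x - J * θ₀ x) x = deriv k x - J * deriv θ₀ x := by
      intro x
      have d1 := hk.contDiff.differentiable (by simp) x
      have d2 := hθ₀.contDiff.differentiable (by simp) x
      rw [deriv_fun_sub d1 (d2.const_mul J), deriv_const_mul _ d2]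
    have e1 : ∀ x, (g x - Φ x) * ((deriv (fun x => k x - J * θ₀ x) x : ℝ) : ℂ) =
        (g x - Φ x) * ((deriv k x : ℝ) : ℂ) - (J : ℂ) * ((g x - Φ x) * ((deriv θ₀ x : ℝ) : ℂ)) := by
      intro x; rw [hd]; push_cast; ring
    simp_rw [e1] at h2
    rw [integral_sub (hk.deriv.integrableOn lgΦ)
      ((hθ₀.deriv.integrableOn lgΦ).const_mul _), integral_const_mul, ← hb] at h2
    have h3 := hk.integral_primitive_mul lp hP
    have h4 : ∫ x in Set.Ioi 0, ((x ^ (-a) : ℝ) : ℂ) * (k x : ℂ) = (J : ℂ) := by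
      have h5 : ∫ x in Set.Ioi 0, x ^ (-a) * k x = J :=
        setIntegral_eq_integral_of_forall_compl_eq_zero fun x hx => by
          rw [image_eq_zero_of_notMem_tsupport fun h => hx (hk.subset h), mul_zero]
      rw [← h5, ← integral_complex_ofReal]
      push_cast
      rfl
    have e2 : ∀ x, (g x - Φ x + b * P x) * ((deriv k x : ℝ) : ℂ) =
        (g x - Φ x) * ((deriv k x : ℝ) : ℂ) + b * (P x * ((deriv k x : ℝ) : ℂ)) := by
      intro x; ring
    simp_rw [e2]
    rw [integral_add (hk.deriv.integrableOn lgΦ) ((hk.deriv.integrableOn lP).const_mul _),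
      integral_const_mul, h3, h4]
    linear_combination h2
  refine ⟨fun x => Φ x - b * P x + c, fun x => F x - b, fun x hx => ?_, fun x y hx hy => ?_, ?_⟩
  · have h1 := hasDerivAt_primitive_Ioi cFp hx
    have h2 := hasDerivAt_primitive_Ioi cp hx
    exact ((h1.sub (h2.const_mul b)).add_const c).congr_deriv (by ring)
  · rw [← hF x y hx hy]; ring
  · filter_upwards [hc] with x hx
    rw [← hx]; ring

/-- Uniqueness for the initial value problem `G' = K x^(-a)`, `K' = m G`. -/
lemma eq_zero_of_initial {G K m : ℝ → ℂ} {a : ℝ} (hm : LocallyIntegrableOn m (Set.Ioi 0))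
    (hG : ∀ x, 0 < x → HasDerivAt G (K x * ((x ^ (-a) : ℝ) : ℂ)) x)
    (hK : ∀ x y, 0 < x → 0 < y → K y - K x = ∫ s in x..y, m s * G s)
    (hKc : ContinuousOn K (Set.Ioi 0)) {x₀ : ℝ} (hx₀ : 0 < x₀) (hG0 : G x₀ = 0) (hK0 : K x₀ = 0) :
    ∀ x, 0 < x → G x = 0 := by
  have hGc : ContinuousOn G (Set.Ioi 0) := fun x hx => (hG x hx).continuousAt.continuousWithinAt
  set Y : ℝ → ℝ := fun x => ‖G x‖ + ‖K x‖ with hY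
  have hYc : ContinuousOn Y (Set.Ioi 0) := hGc.norm.add hKc.norm
  have cp : ContinuousOn (fun x : ℝ => x ^ (-a)) (Set.Ioi 0) :=
    continuousOn_id.rpow_const fun x hx => Or.inl (ne_of_gt hx)
  have lp := cp.locallyIntegrableOn (μ := volume) measurableSet_Ioi
  -- The zero set of Y is open. On an interval around z so short that |m| + s^(-a) integrates to
  -- less than 1/2 from z, the integral equations bound the maximum of Y by half of itself.
  have hloc : ∀ z, 0 < z → Y z = 0 → ∀ᶠ x in nhds z, Y x = 0 := by
    intro z hz hYz
    have hGz : G z = 0 := by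
      have := norm_nonneg (G z); have := norm_nonneg (K z)
      exact norm_eq_zero.1 (by simp only [hY] at hYz; linarith)
    have hKz : K z = 0 := by
      have := norm_nonneg (G z); have := norm_nonneg (K z)
      exact norm_eq_zero.1 (by simp only [hY] at hYz; linarith)
    have hwi : ∀ u v, 0 < u → 0 < v → IntervalIntegrable (fun s => ‖m s‖ + s ^ (-a)) volume u v :=
      fun u v hu hv => (intervalIntegrable_of_Ioi hm hu hv).norm.add
        (intervalIntegrable_of_Ioi lp hu hv)
    have hIc : ContinuousAt (fun x => ∫ s in z..x, (‖m s‖ + s ^ (-a))) z := by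
      have hi := hwi (z / 2) (z + 1) (by linarith) (by linarith)
      have h1 : ContinuousOn (fun x => ∫ s in z..x, (‖m s‖ + s ^ (-a)))
          (Set.uIcc (z / 2) (z + 1)) := by
        refine intervalIntegral.continuousOn_primitive_interval'
          hi ?_
        rw [Set.uIcc_of_le (by linarith)]
        exact ⟨by linarith, by linarith⟩
      refine h1.continuousAt ?_
      rw [Set.uIcc_of_le (by linarith)]
      exact Icc_mem_nhds (by linarith) (by linarith)
    have hsmall : ∀ᶠ x in nhds z, |∫ s in z..x, (‖m s‖ + s ^ (-a))| < 1 / 2 ∧ 0 < x := by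
      have h1 := hIc.abs.tendsto
      simp only [intervalIntegral.integral_same, abs_zero] at h1
      exact (h1.eventually (gt_mem_nhds (by norm_num))).and (lt_mem_nhds hz)
    obtain ⟨δ, hδ, hball⟩ := Metric.eventually_nhds_iff_ball.1 hsmall
    have hsub : Set.Icc (z - δ / 2) (z + δ / 2) ⊆ Metric.ball z δ := by
      intro x hx
      rw [Metric.mem_ball, Real.dist_eq, abs_lt]
      constructor <;> linarith [hx.1, hx.2]
    obtain ⟨xm, hxm, hmax⟩ := (isCompact_Icc (a := z - δ / 2) (b := z + δ / 2)).exists_isMaxOn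
      ⟨z, by constructor <;> linarith⟩ (hYc.mono fun x hx => (hball x (hsub hx)).2)
    have hxm0 := (hball xm (hsub hxm)).2
    have hYn : 0 ≤ Y xm := by simp only [hY]; positivity
    have hin : ∀ s ∈ Set.uIoc z xm, 0 < s ∧ Y s ≤ Y xm := by
      intro s hs
      have : s ∈ Set.Icc (z - δ / 2) (z + δ / 2) := by
        rcases le_total z xm with h | h
        · rw [Set.uIoc_of_le h] at hs
          exact ⟨by linarith [hs.1], hs.2.trans hxm.2⟩
        · rw [Set.uIoc_of_ge h] at hs
          exact ⟨by linarith [hs.1, hxm.1], by linarith [hs.2]⟩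
      exact ⟨(hball s (hsub this)).2, hmax this⟩
    have hGb : ‖G xm‖ ≤ |∫ s in z..xm, s ^ (-a) * Y xm| := by
      have h1 : ∫ s in z..xm, K s * ((s ^ (-a) : ℝ) : ℂ) = G xm - G z := by
        refine intervalIntegral.integral_eq_sub_of_hasDerivAt (fun s hs => hG s ?_) ?_
        · rcases le_total z xm with h | h
          · rw [Set.uIcc_of_le h] at hs; exact hz.trans_le hs.1
          · rw [Set.uIcc_of_ge h] at hs; exact hxm0.trans_le hs.1
        · refine intervalIntegrable_of_Ioi (ContinuousOn.locallyIntegrableOn ?_ measurableSet_Ioi) hz hxm0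
          exact hKc.mul (Complex.continuous_ofReal.comp_continuousOn cp)
      rw [hGz, sub_zero] at h1
      rw [← h1]
      refine intervalIntegral.norm_integral_le_abs_of_norm_le ?_
        ((intervalIntegrable_of_Ioi lp hz hxm0).mul_const _)
      filter_upwards [ae_restrict_mem measurableSet_uIoc] with s hs
      obtain ⟨hs0, hsY⟩ := hin s hs
      rw [norm_mul, Complex.norm_real, Real.norm_eq_abs, abs_of_nonneg (Real.rpow_nonneg hs0.le _),
        mul_comm]
      refine mul_le_mul_of_nonneg_left (le_trans ?_ hsY) (Real.rpow_nonneg hs0.le _)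
      simp only [hY]; linarith [norm_nonneg (G s)]
    have hKb : ‖K xm‖ ≤ |∫ s in z..xm, ‖m s‖ * Y xm| := by
      have h1 := hK z xm hz hxm0
      rw [hKz, sub_zero] at h1
      rw [h1]
      refine intervalIntegral.norm_integral_le_abs_of_norm_le ?_
        ((intervalIntegrable_of_Ioi hm hz hxm0).norm.mul_const _)
      filter_upwards [ae_restrict_mem measurableSet_uIoc] with s hs
      obtain ⟨hs0, hsY⟩ := hin s hs
      rw [norm_mul]
      refine mul_le_mul_of_nonneg_left (le_trans ?_ hsY) (norm_nonneg _)
      simp only [hY]; linarith [norm_nonneg (K s)]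
    have hsum : |∫ s in z..xm, s ^ (-a) * Y xm| + |∫ s in z..xm, ‖m s‖ * Y xm| =
        |∫ s in z..xm, (‖m s‖ + s ^ (-a))| * Y xm := by
      rw [intervalIntegral.integral_mul_const, intervalIntegral.integral_mul_const, abs_mul, abs_mul,
        abs_of_nonneg hYn, intervalIntegral.integral_add (intervalIntegrable_of_Ioi hm hz hxm0).norm
          (intervalIntegrable_of_Ioi lp hz hxm0), ← add_mul]
      congr 1
      rcases le_total z xm with h | h
      · have p1 : 0 ≤ ∫ s in z..xm, s ^ (-a) := intervalIntegral.integral_nonneg h fun s hs =>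
          Real.rpow_nonneg (hz.le.trans hs.1) _
        have p2 : 0 ≤ ∫ s in z..xm, ‖m s‖ := intervalIntegral.integral_nonneg h fun s _ =>
          norm_nonneg _
        rw [abs_of_nonneg p1, abs_of_nonneg p2, abs_of_nonneg (add_nonneg p2 p1), add_comm]
      · have p1 : 0 ≤ ∫ s in xm..z, s ^ (-a) := intervalIntegral.integral_nonneg h fun s hs =>
          Real.rpow_nonneg (hxm0.le.trans hs.1) _
        have p2 : 0 ≤ ∫ s in xm..z, ‖m s‖ := intervalIntegral.integral_nonneg h fun s _ =>
          norm_nonneg _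
        rw [intervalIntegral.integral_symm xm z, intervalIntegral.integral_symm xm z, abs_neg,
          abs_of_nonneg p1, abs_neg, abs_of_nonneg p2, ← neg_add, abs_neg,
          abs_of_nonneg (add_nonneg p2 p1), add_comm]
    have hYm : Y xm ≤ |∫ s in z..xm, (‖m s‖ + s ^ (-a))| * Y xm := by
      rw [← hsum]; exact add_le_add hGb hKb
    have hlt := (hball xm (hsub hxm)).1
    have hYm0 : Y xm ≤ 0 := by nlinarith
    filter_upwards [Icc_mem_nhds (show z - δ / 2 < z by linarith) (show z < z + δ / 2 by linarith)]
      with x hx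
    have h1 : Y x ≤ Y xm := hmax hx
    have h2 : 0 ≤ Y x := by simp only [hY]; positivity
    linarith
  have hcl : IsClopen {x : Set.Ioi (0 : ℝ) | Y x = 0} := by
    constructor
    · exact isClosed_singleton.preimage (continuousOn_iff_continuous_domRestrict.1 hYc)
    · refine isOpen_iff_mem_nhds.2 fun x hx => ?_
      exact continuous_subtype_val.continuousAt (hloc x x.2 hx)
  have : PreconnectedSpace (Set.Ioi (0 : ℝ)) := Subtype.preconnectedSpace isPreconnected_Ioi
  have huniv := hcl.eq_univ ⟨⟨x₀, hx₀⟩, by simp [hY, hG0, hK0]⟩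
  intro x hx
  have hx' : (⟨x, hx⟩ : Set.Ioi (0 : ℝ)) ∈ {x : Set.Ioi (0 : ℝ) | Y x = 0} := huniv ▸ Set.mem_univ _
  have h1 : ‖G x‖ + ‖K x‖ = 0 := hx'
  exact norm_eq_zero.1 (by linarith [norm_nonneg (G x), norm_nonneg (K x)])

/-- The zeros of a nontrivial solution form a null set. -/
lemma ae_ne_zero_of_solution {G K m : ℝ → ℂ} {a : ℝ} (hm : LocallyIntegrableOn m (Set.Ioi 0))
    (hG : ∀ x, 0 < x → HasDerivAt G (K x * ((x ^ (-a) : ℝ) : ℂ)) x)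
    (hK : ∀ x y, 0 < x → 0 < y → K y - K x = ∫ s in x..y, m s * G s)
    (hKc : ContinuousOn K (Set.Ioi 0)) (hne : ∃ x, 0 < x ∧ G x ≠ 0) :
    ∀ᵐ x ∂(volume.restrict (Set.Ioi (0 : ℝ))), G x ≠ 0 := by
  rw [ae_restrict_iff' measurableSet_Ioi, ae_iff]
  refine measure_null_of_locally_null _ fun x hx => ?_
  simp only [Set.mem_ofPred_eq, Classical.not_imp, not_not, Set.mem_Ioi] at hx
  obtain ⟨hx0, hGx⟩ := hx
  -- At a zero of G the flux cannot vanish too, by uniqueness. So G' ≠ 0 there and the zero is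
  -- isolated; a set of isolated points is locally null.
  have hKx : K x ≠ 0 := by
    intro hKx
    obtain ⟨y, hy, hGy⟩ := hne
    exact hGy (eq_zero_of_initial hm hG hK hKc hx0 hGx hKx y hy)
  have hd : K x * ((x ^ (-a) : ℝ) : ℂ) ≠ 0 :=
    mul_ne_zero hKx (by exact_mod_cast (Real.rpow_pos_of_pos hx0 _).ne')
  have hev := (hG x hx0).eventually_ne (c := 0) hd
  refine ⟨{x}, ?_, by simp⟩
  rw [eventually_nhdsWithin_iff] at hev
  rw [mem_nhdsWithin_iff_eventually]
  filter_upwards [hev] with y hy hyS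
  by_contra hyx
  simp only [Classical.not_imp, not_not] at hyS
  exact hy hyx hyS.2

/-! ### Reduction of the eigenvalue equation to the half line -/

lemma locallyIntegrableOn_Ioi_of_Icc {F : ℝ → ℂ}
    (h : ∀ R, IntegrableOn F (Set.Ioi 0 ∩ Set.Iic R)) : LocallyIntegrableOn F (Set.Ioi 0) := by
  intro x hx
  refine ⟨Set.Ioi 0 ∩ Set.Iic (x + 1), ?_, h _⟩
  exact inter_mem_nhdsWithin _ (Iic_mem_nhds (by linarith))

lemma integrable_indicator_tau {f : Heis d → ℂ} (hf : LocallyIntegrable f volume) (R : ℝ) :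
    Integrable (fun p => f p * (Set.Iic R).indicator (fun _ => (1 : ℂ)) (tau p)) := by
  have h1 := hf.integrableOn_isCompact (isCompact_tau_le R)
  rw [← integrable_indicator_iff (isCompact_tau_le R).isClosed.measurableSet] at h1
  refine h1.congr (Filter.Eventually.of_forall fun p => ?_)
  by_cases hp : tau p ≤ R
  · simp [Set.indicator, hp]
  · simp [Set.indicator, hp]

lemma IsTauDensity.locallyIntegrableOn {f : Heis d → ℂ} {m : ℝ → ℂ} (hm : IsTauDensity f m)
    {g : ℝ → ℂ} (hg : Measurable g) (hfg : LocallyIntegrable (fun p => f p * g (tau p)) volume) :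
    LocallyIntegrableOn (fun x => m x * g x) (Set.Ioi 0) := by
  refine locallyIntegrableOn_Ioi_of_Icc fun R => ?_
  have h1 := (hm.spec (fun x => g x * (Set.Iic R).indicator (fun _ => (1 : ℂ)) x)
    (hg.mul (measurable_const.indicator measurableSet_Iic)) (by
      simpa only [mul_assoc] using integrable_indicator_tau hfg R)).1
  rw [IntegrableOn, Set.inter_comm, ← Measure.restrict_restrict measurableSet_Iic, ← IntegrableOn,
    ← integrable_indicator_iff measurableSet_Iic]
  refine h1.congr (Filter.Eventually.of_forall fun x => ?_)
  by_cases hx : x ≤ R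
  · simp [Set.indicator, hx]
  · simp [Set.indicator, hx]

lemma locallyIntegrableOn_congr_Ioi {f g : ℝ → ℂ} (hf : LocallyIntegrableOn f (Set.Ioi 0))
    (h : ∀ᵐ x ∂(volume.restrict (Set.Ioi (0 : ℝ))), f x = g x) :
    LocallyIntegrableOn g (Set.Ioi 0) := by
  rw [locallyIntegrableOn_iff isOpen_Ioi.isLocallyClosed] at hf ⊢
  intro k hk hkc
  exact (hf k hk hkc).congr (ae_restrict_of_ae_restrict_of_subset hk h)

/-- Polar coordinates give local integrability of g times the polar density, which is continuous and
positive on (0, ∞) and can be divided out. -/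
lemma locallyIntegrableOn_profile (hd : 1 ≤ d) {g : ℝ → ℂ} (hg : Measurable g)
    (hu : LocallyIntegrable (fun p : Heis d => g (tau p)) volume) :
    LocallyIntegrableOn g (Set.Ioi 0) := by
  have h1 : LocallyIntegrableOn (fun x => (polarDensity d 0 x : ℂ) * g x) (Set.Ioi 0) := by
    refine locallyIntegrableOn_Ioi_of_Icc fun R => ?_
    have h2 : Integrable (fun p : Heis d => ‖p.1‖ ^ 0 •
        (fun x => g x * (Set.Iic R).indicator (fun _ => (1 : ℂ)) x) (tau p)) := by
      simpa using integrable_indicator_tau hu R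
    have hsm : StronglyMeasurable fun x => g x * (Set.Iic R).indicator (fun _ => (1 : ℂ)) x :=
      (hg.mul (measurable_const.indicator measurableSet_Iic)).stronglyMeasurable
    replace h2 := (integrable_polar_iff (d := d) 0 hsm).1 h2
    rw [IntegrableOn, Set.inter_comm, ← Measure.restrict_restrict measurableSet_Iic, ← IntegrableOn,
      ← integrable_indicator_iff measurableSet_Iic]
    refine h2.congr (Filter.Eventually.of_forall fun x => ?_)
    by_cases hx : x ≤ R
    · simp [Set.indicator, hx]
    · simp [Set.indicator, hx]
  have h3 : ContinuousOn (fun x => ((polarDensity d 0 x)⁻¹ : ℂ)) (Set.Ioi 0) := by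
    refine ContinuousOn.inv₀ (Complex.continuous_ofReal.comp_continuousOn ?_) fun x hx => ?_
    · exact continuousOn_const.mul (continuousOn_id.rpow_const fun x hx => Or.inl (ne_of_gt hx))
    · exact_mod_cast (polarDensity_pos hd 0 hx).ne'
  have h4 := h1.continuousOn_mul h3 isOpen_Ioi.isLocallyClosed
  refine locallyIntegrableOn_congr_Ioi h4 ?_
  filter_upwards [ae_restrict_mem measurableSet_Ioi] with x hx
  have : (polarDensity d 0 x : ℂ) ≠ 0 := by exact_mod_cast (polarDensity_pos hd 0 hx).ne'
  rw [← mul_assoc, inv_mul_cancel₀ this, one_mul]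

/-- The profile of a radial solution of `(𝓛 + V) u = lam u`, as a solution of an ordinary
differential equation. -/
structure IsProfile (d : ℕ) (f : Heis d → ℂ) (u : Heis d → ℂ) (g K m : ℝ → ℂ) : Prop where
  measurable : Measurable g
  ae_eq : ∀ᵐ p : Heis d, u p = g (tau p)
  density : IsTauDensity f m
  locallyIntegrableOn : LocallyIntegrableOn m (Set.Ioi 0)
  hasDerivAt : ∀ x, 0 < x → HasDerivAt g (K x * ((x ^ (-((d : ℝ) / 2 + 1)) : ℝ) : ℂ)) x
  primitive : ∀ x y, 0 < x → 0 < y →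
    K y - K x = ∫ s in x..y, ((16 * polarConst d 2 : ℝ) : ℂ)⁻¹ * m s * g s

lemma polarDensity_two (x : ℝ) : polarDensity d 2 x = polarConst d 2 * x ^ ((d : ℝ) / 2) := by
  unfold polarDensity
  congr 2
  push_cast
  ring

/-- Test functions k(τ) reduce the equation to the half line. The potential side becomes ∫ m g k;
the other side becomes 16 c ∫ g (x^(d/2+1) k')' by the polar formula with weight |z|². This is the
weak form to which `exists_regular_solution` applies. -/
lemma exists_isProfile (hd : 1 ≤ d) {f u : Heis d → ℂ} (hu : LocallyIntegrable u volume)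
    (hr : IsRadial u) (hf : LocallyIntegrable f volume)
    (hfu : LocallyIntegrable (fun p => f p * u p) volume)
    (heq : ∀ v : Heis d → ℝ, ContDiff ℝ ∞ v → HasCompactSupport v →
      ∫ p, (f p * u p) * (v p : ℂ) = ∫ p, u p * (hlap v p : ℂ)) :
    ∃ g K m : ℝ → ℂ, IsProfile d f u g K m := by
  obtain ⟨g₀, hg₀, hug₀⟩ := exists_measurable_profile hu.aestronglyMeasurable hr
  obtain ⟨m, hm⟩ := exists_isTauDensity hf
  have lm : LocallyIntegrableOn m (Set.Ioi 0) := by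
    have := hm.locallyIntegrableOn (g := fun _ => 1) measurable_const (by simpa using hf)
    simpa using this
  have lfg₀ : LocallyIntegrable (fun p => f p * g₀ (tau p)) volume :=
    hfu.congr (by filter_upwards [hug₀] with p hp; rw [hp])
  have lmg₀ := hm.locallyIntegrableOn hg₀ lfg₀
  have lg₀ : LocallyIntegrableOn g₀ (Set.Ioi 0) :=
    locallyIntegrableOn_profile hd hg₀ (hu.congr hug₀)
  set C : ℝ := 16 * polarConst d 2 with hC
  have hC0 : (C : ℂ) ≠ 0 := by
    have := polarConst_pos hd 2
    exact_mod_cast (by positivity : (0 : ℝ) < C).ne'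
  have lf : LocallyIntegrableOn (fun x => (C : ℂ)⁻¹ * (m x * g₀ x)) (Set.Ioi 0) :=
    lmg₀.continuousOn_mul continuousOn_const isOpen_Ioi.isLocallyClosed
  obtain ⟨G, K, hG, hK, hgG⟩ := exists_regular_solution lg₀ lf ((d : ℝ) / 2 + 1) fun k hk => by
    have kc : Continuous k := hk.contDiff.continuous
    have hkτ : ContDiff ℝ ∞ fun p : Heis d => k (tau p) := hk.contDiff.comp contDiff_tau
    have hkτc : HasCompactSupport fun p : Heis d => k (tau p) := hasCompactSupport_comp_tau hk.compact
    have h1 := heq _ hkτ hkτc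
    have h2 : Integrable fun p : Heis d => f p * (g₀ (tau p) * (k (tau p) : ℂ)) := by
      have := lfg₀.integrable_smul_left_of_hasCompactSupport hkτ.continuous hkτc
      refine this.congr (Filter.Eventually.of_forall fun p => ?_)
      simp only [Complex.real_smul]; ring
    have h3 := (hm.spec (fun x => g₀ x * (k x : ℂ))
      (hg₀.mul (Complex.continuous_ofReal.comp kc).measurable) h2).2
    have h4 : ∫ p, (f p * u p) * (k (tau p) : ℂ) = ∫ p, f p * (g₀ (tau p) * (k (tau p) : ℂ)) := by
      refine integral_congr_ae ?_
      filter_upwards [hug₀] with p hp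
      rw [hp, mul_assoc]
    have k1c : Continuous (deriv k) := hk.deriv.contDiff.continuous
    have k2c : Continuous (deriv (deriv k)) := hk.deriv.deriv.contDiff.continuous
    set φ : ℝ → ℂ := fun x => g₀ x *
      ((16 * x * deriv (deriv k) x + (8 * d + 16) * deriv k x : ℝ) : ℂ) with hφ
    have hφm : StronglyMeasurable φ :=
      (hg₀.mul (Complex.continuous_ofReal.comp (by fun_prop)).measurable).stronglyMeasurable
    have h5 : ∫ p, u p * (hlap (fun p => k (tau p)) p : ℂ) = ∫ p : Heis d, ‖p.1‖ ^ 2 • φ (tau p) := by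
      refine integral_congr_ae ?_
      filter_upwards [hug₀] with p hp
      rw [hp, hlap_comp_tau hk.contDiff, Complex.real_smul]
      simp only [hφ]
      push_cast
      ring
    rw [integral_polar 2 hφm] at h5
    have h6 : ∫ x in Set.Ioi 0, polarDensity d 2 x • φ x = (C : ℂ) * ∫ x in Set.Ioi 0, g₀ x *
        ((x ^ ((d : ℝ) / 2 + 1 - 1) *
          (x * deriv (deriv k) x + ((d : ℝ) / 2 + 1) * deriv k x) : ℝ) : ℂ) := by
      rw [← integral_const_mul]
      refine setIntegral_congr_fun measurableSet_Ioi fun x _ => ?_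
      simp only [polarDensity_two, hφ, hC, Complex.real_smul, add_sub_cancel_right]
      push_cast
      ring
    have h7 : ∫ x in Set.Ioi 0, ((C : ℂ)⁻¹ * (m x * g₀ x)) * (k x : ℂ) =
        (C : ℂ)⁻¹ * ∫ x in Set.Ioi 0, m x * (g₀ x * (k x : ℂ)) := by
      rw [← integral_const_mul]
      refine setIntegral_congr_fun measurableSet_Ioi fun x _ => ?_
      ring
    rw [h7, ← h3, ← h4, h1, h5, h6, ← mul_assoc, inv_mul_cancel₀ hC0, one_mul]
  have hGc : ContinuousOn G (Set.Ioi 0) := fun x hx => (hG x hx).continuousAt.continuousWithinAt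
  have hind : ∀ x, 0 < x → (Set.Ioi (0 : ℝ)).indicator G =ᶠ[nhds x] G := fun x hx => by
    filter_upwards [Ioi_mem_nhds hx] with y hy using Set.indicator_of_mem hy G
  -- G is controlled only on (0, ∞). Extending it by zero makes it measurable and changes nothing,
  -- because `tau` is positive almost everywhere.
  refine ⟨(Set.Ioi (0 : ℝ)).indicator G, K, m, ?_, ?_, hm, lm, fun x hx => ?_, fun x y hx hy => ?_⟩
  · have := hGc.measurable_piecewise (g := (0 : ℝ → ℂ)) continuous_zero.continuousOn measurableSet_Ioi
    rwa [Set.piecewise_eq_indicator] at this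
  · have h1 : ∀ᵐ x ∂(volume.restrict (Set.Ioi (0 : ℝ))), g₀ x = (Set.Ioi (0 : ℝ)).indicator G x := by
      filter_upwards [hgG, ae_restrict_mem measurableSet_Ioi] with x h2 hx
      rw [Set.indicator_of_mem hx, h2]
    filter_upwards [hug₀, ae_comp_tau h1] with p h2 h3
    rw [h2, h3]
  · exact (hG x hx).congr_of_eventuallyEq (hind x hx)
  · rw [hK x y hx hy]
    refine intervalIntegral.integral_congr_ae ?_
    have h1 := (ae_restrict_iff' measurableSet_Ioi).1 hgG
    filter_upwards [h1] with s hs hsm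
    have hs0 : s ∈ Set.Ioi (0 : ℝ) := (lt_min hx hy).trans hsm.1
    rw [Set.indicator_of_mem hs0, ← hs hs0, mul_assoc]

namespace IsProfile

variable {f u : Heis d → ℂ} {g K m : ℝ → ℂ}

lemma locallyIntegrableOn_const_mul (h : IsProfile d f u g K m) :
    LocallyIntegrableOn (fun x => ((16 * polarConst d 2 : ℝ) : ℂ)⁻¹ * m x) (Set.Ioi 0) :=
  h.locallyIntegrableOn.continuousOn_mul continuousOn_const isOpen_Ioi.isLocallyClosed

lemma continuousOn (h : IsProfile d f u g K m) : ContinuousOn g (Set.Ioi 0) :=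
  fun x hx => (h.hasDerivAt x hx).continuousAt.continuousWithinAt

lemma locallyIntegrableOn_mul (h : IsProfile d f u g K m) :
    LocallyIntegrableOn (fun x => ((16 * polarConst d 2 : ℝ) : ℂ)⁻¹ * m x * g x) (Set.Ioi 0) :=
  h.locallyIntegrableOn_const_mul.mul_continuousOn h.continuousOn isOpen_Ioi.isLocallyClosed

lemma continuousOn_flux (h : IsProfile d f u g K m) : ContinuousOn K (Set.Ioi 0) :=
  continuousOn_of_primitive h.locallyIntegrableOn_mul h.primitive

lemma ae_ne_zero (h : IsProfile d f u g K m) (hne : ¬ (u =ᵐ[volume] 0)) :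
    ∀ᵐ x ∂(volume.restrict (Set.Ioi (0 : ℝ))), g x ≠ 0 := by
  refine ae_ne_zero_of_solution h.locallyIntegrableOn_const_mul h.hasDerivAt h.primitive
    h.continuousOn_flux ?_
  by_contra! hz
  refine hne ?_
  have h1 : ∀ᵐ x ∂(volume.restrict (Set.Ioi (0 : ℝ))), g x = 0 := by
    filter_upwards [ae_restrict_mem measurableSet_Ioi] with x hx using hz x hx
  filter_upwards [h.ae_eq, ae_comp_tau h1] with p e1 e2
  rw [e1, e2]; rfl

/-- The potential is orthogonal to functions in the kernel of the angular average. -/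
lemma integral_mul_qpoly_eq_zero (h : IsProfile d f u g K m) (hne : ¬ (u =ᵐ[volume] 0))
    (hu : LocallyIntegrable u volume) (hf : LocallyIntegrable f volume)
    (hfu : LocallyIntegrable (fun p => f p * u p) volume)
    (heq : ∀ v : Heis d → ℝ, ContDiff ℝ ∞ v → HasCompactSupport v →
      ∫ p, (f p * u p) * (v p : ℂ) = ∫ p, u p * (hlap v p : ℂ))
    {k : ℝ → ℝ} (hk : Continuous k) (hc : HasCompactSupport k) :
    ∫ p, f p * ((qpoly p * k (tau p) : ℝ) : ℂ) = 0 := by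
  have qc : Continuous (qpoly (d := d)) := (contDiff_qpoly (n := 0)).continuous
  have cn : Continuous fun p : Heis d => ‖p.1‖ := continuous_fst.norm
  have lfq : LocallyIntegrable (fun p => f p * (qpoly p : ℂ)) volume :=
    hf.mul_continuous (Complex.continuous_ofReal.comp qc)
  obtain ⟨m₂, hm₂⟩ := exists_isTauDensity lfq
  have lq : LocallyIntegrable (fun p : Heis d => ((‖p.1‖ ^ 2 * qpoly p : ℝ) : ℂ)) volume :=
    (Complex.continuous_ofReal.comp (by fun_prop)).locallyIntegrable
  obtain ⟨m₃, hm₃⟩ := exists_isTauDensity lq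
  have lm₃ : LocallyIntegrableOn m₃ (Set.Ioi 0) := by
    have := hm₃.locallyIntegrableOn (g := fun _ => 1) measurable_const (by simpa using lq)
    simpa using this
  -- This is the vanishing mean of |z|² q, sphere by sphere.
  have z₃ : ∀ᵐ x ∂(volume.restrict (Set.Ioi (0 : ℝ))), m₃ x = 0 := by
    refine ae_eq_zero_of_integral_test lm₃ fun k hk => ?_
    have hkτc : HasCompactSupport fun p : Heis d => k (tau p) := hasCompactSupport_comp_tau hk.compact
    rw [← (hm₃.spec (fun x => (k x : ℂ))
      (Complex.continuous_ofReal.comp hk.contDiff.continuous).measurable ?_).2]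
    · have h1 := integral_normSq_mul_qpoly (d := d) hk.contDiff hk.compact
      rw [← Complex.ofReal_zero, ← h1, ← integral_complex_ofReal]
      push_cast
      rfl
    · have := lq.integrable_smul_left_of_hasCompactSupport
        (hk.contDiff.continuous.comp continuous_tau) hkτc
      refine this.congr (Filter.Eventually.of_forall fun p => ?_)
      simp only [Complex.real_smul, Function.comp_apply]; ring
  have lfqg : LocallyIntegrable (fun p => (f p * (qpoly p : ℂ)) * g (tau p)) volume := by
    refine (hfu.mul_continuous (Complex.continuous_ofReal.comp qc)).congr ?_
    filter_upwards [h.ae_eq] with p hp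
    rw [hp]
    simp only [Function.comp_apply]
    ring
  have lm₂g := hm₂.locallyIntegrableOn h.measurable lfqg
  -- The equation is tested with k(τ) q. The sub-Laplacian of this function is |z|² q w(τ), which
  -- enters only through `m₃` and hence contributes nothing.
  have z₂ : ∀ᵐ x ∂(volume.restrict (Set.Ioi (0 : ℝ))), m₂ x * g x = 0 := by
    refine ae_eq_zero_of_integral_test lm₂g fun k hk => ?_
    have kc : Continuous k := hk.contDiff.continuous
    have hkτ : ContDiff ℝ ∞ fun p : Heis d => k (tau p) := hk.contDiff.comp contDiff_tau
    have hkτc : HasCompactSupport fun p : Heis d => k (tau p) := hasCompactSupport_comp_tau hk.compact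
    have h1 := heq (fun p => k (tau p) * qpoly p) (hkτ.mul contDiff_qpoly) hkτc.mul_right
    have h2 := (hm₂.spec (fun x => g x * (k x : ℂ))
      (h.measurable.mul (Complex.continuous_ofReal.comp kc).measurable) (by
        have := lfqg.integrable_smul_left_of_hasCompactSupport hkτ.continuous hkτc
        refine this.congr (Filter.Eventually.of_forall fun p => ?_)
        simp only [Complex.real_smul]; ring)).2
    have k1c : Continuous (deriv k) := hk.deriv.contDiff.continuous
    have k2c : Continuous (deriv (deriv k)) := hk.deriv.deriv.contDiff.continuous
    have hw : Continuous fun x => 16 * x * deriv (deriv k) x + (8 * d + 48) * deriv k x := by fun_prop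
    have hwc : HasCompactSupport fun x => 16 * x * deriv (deriv k) x + (8 * d + 48) * deriv k x :=
      (hk.deriv.deriv.compact.mul_left).add (hk.deriv.compact.mul_left)
    set w : ℝ → ℝ := fun x => 16 * x * deriv (deriv k) x + (8 * d + 48) * deriv k x with hwdef
    have h3 := (hm₃.spec (fun x => g x * (w x : ℂ))
      (h.measurable.mul (Complex.continuous_ofReal.comp hw).measurable) (by
        have hcont : Continuous fun p : Heis d => (‖p.1‖ ^ 2 * qpoly p) * w (tau p) :=
          ((cn.pow 2).mul qc).mul (hw.comp continuous_tau)
        have := hu.integrable_smul_left_of_hasCompactSupport hcont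
          ((hasCompactSupport_comp_tau hwc).mul_left)
        refine this.congr ?_
        filter_upwards [h.ae_eq] with p hp
        rw [hp, Complex.real_smul]
        push_cast
        ring)).2
    have h4 : ∫ x in Set.Ioi 0, m₃ x * (g x * (w x : ℂ)) = 0 := by
      refine integral_eq_zero_of_ae ?_
      filter_upwards [z₃] with x hx
      rw [hx, zero_mul]; rfl
    have h5 : ∫ p, u p * (hlap (fun p => k (tau p) * qpoly p) p : ℂ) =
        ∫ p : Heis d, ((‖p.1‖ ^ 2 * qpoly p : ℝ) : ℂ) * (g (tau p) * (w (tau p) : ℂ)) := by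
      refine integral_congr_ae ?_
      filter_upwards [h.ae_eq] with p hp
      rw [hp, hlap_comp_tau_mul_qpoly hk.contDiff]
      simp only [hwdef]
      push_cast
      ring
    have h6 : ∫ p, (f p * u p) * ((k (tau p) * qpoly p : ℝ) : ℂ) =
        ∫ p, (f p * (qpoly p : ℂ)) * (g (tau p) * (k (tau p) : ℂ)) := by
      refine integral_congr_ae ?_
      filter_upwards [h.ae_eq] with p hp
      rw [hp]
      push_cast
      ring
    simp_rw [mul_assoc (m₂ _)]
    rw [← h2, ← h6, h1, h5, h3, h4]
  have h1 := (hm₂.spec (fun x => (k x : ℂ)) (Complex.continuous_ofReal.comp hk).measurable (by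
    have := lfq.integrable_smul_left_of_hasCompactSupport (hk.comp continuous_tau)
      (hasCompactSupport_comp_tau hc)
    refine this.congr (Filter.Eventually.of_forall fun p => ?_)
    simp only [Complex.real_smul, Function.comp_apply]; ring)).2
  have h2 : ∫ x in Set.Ioi 0, m₂ x * (k x : ℂ) = 0 := by
    refine integral_eq_zero_of_ae ?_
    -- The zeros of g form a null set, so g can be divided out of `m₂` times g.
    filter_upwards [z₂, h.ae_ne_zero hne] with x hx hg
    rcases mul_eq_zero.1 hx with h0 | h0
    · rw [h0, zero_mul]; rfl
    · exact absurd h0 hg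
  rw [← h2, ← h1]
  refine integral_congr_ae (Filter.Eventually.of_forall fun p => ?_)
  push_cast
  ring

end IsProfile

/-! ### Excluding eigenvalues with positive real part -/

lemma norm_pow_four_le_tau (p : Heis d) : ‖p.1‖ ^ 4 ≤ tau p := by
  unfold tau; nlinarith [sq_nonneg p.2]

/-- The square of a(τ)|z|² produces the |z|⁴ that contains `qpoly`. The bound uses (α + β)² ≤ 2α² +
2β² and |z|⁴ ≤ τ. -/
lemma norm_hgrad_comp_tau_mul_normSq_le {a : ℝ → ℝ} (ha : Differentiable ℝ a) (p : Heis d) :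
    ‖hgrad (fun p => ((a (tau p) * ‖p.1‖ ^ 2 : ℝ) : ℂ)) p‖ ^ 2 ≤
      ‖p.1‖ ^ 2 * (8 * a (tau p) ^ 2 + 32 * (tau p * deriv a (tau p)) ^ 2) := by
  have had : DifferentiableAt ℝ (fun p : Heis d => a (tau p)) p :=
    (ha _).fun_comp' p (differentiable_tau p)
  have h1 : ∀ i, ‖hderiv i (fun p : Heis d => ((a (tau p) * ‖p.1‖ ^ 2 : ℝ) : ℂ)) p‖ ^ 2 ≤
      8 * a (tau p) ^ 2 * p.1 i ^ 2 + 2 * (deriv a (tau p) * ‖p.1‖ ^ 2) ^ 2 * tauGrad i p ^ 2 := by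
    intro i
    rw [hderiv_ofReal i (had.fun_mul (differentiable_normSq p)), Complex.norm_real,
      Real.norm_eq_abs, sq_abs, hderiv_mul i had (differentiable_normSq p), hderiv_normSq,
      hderiv_comp i (ha _) (differentiable_tau p), hderiv_tau, smul_eq_mul]
    nlinarith [sq_nonneg (a (tau p) * (2 * p.1 i) - tauGrad i p * deriv a (tau p) * ‖p.1‖ ^ 2)]
  rw [norm_hgrad_sq]
  refine (Finset.sum_le_sum fun i _ => h1 i).trans ?_
  rw [Finset.sum_add_distrib, ← Finset.mul_sum, ← Finset.mul_sum, sum_tauGrad_sq, sum_sq]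
  have h2 := mul_le_mul_of_nonneg_right (norm_pow_four_le_tau p)
    (by have := tau_nonneg p; positivity : 0 ≤ 32 * ‖p.1‖ ^ 2 * tau p * deriv a (tau p) ^ 2)
  nlinarith [h2]

/-- The combination of the virial inequality with the lower bound for the negative part. -/
lemma combined_virial_le {V : Heis d → ℂ} {V' : Heis d → Heis d →L[ℝ] ℂ}
    (hV : HasWeakFDeriv V V') {b₁ b₂ mu : ℝ}
    (h₁ : FormBounded (fun p => max 0 (-(V p).re)) b₁)
    (h₂ : FormBounded (fun p => max 0 (radialDerivRho V V' p)) b₂)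
    (hR : ∀ k : ℝ → ℝ, ContDiff ℝ ∞ k → HasCompactSupport k →
      ∫ p, (V p).re * (qpoly p * k (tau p)) = mu * ∫ p : Heis d, qpoly p * k (tau p))
    {a s : ℝ → ℝ} (ha : ContDiff ℝ ∞ a) (hac : HasCompactSupport a)
    (hs : ContDiff ℝ ∞ s) (hsc : HasCompactSupport s) :
    mu * (1 / (((d : ℝ) + 1) * (d + 2))) * ∫ p : Heis d, tau p * a (tau p) ^ 2 ≤
      ((d : ℝ) + 1) / (d + 2) * (∫ p, (V p).re * (tau p * a (tau p) ^ 2 + (2 * d + 1) * s (tau p) ^ 2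
        + 8 * tau p * (s (tau p) * deriv s (tau p)))) +
      (b₁ ^ 2 * (∫ p : Heis d, ‖hgrad (fun p => ((a (tau p) * ‖p.1‖ ^ 2 : ℝ) : ℂ)) p‖ ^ 2) +
      ((d : ℝ) + 1) / (d + 2) *
        (b₂ ^ 2 * ∫ p : Heis d, 16 * ‖p.1‖ ^ 2 * tau p * deriv s (tau p) ^ 2)) := by
  have lV : LocallyIntegrable (fun p => (V p).re) volume := hV.locInt.complex_re
  have cτ := continuous_tau (d := d)
  have hψ : ContDiff ℝ 1 fun p : Heis d => ((a (tau p) * ‖p.1‖ ^ 2 : ℝ) : ℂ) :=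
    Complex.ofRealCLM.contDiff.comp
      (((ha.of_le (by norm_cast)).comp contDiff_tau).mul contDiff_normSq)
  have hψc : HasCompactSupport fun p : Heis d => ((a (tau p) * ‖p.1‖ ^ 2 : ℝ) : ℂ) :=
    ((hasCompactSupport_comp_tau hac).mul_right).comp_left (g := fun x : ℝ => (x : ℂ)) (by simp)
  have e1 := h₁.integral_le lV.neg.max_zero (fun p => le_max_left _ _) hψ hψc
  have hψn : ∀ p : Heis d, ‖((a (tau p) * ‖p.1‖ ^ 2 : ℝ) : ℂ)‖ ^ 2 = a (tau p) ^ 2 * ‖p.1‖ ^ 4 := by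
    intro p
    rw [Complex.norm_real, Real.norm_eq_abs, sq_abs]; ring
  have ca : Continuous fun p : Heis d => a (tau p) := ha.continuous.comp cτ
  have cs : Continuous fun p : Heis d => s (tau p) := hs.continuous.comp cτ
  have cs' : Continuous fun p : Heis d => deriv s (tau p) :=
    (contDiff_deriv_infty hs).continuous.comp cτ
  have sa : HasCompactSupport fun p : Heis d => a (tau p) ^ 2 :=
    (hasCompactSupport_comp_tau hac).comp_left (g := fun x : ℝ => x ^ 2) (by simp)
  have ss : HasCompactSupport fun p : Heis d => s (tau p) := hasCompactSupport_comp_tau hsc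
  have cz : Continuous fun p : Heis d => ‖p.1‖ := continuous_fst.norm
  have qc : Continuous (qpoly (d := d)) := (contDiff_qpoly (n := 0)).continuous
  have i1 : Integrable fun p => (V p).re * (a (tau p) ^ 2 * ‖p.1‖ ^ 4) :=
    lV.integrable_mul_continuous (by fun_prop) sa.mul_right
  have i2 : Integrable fun p => max 0 (-(V p).re) * (a (tau p) ^ 2 * ‖p.1‖ ^ 4) :=
    lV.neg.max_zero.integrable_mul_continuous (by fun_prop) sa.mul_right
  have i3 : Integrable fun p => (V p).re * (qpoly p * a (tau p) ^ 2) :=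
    lV.integrable_mul_continuous (by fun_prop) sa.mul_left
  have i4 : Integrable fun p => (V p).re * (tau p * a (tau p) ^ 2) :=
    lV.integrable_mul_continuous (by fun_prop) sa.mul_left
  have i5 : Integrable fun p => (V p).re * ((2 * d + 1) * s (tau p) ^ 2
        + 8 * tau p * (s (tau p) * deriv s (tau p))) :=
    lV.integrable_mul_continuous (by fun_prop)
      ((ss.comp_left (g := fun x : ℝ => x ^ 2) (by simp)).mul_left.add ss.mul_right.mul_left)
  have e2 : -∫ p, (V p).re * (a (tau p) ^ 2 * ‖p.1‖ ^ 4) ≤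
      ∫ p, max 0 (-(V p).re) * (a (tau p) ^ 2 * ‖p.1‖ ^ 4) := by
    rw [← integral_neg]
    refine integral_mono i1.neg i2 fun p => ?_
    have : 0 ≤ a (tau p) ^ 2 * ‖p.1‖ ^ 4 := by positivity
    have := mul_le_mul_of_nonneg_right (le_max_right 0 (-(V p).re)) this
    simpa using this
  -- The splitting |z|⁴ = q + (d+1)/(d+2) τ: the first part is known from `hR`, the second is a
  -- radial moment for the virial inequality.
  have e3 : ∫ p, (V p).re * (a (tau p) ^ 2 * ‖p.1‖ ^ 4) =
      (∫ p, (V p).re * (qpoly p * a (tau p) ^ 2)) +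
        ((d : ℝ) + 1) / (d + 2) * ∫ p, (V p).re * (tau p * a (tau p) ^ 2) := by
    rw [← integral_const_mul, ← integral_add i3 (i4.const_mul _)]
    refine integral_congr_ae (Filter.Eventually.of_forall fun p => ?_)
    unfold qpoly
    ring
  have ha2 : ContDiff ℝ ∞ fun x => a x ^ 2 := ha.pow 2
  have ha2c : HasCompactSupport fun x => a x ^ 2 :=
    hac.comp_left (g := fun x : ℝ => x ^ 2) (by simp)
  have e4 := hR _ ha2 ha2c
  rw [integral_qpoly ha2 ha2c] at e4
  have e5 := virial_le hV h₂ hs hsc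
  have e6 : ∫ p, (V p).re * (tau p * a (tau p) ^ 2 + (2 * d + 1) * s (tau p) ^ 2
        + 8 * tau p * (s (tau p) * deriv s (tau p))) =
      (∫ p, (V p).re * (tau p * a (tau p) ^ 2)) +
      ∫ p, ((2 * d + 1) * s (tau p) ^ 2 + 8 * tau p * (s (tau p) * deriv s (tau p))) * (V p).re := by
    rw [show (∫ p, ((2 * d + 1) * s (tau p) ^ 2 + 8 * tau p * (s (tau p) * deriv s (tau p))) *
      (V p).re) = ∫ p, (V p).re * ((2 * d + 1) * s (tau p) ^ 2
        + 8 * tau p * (s (tau p) * deriv s (tau p))) by simp_rw [mul_comm], ← integral_add i4 i5]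
    refine integral_congr_ae (Filter.Eventually.of_forall fun p => ?_)
    ring
  simp_rw [hψn] at e1
  have hα : 0 ≤ ((d : ℝ) + 1) / (d + 2) := by positivity
  have e7 := mul_le_mul_of_nonneg_left e5 hα
  rw [e6]
  rw [e3, e4] at e2
  linarith

/-! ### Cutoff powers and growth in the virial inequality -/

/-- The weight `x ^ (-κ)`, cut off smoothly near `1` and by `η` at scale `N`. -/
noncomputable def cutPow (κ : ℝ) (η : ℝ → ℝ) (N x : ℝ) : ℝ :=
  x ^ (-κ) * (Real.smoothTransition (x - 1) * η (x / N))

lemma contDiff_smoothTransition_sub_one : ContDiff ℝ ∞ fun x : ℝ => Real.smoothTransition (x - 1) :=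
  Real.smoothTransition.contDiff.comp (contDiff_id.sub contDiff_const)

lemma deriv_smoothTransition_eq_zero {x : ℝ} (hx : x ∉ Set.Icc (1 : ℝ) 2) :
    deriv (fun x : ℝ => Real.smoothTransition (x - 1)) x = 0 := by
  rw [Set.mem_Icc, not_and_or, not_le, not_le] at hx
  rcases hx with hx | hx
  · have : (fun x : ℝ => Real.smoothTransition (x - 1)) =ᶠ[nhds x] fun _ => 0 := by
      filter_upwards [Iio_mem_nhds hx] with y hy
      exact Real.smoothTransition.zero_of_nonpos (by linarith [Set.mem_Iio.1 hy])
    rw [this.deriv_eq, deriv_const]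
  · have : (fun x : ℝ => Real.smoothTransition (x - 1)) =ᶠ[nhds x] fun _ => 1 := by
      filter_upwards [Ioi_mem_nhds hx] with y hy
      exact Real.smoothTransition.one_of_one_le (by linarith [Set.mem_Ioi.1 hy])
    rw [this.deriv_eq, deriv_const]

lemma exists_deriv_smoothTransition_le :
    ∃ C, ∀ x, |deriv (fun x : ℝ => Real.smoothTransition (x - 1)) x| ≤ C := by
  have hc := (contDiff_deriv_infty contDiff_smoothTransition_sub_one).continuous
  obtain ⟨C, hC⟩ := isCompact_Icc.exists_bound_of_continuousOn (s := Set.Icc (1 : ℝ) 2) hc.continuousOn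
  refine ⟨C, fun x => ?_⟩
  by_cases hx : x ∈ Set.Icc (1 : ℝ) 2
  · exact hC x hx
  · rw [deriv_smoothTransition_eq_zero hx, abs_zero]
    exact (norm_nonneg _).trans (hC 1 (by norm_num))

lemma isTest_cutPow (κ : ℝ) {η : ℝ → ℝ} (hη : ContDiff ℝ ∞ η) (h1 : ∀ y, 1 ≤ y → η y = 0) {N : ℝ}
    (hN : 0 < N) : IsTest (cutPow κ η N) := by
  have : IsTest fun x => Real.smoothTransition (x - 1) * η (x / N) := by
    refine IsTest.of_Ioo (a := 1) (b := N) (contDiff_smoothTransition_sub_one.mul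
      (hη.comp (contDiff_id.div_const N))) one_pos fun x hx => ?_
    rw [Set.mem_Ioo, not_and_or, not_lt, not_lt] at hx
    rcases hx with hx | hx
    · rw [Real.smoothTransition.zero_of_nonpos (by linarith), zero_mul]
    · rw [h1 _ ((one_le_div hN).2 hx), mul_zero]
  exact this.rpow_mul (-κ)

lemma hasDerivAt_cutPow (κ : ℝ) {η : ℝ → ℝ} (hη : ContDiff ℝ ∞ η) {N x : ℝ} (hx : 0 < x) :
    HasDerivAt (cutPow κ η N) (-κ * x ^ (-κ - 1) * (Real.smoothTransition (x - 1) * η (x / N)) +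
      x ^ (-κ) * (deriv (fun x : ℝ => Real.smoothTransition (x - 1)) x * η (x / N) +
        Real.smoothTransition (x - 1) * (deriv η (x / N) / N))) x := by
  have h1 := (contDiff_smoothTransition_sub_one.differentiable (by simp) x).hasDerivAt
  have h2 : HasDerivAt (fun x => η (x / N)) (deriv η (x / N) / N) x := by
    have := HasDerivAt.comp x (h₂ := η) (h := fun x => x / N)
      (hη.differentiable (by simp) (x / N)).hasDerivAt ((hasDerivAt_id' x).div_const N)
    exact this.congr_deriv (mul_one_div _ _)
  exact (Real.hasDerivAt_rpow_const (p := -κ) (Or.inl hx.ne')).mul (h1.mul h2)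

lemma mul_deriv_cutPow (κ : ℝ) {η : ℝ → ℝ} (hη : ContDiff ℝ ∞ η) {N x : ℝ} (hx : 0 < x) :
    x * deriv (cutPow κ η N) x = x ^ (-κ) * (-κ * (Real.smoothTransition (x - 1) * η (x / N)) +
      (x * deriv (fun x : ℝ => Real.smoothTransition (x - 1)) x * η (x / N) +
        Real.smoothTransition (x - 1) * (x / N * deriv η (x / N)))) := by
  rw [(hasDerivAt_cutPow κ hη hx).deriv, Real.rpow_sub_one hx.ne']
  field_simp

/-- The bounds are uniform in N because differentiating η(x/N) brings the factor x/N ≤ 1 on the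
support, while the derivative of the transition lives where x ≤ 2. -/
lemma exists_cutPow_le (κ : ℝ) {η : ℝ → ℝ} (hη : ContDiff ℝ ∞ η) (h1 : ∀ y, 1 ≤ y → η y = 0) :
    ∃ C, 0 ≤ C ∧ ∀ N, 1 ≤ N → ∀ x,
      (cutPow κ η N x) ^ 2 ≤ (Set.Icc 1 N).indicator (fun x => C * x ^ (-(2 * κ))) x ∧
      (x * deriv (cutPow κ η N) x) ^ 2 ≤
        (Set.Icc 1 N).indicator (fun x => C * x ^ (-(2 * κ))) x := by
  obtain ⟨C₁, hC₁⟩ := isCompact_Icc.exists_bound_of_continuousOn (s := Set.Icc (0 : ℝ) 1)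
    hη.continuous.continuousOn
  obtain ⟨C₂, hC₂⟩ := isCompact_Icc.exists_bound_of_continuousOn (s := Set.Icc (0 : ℝ) 1)
    (contDiff_deriv_infty hη).continuous.continuousOn
  obtain ⟨C₃, hC₃⟩ := exists_deriv_smoothTransition_le
  have z₁ : 0 ≤ C₁ := (norm_nonneg _).trans (hC₁ 0 (by norm_num))
  have z₂ : 0 ≤ C₂ := (norm_nonneg _).trans (hC₂ 0 (by norm_num))
  have z₃ : 0 ≤ C₃ := (abs_nonneg _).trans (hC₃ 0)
  set D : ℝ := |κ| * C₁ + (2 * C₃ * C₁ + C₂) with hD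
  have zD : 0 ≤ D := by positivity
  refine ⟨C₁ ^ 2 + D ^ 2, by positivity, fun N hN x => ?_⟩
  have hN0 : 0 < N := by linarith
  by_cases hx : x ∈ Set.Icc 1 N
  · rw [Set.indicator_of_mem hx]
    have hx0 : 0 < x := by linarith [hx.1]
    have hy : x / N ∈ Set.Icc (0 : ℝ) 1 := ⟨by positivity, (div_le_one hN0).2 hx.2⟩
    have a1 := hC₁ _ hy
    have a2 := hC₂ _ hy
    rw [Real.norm_eq_abs] at a1 a2
    have b1 : |Real.smoothTransition (x - 1)| ≤ 1 := by
      rw [abs_of_nonneg (Real.smoothTransition.nonneg _)]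
      exact Real.smoothTransition.le_one _
    have b2 : |Real.smoothTransition (x - 1) * η (x / N)| ≤ C₁ := by
      rw [abs_mul]
      exact (mul_le_mul b1 a1 (abs_nonneg _) zero_le_one).trans (one_mul _).le
    have b3 : |x * deriv (fun x : ℝ => Real.smoothTransition (x - 1)) x| ≤ 2 * C₃ := by
      by_cases hx2 : x ∈ Set.Icc (1 : ℝ) 2
      · rw [abs_mul, abs_of_pos hx0]
        exact mul_le_mul hx2.2 (hC₃ x) (abs_nonneg _) (by norm_num)
      · rw [deriv_smoothTransition_eq_zero hx2, mul_zero, abs_zero]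
        positivity
    have b4 : |x / N * deriv η (x / N)| ≤ C₂ := by
      rw [abs_mul, abs_of_nonneg hy.1]
      exact (mul_le_mul hy.2 a2 (abs_nonneg _) zero_le_one).trans (one_mul _).le
    have hpow : (x ^ (-κ)) ^ 2 = x ^ (-(2 * κ)) := by
      rw [← Real.rpow_natCast, ← Real.rpow_mul hx0.le]
      congr 1; push_cast; ring
    have hp := (Real.rpow_pos_of_pos hx0 (-(2 * κ))).le
    constructor
    · unfold cutPow
      rw [mul_pow, hpow, mul_comm]
      refine mul_le_mul_of_nonneg_right ?_ hp
      have := sq_le_sq' (neg_le_of_abs_le b2) (le_of_abs_le b2)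
      nlinarith [sq_nonneg D]
    · rw [mul_deriv_cutPow κ hη hx0, mul_pow, hpow, mul_comm]
      refine mul_le_mul_of_nonneg_right ?_ hp
      have : |-κ * (Real.smoothTransition (x - 1) * η (x / N)) +
          (x * deriv (fun x : ℝ => Real.smoothTransition (x - 1)) x * η (x / N) +
          Real.smoothTransition (x - 1) * (x / N * deriv η (x / N)))| ≤ D := by
        refine (abs_add_le _ _).trans (add_le_add ?_ ((abs_add_le _ _).trans (add_le_add ?_ ?_)))
        · rw [abs_mul, abs_neg]
          exact mul_le_mul_of_nonneg_left b2 (abs_nonneg _)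
        · rw [abs_mul]
          exact mul_le_mul b3 a1 (abs_nonneg _) (by positivity)
        · rw [abs_mul]
          exact (mul_le_mul b1 b4 (abs_nonneg _) zero_le_one).trans (one_mul _).le
      have := sq_le_sq' (neg_le_of_abs_le this) (le_of_abs_le this)
      nlinarith [sq_nonneg C₁]
  · rw [Set.indicator_of_notMem hx]
    have hz : cutPow κ η N =ᶠ[nhds x] fun _ => 0 := by
      filter_upwards [isClosed_Icc.isOpen_compl.mem_nhds hx] with y hy
      rw [Set.mem_compl_iff, Set.mem_Icc, not_and_or, not_le, not_le] at hy
      unfold cutPow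
      rcases hy with hy | hy
      · rw [Real.smoothTransition.zero_of_nonpos (by linarith), zero_mul, mul_zero]
      · rw [h1 _ ((one_le_div hN0).2 hy.le), mul_zero, mul_zero]
    rw [hz.deriv_eq, hz.eq_of_nhds]
    simp

/-- The smooth function `exp (-1 / (1 - y))` for `y < 1`, continued by zero. -/
noncomputable def cutLow (y : ℝ) : ℝ := expNegInvGlue (1 - y)

/-- The function with `cutLow * cutLow' = -cutHigh ^ 2`. -/
noncomputable def cutHigh (y : ℝ) : ℝ := (1 - y)⁻¹ * expNegInvGlue (1 - y)

lemma contDiff_cutLow : ContDiff ℝ ∞ cutLow :=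
  expNegInvGlue.contDiff.comp (contDiff_const.sub contDiff_id)

lemma contDiff_cutHigh : ContDiff ℝ ∞ cutHigh := by
  have h := (expNegInvGlue.contDiff_polynomial_eval_inv_mul (n := ⊤) Polynomial.X).comp
    ((contDiff_const (c := (1 : ℝ))).sub contDiff_id)
  have e : cutHigh = fun y : ℝ => (1 - y)⁻¹ * expNegInvGlue (1 - y) := rfl
  rw [e]
  simpa [Function.comp_def] using h

lemma cutLow_eq_zero {y : ℝ} (hy : 1 ≤ y) : cutLow y = 0 :=
  expNegInvGlue.zero_of_nonpos (by linarith)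

lemma cutHigh_eq_zero {y : ℝ} (hy : 1 ≤ y) : cutHigh y = 0 := by
  unfold cutHigh
  rw [expNegInvGlue.zero_of_nonpos (by linarith), mul_zero]

lemma deriv_cutLow (y : ℝ) : deriv cutLow y = -((1 - y)⁻¹ * cutHigh y) := by
  have h := expNegInvGlue.hasDerivAt_polynomial_eval_inv_mul 1 (1 - y)
  have h2 := HasDerivAt.comp y h ((hasDerivAt_id' y).const_sub 1)
  have h3 : HasDerivAt cutLow (-((1 - y)⁻¹ * cutHigh y)) y := by
    simp only [Polynomial.eval_one, one_mul, Polynomial.derivative_one, sub_zero, mul_one,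
      Polynomial.eval_pow, Polynomial.eval_X] at h2
    refine h2.congr_deriv ?_
    unfold cutHigh
    ring
  exact h3.deriv

lemma cutLow_sq_le_one (y : ℝ) : cutLow y ^ 2 ≤ 1 := by
  have h0 : 0 ≤ cutLow y := expNegInvGlue.nonneg _
  have h1 : cutLow y ≤ 1 := by
    unfold cutLow expNegInvGlue
    split_ifs with h
    · exact zero_le_one
    · rw [Real.exp_le_one_iff, neg_nonpos, inv_nonneg]
      exact (not_le.1 h).le
  exact pow_le_one₀ h0 h1

lemma cutHigh_ge {y : ℝ} (hy : y ∈ Set.Icc (1 / 4 : ℝ) (1 / 2)) :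
    Real.exp (-2) ≤ cutHigh y := by
  have h1 : 0 < 1 - y := by linarith [hy.2]
  have h2 : 1 ≤ (1 - y)⁻¹ := (one_le_inv₀ h1).2 (by linarith [hy.1])
  have h3 : (1 - y)⁻¹ ≤ 2 := by
    rw [inv_le_comm₀ h1 two_pos]; linarith [hy.2]
  unfold cutHigh expNegInvGlue
  rw [if_neg (not_le.2 h1)]
  have h4 : Real.exp (-2) ≤ Real.exp (-(1 - y)⁻¹) := Real.exp_le_exp.2 (by linarith)
  calc Real.exp (-2) = 1 * Real.exp (-2) := (one_mul _).symm
    _ ≤ _ := mul_le_mul h2 h4 (Real.exp_pos _).le (by linarith)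

/-- Differentiating the power cancels 8κ s². Differentiating `cutLow` gives -8 (x/(4M)) `cutHigh`²
times the remaining factors, which cancels the first term: this fixes the constant √(2/M). Only the
derivative of the transition on [1, 2] survives, independently of M. -/
lemma virial_remainder_le : ∃ C, 0 ≤ C ∧ ∀ κ M x : ℝ, 0 ≤ κ → 0 < M → 0 ≤ x →
    |x * (√(2 / M) * cutPow κ cutHigh (4 * M) x) ^ 2 + 8 * κ * cutPow κ cutLow (4 * M) x ^ 2 +
      8 * x * (cutPow κ cutLow (4 * M) x * deriv (cutPow κ cutLow (4 * M)) x)| ≤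
      (Set.Iic 2).indicator (fun _ => C) x := by
  obtain ⟨C₃, hC₃⟩ := exists_deriv_smoothTransition_le
  have z₃ : 0 ≤ C₃ := (abs_nonneg _).trans (hC₃ 0)
  refine ⟨16 * C₃, by positivity, fun κ M x hκ hM hx => ?_⟩
  rcases hx.eq_or_lt with rfl | hx0
  · have : cutPow κ cutLow (4 * M) 0 = 0 := by
      unfold cutPow
      rw [Real.smoothTransition.zero_of_nonpos (by norm_num), zero_mul, mul_zero]
    rw [this, Set.indicator_of_mem (by simp)]
    simp; positivity
  · have key : x * (√(2 / M) * cutPow κ cutHigh (4 * M) x) ^ 2 +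
        8 * κ * cutPow κ cutLow (4 * M) x ^ 2 +
        8 * x * (cutPow κ cutLow (4 * M) x * deriv (cutPow κ cutLow (4 * M)) x) =
        8 * ((x ^ (-κ)) ^ 2 * Real.smoothTransition (x - 1) *
          (x * deriv (fun x : ℝ => Real.smoothTransition (x - 1)) x) * cutLow (x / (4 * M)) ^ 2) := by
      rw [show 8 * x * (cutPow κ cutLow (4 * M) x * deriv (cutPow κ cutLow (4 * M)) x) =
        8 * cutPow κ cutLow (4 * M) x * (x * deriv (cutPow κ cutLow (4 * M)) x) by ring,
        mul_deriv_cutPow κ contDiff_cutLow hx0, deriv_cutLow, mul_pow, Real.sq_sqrt (by positivity),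
        show 2 / M = 8 / (4 * M) by field_simp; norm_num]
      unfold cutPow cutHigh cutLow
      ring
    rw [key]
    by_cases hx1 : x ∈ Set.Icc (1 : ℝ) 2
    · rw [Set.indicator_of_mem (Set.mem_Iic.2 hx1.2)]
      have b1 : |Real.smoothTransition (x - 1)| ≤ 1 := by
        rw [abs_of_nonneg (Real.smoothTransition.nonneg _)]
        exact Real.smoothTransition.le_one _
      have b2 : |x * deriv (fun x : ℝ => Real.smoothTransition (x - 1)) x| ≤ 2 * C₃ := by
        rw [abs_mul, abs_of_pos hx0]
        exact mul_le_mul hx1.2 (hC₃ x) (abs_nonneg _) (by norm_num)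
      have b3 : |(x ^ (-κ)) ^ 2| ≤ 1 := by
        rw [abs_of_nonneg (sq_nonneg _)]
        exact pow_le_one₀ (Real.rpow_nonneg hx _)
          (Real.rpow_le_one_of_one_le_of_nonpos hx1.1 (by linarith))
      have b4 : |cutLow (x / (4 * M)) ^ 2| ≤ 1 := by
        rw [abs_of_nonneg (sq_nonneg _)]
        exact cutLow_sq_le_one _
      rw [abs_mul, abs_mul, abs_mul, abs_mul, abs_of_pos (by norm_num : (0 : ℝ) < 8)]
      have b5 := mul_le_mul (mul_le_mul (mul_le_mul b3 b1 (abs_nonneg _) zero_le_one) b2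
        (abs_nonneg _) (by norm_num)) b4 (abs_nonneg _) (by positivity)
      linarith
    · rw [deriv_smoothTransition_eq_zero hx1]
      simp only [mul_zero, zero_mul, abs_zero]
      exact Set.indicator_nonneg (fun _ _ => by positivity) _

/-- The exponent for which the scaling terms in the virial inequality cancel. -/
noncomputable def virialExp (d : ℕ) : ℝ := (2 * d + 1) / 8

/-- The weight `x ^ (-(2 * virialExp d) - 1)` on `[1, ∞)`. -/
noncomputable def tailWeight (d : ℕ) : ℝ → ℝ :=
  (Set.Ici 1).indicator fun x => x ^ (-(2 * virialExp d) - 1)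

lemma measurable_tailWeight : Measurable (tailWeight d) :=
  (measurable_id.pow_const _).indicator measurableSet_Ici

/-- With the density x^(d/2) for the weight |z|² the exponent is d/2 - (2d+1)/4 - 1 = -5/4,
integrable at infinity. -/
lemma integrable_tailWeight :
    Integrable fun p : Heis d => ‖p.1‖ ^ 2 * tailWeight d (tau p) := by
  have h := integrable_polar_iff (d := d) 2 (measurable_tailWeight (d := d)).stronglyMeasurable
  simp only [smul_eq_mul] at h
  rw [h]
  have h1 : IntegrableOn (fun x : ℝ => polarConst d 2 * x ^ (-(5 / 4) : ℝ)) (Set.Ici 1) := by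
    rw [integrableOn_Ici_iff_integrableOn_Ioi]
    exact (integrableOn_Ioi_rpow_of_lt (by norm_num) one_pos).const_mul _
  rw [← integrable_indicator_iff measurableSet_Ici] at h1
  refine (h1.congr (Filter.Eventually.of_forall fun x => ?_)).integrableOn
  by_cases hx : x ∈ Set.Ici (1 : ℝ)
  · have hx0 : 0 < x := lt_of_lt_of_le one_pos hx
    rw [tailWeight, Set.indicator_of_mem hx, Set.indicator_of_mem hx, polarDensity_two, mul_assoc,
      ← Real.rpow_add hx0]
    congr 2
    unfold virialExp; ring
  · rw [tailWeight, Set.indicator_of_notMem hx, Set.indicator_of_notMem hx, mul_zero]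

lemma indicator_div_le_tailWeight {C N x : ℝ} (hC : 0 ≤ C) :
    x⁻¹ * (Set.Icc 1 N).indicator (fun x => C * x ^ (-(2 * virialExp d))) x ≤
      C * tailWeight d x := by
  by_cases hx : x ∈ Set.Icc 1 N
  · have hx0 : 0 < x := lt_of_lt_of_le one_pos hx.1
    rw [tailWeight, Set.indicator_of_mem hx, Set.indicator_of_mem (Set.mem_Ici.2 hx.1),
      Real.rpow_sub_one hx0.ne']
    apply le_of_eq
    ring
  · rw [Set.indicator_of_notMem hx, mul_zero]
    refine mul_nonneg hC (Set.indicator_nonneg (fun y hy => ?_) _)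
    exact Real.rpow_nonneg (zero_le_one.trans hy) _

/-- On [1, 4M] one has 2/M ≤ 8/x, so the small constant in front of a² plays the role of the factor
1/x. -/
lemma indicator_div_scale_le_tailWeight {C M x : ℝ} (hC : 0 ≤ C) (hM : 0 < M) :
    2 / M * (Set.Icc 1 (4 * M)).indicator (fun x => C * x ^ (-(2 * virialExp d))) x ≤
      8 * (C * tailWeight d x) := by
  refine le_trans ?_ (mul_le_mul_of_nonneg_left
    (indicator_div_le_tailWeight (d := d) (N := 4 * M) (x := x) hC) (by norm_num : (0 : ℝ) ≤ 8))
  by_cases hx : x ∈ Set.Icc 1 (4 * M)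
  · have hx0 : 0 < x := lt_of_lt_of_le one_pos hx.1
    rw [Set.indicator_of_mem hx, ← mul_assoc 8]
    refine mul_le_mul_of_nonneg_right ?_ (mul_nonneg hC (Real.rpow_nonneg hx0.le _))
    rw [← div_eq_mul_inv, div_le_div_iff₀ hM hx0]
    linarith [hx.2]
  · rw [Set.indicator_of_notMem hx]
    simp

/-- On M ≤ τ ≤ 2M the transition equals 1, as M ≥ 2, and `cutHigh` is evaluated in [1/4, 1/2]. There
τ · τ^(-2κ) times the polar density is of order M^(1/4), and the factor 2/M compensates the length
M. -/
lemma integral_tau_mul_cutPow_sq_ge {M : ℝ} (hM : 2 ≤ M) :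
    polarConst d 0 * (2 * Real.exp (-2) ^ 2) * M ^ (1 / 4 : ℝ) ≤
      ∫ p : Heis d, tau p * (√(2 / M) * cutPow (virialExp d) cutHigh (4 * M) (tau p)) ^ 2 := by
  have hM0 : 0 < M := by linarith
  set c : ℝ := 2 / M * Real.exp (-2) ^ 2 * M ^ (1 / 4 : ℝ) with hc
  have hc0 : 0 ≤ c := by positivity
  -- The exponent 3/4 - 2κ = -(d-1)/2 makes f times the polar density constant on [M, 2M]. The
  -- excess x^(1/4) has been replaced by M^(1/4) in c.
  set f : ℝ → ℝ := (Set.Icc M (2 * M)).indicator fun x => c * x ^ (3 / 4 - 2 * virialExp d) with hf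
  have hfm : StronglyMeasurable f :=
    (((measurable_id.pow_const _).const_mul c).indicator measurableSet_Icc).stronglyMeasurable
  have ht := isTest_cutPow (virialExp d) contDiff_cutHigh (fun y => cutHigh_eq_zero)
    (by linarith : 0 < 4 * M)
  have h1 := integral_polar (d := d) 0 hfm
  have hden : ∀ x ∈ Set.Ioi (0 : ℝ), polarDensity d 0 x • f x =
      (Set.Icc M (2 * M)).indicator (fun _ => polarConst d 0 * c) x := by
    intro x hx
    by_cases hxM : x ∈ Set.Icc M (2 * M)
    · rw [hf, Set.indicator_of_mem hxM, Set.indicator_of_mem hxM, polarDensity, smul_eq_mul,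
        show polarConst d 0 * x ^ ((2 * d + 2 + (0 : ℕ) : ℝ) / 4 - 1) *
          (c * x ^ (3 / 4 - 2 * virialExp d)) = polarConst d 0 * c *
          (x ^ ((2 * d + 2 + (0 : ℕ) : ℝ) / 4 - 1) * x ^ (3 / 4 - 2 * virialExp d)) by ring,
        ← Real.rpow_add hx, show (2 * d + 2 + (0 : ℕ) : ℝ) / 4 - 1 + (3 / 4 - 2 * virialExp d) = 0 by
          unfold virialExp; push_cast; ring, Real.rpow_zero, mul_one]
    · rw [hf, Set.indicator_of_notMem hxM, Set.indicator_of_notMem hxM, smul_zero]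
  have hsub : Set.Icc M (2 * M) ⊆ Set.Ioi 0 := fun x hx => hM0.trans_le hx.1
  have h2 : ∫ x in Set.Ioi 0, polarDensity d 0 x • f x = polarConst d 0 * c * M := by
    rw [setIntegral_congr_fun measurableSet_Ioi hden, setIntegral_indicator measurableSet_Icc,
      Set.inter_eq_self_of_subset_right hsub, setIntegral_const,
      Real.volume_real_Icc_of_le (by linarith), smul_eq_mul]
    ring
  have h3 : polarConst d 0 * (2 * Real.exp (-2) ^ 2) * M ^ (1 / 4 : ℝ) =
      polarConst d 0 * c * M := by
    rw [hc]; field_simp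
  rw [h3, ← h2, ← h1]
  refine integral_mono_of_nonneg (Filter.Eventually.of_forall fun p => ?_) ?_
    (Filter.Eventually.of_forall fun p => ?_)
  · simp only [pow_zero, one_smul, Pi.zero_apply]
    exact Set.indicator_nonneg (fun x hx => mul_nonneg hc0
      (Real.rpow_nonneg (hM0.le.trans hx.1) _)) _
  · have c1 : Continuous fun p : Heis d => cutPow (virialExp d) cutHigh (4 * M) (tau p) :=
      ht.contDiff.continuous.comp continuous_tau
    have c2 := continuous_tau (d := d)
    refine Continuous.integrable_of_hasCompactSupport (by fun_prop) ?_
    have : HasCompactSupport fun x => (√(2 / M) * cutPow (virialExp d) cutHigh (4 * M) x) ^ 2 :=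
      ht.compact.comp_left (g := fun x : ℝ => (√(2 / M) * x) ^ 2) (by simp)
    exact (hasCompactSupport_comp_tau this).mul_left
  · simp only [pow_zero, one_smul]
    by_cases hxM : tau p ∈ Set.Icc M (2 * M)
    · have hx0 : 0 < tau p := hM0.trans_le hxM.1
      rw [hf, Set.indicator_of_mem hxM, mul_pow, Real.sq_sqrt (by positivity)]
      unfold cutPow
      rw [Real.smoothTransition.one_of_one_le (by linarith [hxM.1]), one_mul, mul_pow,
        ← Real.rpow_natCast (tau p ^ (-virialExp d)), ← Real.rpow_mul hx0.le]
      have h4 : Real.exp (-2) ≤ cutHigh (tau p / (4 * M)) := by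
        refine cutHigh_ge ⟨?_, ?_⟩
        · rw [le_div_iff₀ (by linarith)]; linarith [hxM.1]
        · rw [div_le_iff₀ (by linarith)]; linarith [hxM.2]
      have h5 : Real.exp (-2) ^ 2 ≤ cutHigh (tau p / (4 * M)) ^ 2 :=
        pow_le_pow_left₀ (Real.exp_pos _).le h4 2
      have h6 : M ^ (1 / 4 : ℝ) ≤ tau p ^ (1 / 4 : ℝ) :=
        Real.rpow_le_rpow hM0.le hxM.1 (by norm_num)
      have h7 : tau p * tau p ^ (-virialExp d * (2 : ℕ)) =
          tau p ^ (1 / 4 : ℝ) * tau p ^ (3 / 4 - 2 * virialExp d) := by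
        nth_rewrite 1 [← Real.rpow_one (tau p)]
        rw [← Real.rpow_add hx0, ← Real.rpow_add hx0]
        congr 1; push_cast; ring
      have h8 := mul_le_mul h5 h6 (by positivity) (sq_nonneg _)
      have h9 : 0 ≤ 2 / M * tau p ^ (3 / 4 - 2 * virialExp d) := by positivity
      calc c * tau p ^ (3 / 4 - 2 * virialExp d)
          = Real.exp (-2) ^ 2 * M ^ (1 / 4 : ℝ) * (2 / M * tau p ^ (3 / 4 - 2 * virialExp d)) := by
            rw [hc]; ring
        _ ≤ _ := mul_le_mul_of_nonneg_right h8 h9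
        _ = 2 / M * cutHigh (tau p / (4 * M)) ^ 2 *
            (tau p ^ (1 / 4 : ℝ) * tau p ^ (3 / 4 - 2 * virialExp d)) := by ring
        _ = _ := by rw [← h7]; ring
    · rw [hf, Set.indicator_of_notMem hxM]
      exact mul_nonneg (tau_nonneg p) (sq_nonneg _)

/-- Orthogonality of the potential to the tangential moments excludes positive real parts. -/
theorem not_pos_of_virial (hd : 1 ≤ d) {V : Heis d → ℂ} {V' : Heis d → Heis d →L[ℝ] ℂ}
    (hV : HasWeakFDeriv V V') {b₁ b₂ mu : ℝ}
    (h₁ : FormBounded (fun p => max 0 (-(V p).re)) b₁)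
    (h₂ : FormBounded (fun p => max 0 (radialDerivRho V V' p)) b₂)
    (hR : ∀ k : ℝ → ℝ, ContDiff ℝ ∞ k → HasCompactSupport k →
      ∫ p, (V p).re * (qpoly p * k (tau p)) = mu * ∫ p : Heis d, qpoly p * k (tau p)) :
    ¬ 0 < mu := by
  intro hmu
  obtain ⟨C₀, hC₀, hr⟩ := virial_remainder_le
  obtain ⟨C₁, hC₁, hlow⟩ := exists_cutPow_le (virialExp d) contDiff_cutLow fun y => cutLow_eq_zero
  obtain ⟨C₂, hC₂, hhigh⟩ := exists_cutPow_le (virialExp d) contDiff_cutHigh fun y => cutHigh_eq_zero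
  have hκ : 0 ≤ virialExp d := by unfold virialExp; positivity
  have cτ := continuous_tau (d := d)
  set J : ℝ := ∫ p : Heis d, ‖p.1‖ ^ 2 * tailWeight d (tau p) with hJ
  have iJ := integrable_tailWeight (d := d)
  set R₀ : ℝ := ∫ p : Heis d, (Set.Iic 2).indicator (fun _ => C₀) (tau p) * |(V p).re| with hR₀
  have iR : Integrable fun p : Heis d => (Set.Iic 2).indicator (fun _ => C₀) (tau p) * |(V p).re| := by
    have h1 := (integrable_indicator_tau hV.locInt 2).re.norm.const_mul C₀
    refine h1.congr (Filter.Eventually.of_forall fun p => ?_)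
    by_cases hp : tau p ≤ 2
    · simp [Set.indicator, hp]
    · simp [Set.indicator, hp]
  set α : ℝ := ((d : ℝ) + 1) / (d + 2) with hα
  have hα0 : 0 ≤ α := by positivity
  set T : ℝ := α * R₀ + (b₁ ^ 2 * (320 * C₂ * J) + α * (b₂ ^ 2 * (16 * C₁ * J))) with hT
  set c : ℝ := mu * (1 / (((d : ℝ) + 1) * (d + 2))) * (polarConst d 0 * (2 * Real.exp (-2) ^ 2))
    with hc
  have hc0 : 0 < c := by have := polarConst_pos hd 0; positivity
  -- T is independent of M: the moment of Re V is confined to τ ≤ 2 and both energies are dominated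
  -- by `tailWeight`.
  have main : ∀ M : ℝ, 2 ≤ M → c * M ^ (1 / 4 : ℝ) ≤ T := by
    intro M hM
    have hM0 : 0 < M := by linarith
    have tH := isTest_cutPow (virialExp d) contDiff_cutHigh (fun y => cutHigh_eq_zero)
      (by linarith : 0 < 4 * M)
    have tL := isTest_cutPow (virialExp d) contDiff_cutLow (fun y => cutLow_eq_zero)
      (by linarith : 0 < 4 * M)
    have tA := tH.const_mul √(2 / M)
    set A := cutPow (virialExp d) cutHigh (4 * M) with hA
    set s := cutPow (virialExp d) cutLow (4 * M) with hs
    have h3 := combined_virial_le hV h₁ h₂ hR tA.contDiff tA.compact tL.contDiff tL.compact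
    have h4 := mul_le_mul_of_nonneg_left (integral_tau_mul_cutPow_sq_ge (d := d) hM)
      (by positivity : 0 ≤ mu * (1 / (((d : ℝ) + 1) * (d + 2))))
    have e1 : ∫ p, (V p).re * (tau p * (√(2 / M) * A (tau p)) ^ 2 + (2 * d + 1) * s (tau p) ^ 2
        + 8 * tau p * (s (tau p) * deriv s (tau p))) ≤ R₀ := by
      refine (le_abs_self _).trans (abs_integral_le_integral_abs.trans
        (integral_mono_of_nonneg (Filter.Eventually.of_forall fun p => abs_nonneg _) iR
          (Filter.Eventually.of_forall fun p => ?_)))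
      have := hr (virialExp d) M (tau p) hκ hM0 (tau_nonneg p)
      rw [show 8 * virialExp d = 2 * d + 1 by unfold virialExp; ring] at this
      simp only [abs_mul (V p).re]
      rw [mul_comm]
      exact mul_le_mul_of_nonneg_right this (abs_nonneg _)
    have e2 : ∫ p : Heis d, ‖hgrad (fun p => ((√(2 / M) * A (tau p) * ‖p.1‖ ^ 2 : ℝ) : ℂ)) p‖ ^ 2 ≤
        320 * C₂ * J := by
      rw [hJ, ← integral_const_mul]
      refine integral_mono_of_nonneg (Filter.Eventually.of_forall fun p => sq_nonneg _)
        (iJ.const_mul _) (Filter.Eventually.of_forall fun p => ?_)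
      refine (norm_hgrad_comp_tau_mul_normSq_le (tA.contDiff.differentiable (by simp)) p).trans ?_
      have hdA : deriv (fun x => √(2 / M) * A x) (tau p) = √(2 / M) * deriv A (tau p) :=
        deriv_const_mul _ (tH.contDiff.differentiable (by simp) _)
      have k0 := indicator_div_scale_le_tailWeight (d := d) (x := tau p) hC₂ hM0
      obtain ⟨k1, k2⟩ := hhigh (4 * M) (by linarith) (tau p)
      have k3 := mul_le_mul_of_nonneg_left k1 (by positivity : 0 ≤ 2 / M)
      have k4 := mul_le_mul_of_nonneg_left k2 (by positivity : 0 ≤ 2 / M)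
      rw [hdA, show tau p * (√(2 / M) * deriv A (tau p)) = √(2 / M) * (tau p * deriv A (tau p)) by
        ring, mul_pow, mul_pow (√(2 / M)), Real.sq_sqrt (by positivity)]
      -- Each bracket is at most 8 C₂ times the tail weight, and 8 · 8 + 32 · 8 = 320.
      have : 8 * (2 / M * A (tau p) ^ 2) + 32 * (2 / M * (tau p * deriv A (tau p)) ^ 2) ≤
          320 * C₂ * tailWeight d (tau p) := by linarith
      calc _ ≤ ‖p.1‖ ^ 2 * (320 * C₂ * tailWeight d (tau p)) :=
            mul_le_mul_of_nonneg_left this (sq_nonneg _)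
        _ = _ := by ring
    have e3 : ∫ p : Heis d, 16 * ‖p.1‖ ^ 2 * tau p * deriv s (tau p) ^ 2 ≤ 16 * C₁ * J := by
      rw [hJ, ← integral_const_mul]
      refine integral_mono_of_nonneg (Filter.Eventually.of_forall fun p => ?_)
        (iJ.const_mul _) (Filter.Eventually.of_forall fun p => ?_)
      · have := tau_nonneg p
        simp only [Pi.zero_apply]
        positivity
      · obtain ⟨-, k2⟩ := hlow (4 * M) (by linarith) (tau p)
        have k3 := (mul_le_mul_of_nonneg_left k2 (inv_nonneg.2 (tau_nonneg p))).trans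
          (indicator_div_le_tailWeight (d := d) hC₁)
        have k4 : (tau p)⁻¹ * (tau p * deriv s (tau p)) ^ 2 = tau p * deriv s (tau p) ^ 2 := by
          rcases eq_or_ne (tau p) 0 with h | h
          · rw [h]; simp
          · field_simp
        rw [k4] at k3
        calc 16 * ‖p.1‖ ^ 2 * tau p * deriv s (tau p) ^ 2
            = 16 * ‖p.1‖ ^ 2 * (tau p * deriv s (tau p) ^ 2) := by ring
          _ ≤ 16 * ‖p.1‖ ^ 2 * (C₁ * tailWeight d (tau p)) :=
            mul_le_mul_of_nonneg_left k3 (by positivity)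
          _ = _ := by ring
    have e4 := mul_le_mul_of_nonneg_left e1 hα0
    have e5 := mul_le_mul_of_nonneg_left e2 (sq_nonneg b₁)
    have e6 := mul_le_mul_of_nonneg_left (mul_le_mul_of_nonneg_left e3 (sq_nonneg b₂)) hα0
    calc c * M ^ (1 / 4 : ℝ) = mu * (1 / (((d : ℝ) + 1) * (d + 2))) *
          (polarConst d 0 * (2 * Real.exp (-2) ^ 2) * M ^ (1 / 4 : ℝ)) := by rw [hc]; ring
      _ ≤ _ := h4
      _ ≤ _ := h3
      _ ≤ _ := add_le_add e4 (add_le_add e5 e6)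
  have h := (tendsto_rpow_atTop (by norm_num : (0 : ℝ) < 1 / 4)).const_mul_atTop hc0
  obtain ⟨M, hM⟩ := ((h.eventually_gt_atTop T).and (Filter.eventually_ge_atTop 2)).exists
  exact absurd (main M hM.2) (not_le.2 hM.1)

/-! ### The profile of an eigenfunction with nonpositive real part of the eigenvalue -/

lemma integrableOn_Ioi_of_continuousOn {E F : Type*} [Zero F] [NormedAddCommGroup E] {f : ℝ → E}
    {k : ℝ → F} (hf : ContinuousOn f (Set.Ioi 0)) (hc : HasCompactSupport k)
    (hs : tsupport k ⊆ Set.Ioi 0) (hz : ∀ x, x ∉ tsupport k → f x = 0) :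
    IntegrableOn f (Set.Ioi 0) :=
  ((hf.mono hs).integrableOn_compact hc.isCompact).of_forall_sdiff_eq_zero measurableSet_Ioi
    fun x hx => hz x hx.2

/-- The algebra of the Caccioppoli inequality, with r the weight, e = η, e' = η' and P = g'. It
expands Re(g' · conj((η² g)')) as |(η g)'|² - η'² |g|². -/
lemma re_mul_star_deriv (r e e' : ℝ) (P g : ℂ) :
    ((r : ℂ) * P * ((e' : ℂ) * star ((e : ℂ) * g) + (e : ℂ) * star ((e' : ℂ) * g + (e : ℂ) * P))).re =
      r * ‖(e' : ℂ) * g + (e : ℂ) * P‖ ^ 2 - r * (e' ^ 2 * ‖g‖ ^ 2) := by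
  rw [Complex.sq_norm, Complex.sq_norm, Complex.normSq_apply, Complex.normSq_apply]
  simp
  ring

namespace IsProfile

variable {f u : Heis d → ℂ} {g K m : ℝ → ℂ}

lemma deriv_eq (h : IsProfile d f u g K m) {x : ℝ} (hx : 0 < x) :
    deriv g x = K x * ((x ^ (-((d : ℝ) / 2 + 1)) : ℝ) : ℂ) := (h.hasDerivAt x hx).deriv

lemma flux_eq (h : IsProfile d f u g K m) {x : ℝ} (hx : 0 < x) :
    K x = ((x ^ ((d : ℝ) / 2 + 1) : ℝ) : ℂ) * deriv g x := by
  rw [h.deriv_eq hx, mul_comm, mul_assoc, ← Complex.ofReal_mul, ← Real.rpow_add hx]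
  simp

lemma continuousOn_deriv (h : IsProfile d f u g K m) : ContinuousOn (deriv g) (Set.Ioi 0) := by
  have h1 : ContinuousOn (fun x : ℝ => ((x ^ (-((d : ℝ) / 2 + 1)) : ℝ) : ℂ)) (Set.Ioi 0) :=
    Complex.continuous_ofReal.comp_continuousOn
      (continuousOn_id.rpow_const fun x hx => Or.inl (ne_of_gt hx))
  exact (h.continuousOn_flux.mul h1).congr fun x hx => h.deriv_eq hx

lemma hasDerivAt_deriv (h : IsProfile d f u g K m) {x : ℝ} (hx : 0 < x) :
    HasDerivAt g (deriv g x) x := (h.hasDerivAt x hx).differentiableAt.hasDerivAt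

lemma contDiffAt (h : IsProfile d f u g K m) {x : ℝ} (hx : 0 < x) : ContDiffAt ℝ 1 g x := by
  rw [contDiffAt_one_iff]
  refine ⟨fun x => ContinuousLinearMap.toSpanSingleton ℝ (deriv g x), Set.Ioi 0, Ioi_mem_nhds hx,
    ?_, fun y hy => (h.hasDerivAt_deriv hy).hasFDerivAt⟩
  exact (ContinuousLinearMap.toSpanSingletonCLE (𝕜 := ℝ) (E := ℂ)).continuous.comp_continuousOn
    h.continuousOn_deriv

lemma contDiff_mul (h : IsProfile d f u g K m) {η : ℝ → ℝ} (hη : IsTest η) :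
    ContDiff ℝ 1 fun x => (η x : ℂ) * g x := by
  refine contDiff_of_tsupport fun x hx => ?_
  have hx0 : x ∈ Set.Ioi (0 : ℝ) :=
    hη.subset (tsupport_ofReal_subset η (tsupport_mul_subset_left hx))
  exact (Complex.ofRealCLM.contDiff.comp (hη.contDiff.of_le (by norm_cast))).contDiffAt.mul
    (h.contDiffAt hx0)

/-- The Caccioppoli inequality for the profile. -/
lemma caccioppoli (h : IsProfile d f u g K m) (hd : 1 ≤ d) {W : Heis d → ℝ} {b : ℝ}
    (hb : FormBounded W b) (hW : LocallyIntegrable W volume) (hW0 : ∀ p, 0 ≤ W p)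
    (hf : LocallyIntegrable f volume) (hfW : ∀ p, -W p ≤ (f p).re) {η : ℝ → ℝ} (hη : IsTest η) :
    (1 - b ^ 2) * ∫ x in Set.Ioi 0, x ^ ((d : ℝ) / 2 + 1) *
        ‖deriv (fun x => (η x : ℂ) * g x) x‖ ^ 2 ≤
      ∫ x in Set.Ioi 0, x ^ ((d : ℝ) / 2 + 1) * (deriv η x ^ 2 * ‖g x‖ ^ 2) := by
  set φ : ℝ → ℂ := fun x => (η x : ℂ) * g x with hφ
  have cφ : ContDiff ℝ 1 φ := h.contDiff_mul hη
  have ηc : ContDiff ℝ 1 fun x => (η x : ℂ) :=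
    Complex.ofRealCLM.contDiff.comp (hη.contDiff.of_le (by norm_cast))
  -- This is η² times the conjugate of g. It is only C¹, but K is a primitive of a locally
  -- integrable function, so integration by parts against it is allowed.
  set w : ℝ → ℂ := fun x => (η x : ℂ) * star (φ x) with hw
  have cw : ContDiff ℝ 1 w := ηc.mul ((starL' ℝ : ℂ ≃L[ℝ] ℂ).contDiff.comp cφ)
  have ηs : HasCompactSupport fun x => (η x : ℂ) :=
    hη.compact.comp_left (g := fun x : ℝ => (x : ℂ)) (by simp)
  have ηt : tsupport (fun x => (η x : ℂ)) ⊆ Set.Ioi 0 := (tsupport_ofReal_subset η).trans hη.subset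
  have sw : HasCompactSupport w := ηs.mul_right
  have tw : tsupport w ⊆ Set.Ioi 0 := tsupport_mul_subset_left.trans ηt
  have sφ : HasCompactSupport φ := ηs.mul_right
  have tφ : tsupport φ ⊆ Set.Ioi 0 := tsupport_mul_subset_left.trans ηt
  have dφ : ∀ x, 0 < x → HasDerivAt φ (((deriv η x : ℝ) : ℂ) * g x + (η x : ℂ) * deriv g x) x :=
    fun x hx => (hη.hasDerivAt_ofReal x).mul (h.hasDerivAt_deriv hx)
  have dw : ∀ x, 0 < x → K x * deriv w x = ((x ^ ((d : ℝ) / 2 + 1) : ℝ) : ℂ) * deriv g x *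
      (((deriv η x : ℝ) : ℂ) * star ((η x : ℂ) * g x) +
        (η x : ℂ) * star (((deriv η x : ℝ) : ℂ) * g x + (η x : ℂ) * deriv g x)) := by
    intro x hx
    rw [((hη.hasDerivAt_ofReal x).fun_mul (dφ x hx).star).deriv, h.flux_eq hx]
  have hpow : ContinuousOn (fun x : ℝ => x ^ ((d : ℝ) / 2 + 1)) (Set.Ioi 0) :=
    continuousOn_id.rpow_const fun x hx => Or.inl (ne_of_gt hx)
  have cη' : Continuous (deriv η) := hη.deriv.contDiff.continuous
  have i1 : IntegrableOn (fun x => K x * deriv w x) (Set.Ioi 0) :=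
    integrableOn_mul_of_hasCompactSupport (h.continuousOn_flux.locallyIntegrableOn measurableSet_Ioi)
      (cw.continuous_deriv le_rfl) sw.deriv ((tsupport_deriv_subset).trans tw)
  have i2 : IntegrableOn (fun x => x ^ ((d : ℝ) / 2 + 1) * ‖deriv φ x‖ ^ 2) (Set.Ioi 0) :=
    integrableOn_Ioi_of_continuousOn
      (hpow.mul ((cφ.continuous_deriv le_rfl).norm.pow 2).continuousOn) sφ.deriv
      ((tsupport_deriv_subset).trans tφ)
      fun x hx => by rw [image_eq_zero_of_notMem_tsupport hx]; simp
  have i3 : IntegrableOn (fun x => x ^ ((d : ℝ) / 2 + 1) * (deriv η x ^ 2 * ‖g x‖ ^ 2))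
      (Set.Ioi 0) :=
    integrableOn_Ioi_of_continuousOn
      (hpow.mul ((cη'.pow 2).continuousOn.mul (h.continuousOn.norm.pow 2))) hη.deriv.compact
      hη.deriv.subset fun x hx => by rw [image_eq_zero_of_notMem_tsupport hx]; simp
  have e1 : (∫ x in Set.Ioi 0, K x * deriv w x).re =
      (∫ x in Set.Ioi 0, x ^ ((d : ℝ) / 2 + 1) * ‖deriv φ x‖ ^ 2) -
        ∫ x in Set.Ioi 0, x ^ ((d : ℝ) / 2 + 1) * (deriv η x ^ 2 * ‖g x‖ ^ 2) := by
    rw [← integral_sub i2 i3]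
    have := integral_re (𝕜 := ℂ) i1
    simp only [RCLike.re_eq_complex_re] at this
    rw [← this]
    refine setIntegral_congr_fun measurableSet_Ioi fun x hx => ?_
    rw [dw x hx, re_mul_star_deriv, (dφ x hx).deriv]
  have e2 := integral_primitive_mul h.locallyIntegrableOn_mul h.primitive
    (fun x => (cw.differentiable one_ne_zero x).hasDerivAt) (cw.continuous_deriv le_rfl) sw tw
  set c : ℝ := 16 * polarConst d 2 with hc
  have hc0 : 0 < c := by have := polarConst_pos hd 2; positivity
  have cψ : Continuous fun p : Heis d => ‖φ (tau p)‖ ^ 2 :=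
    (cφ.continuous.comp continuous_tau).norm.pow 2
  have sψ : HasCompactSupport fun p : Heis d => ‖φ (tau p)‖ ^ 2 :=
    hasCompactSupport_norm_sq (hasCompactSupport_comp_tau sφ)
  have i4 : Integrable fun p => f p * ((‖φ (tau p)‖ ^ 2 : ℝ) : ℂ) := by
    have := hf.integrable_smul_left_of_hasCompactSupport cψ sψ
    refine this.congr (Filter.Eventually.of_forall fun p => ?_)
    simp only [Complex.real_smul]; ring
  have e3 := (h.density.spec (fun x => ((‖φ x‖ ^ 2 : ℝ) : ℂ))
    (Complex.continuous_ofReal.comp (cφ.continuous.norm.pow 2)).measurable i4).2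
  -- Since g w = |φ|², the potential term is the integral of f |φ(τ)|² on the group, where the form
  -- bound applies.
  have e4 : ∫ x in Set.Ioi 0, ((c : ℂ)⁻¹ * m x * g x) * w x =
      (c : ℂ)⁻¹ * ∫ p, f p * ((‖φ (tau p)‖ ^ 2 : ℝ) : ℂ) := by
    rw [e3, ← integral_const_mul]
    refine setIntegral_congr_fun measurableSet_Ioi fun x _ => ?_
    have : g x * w x = ((‖φ x‖ ^ 2 : ℝ) : ℂ) := by
      rw [Complex.ofReal_pow, ← Complex.mul_conj']
      simp only [hw, hφ, starRingEnd_apply]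
      ring
    rw [← this]; ring
  have e5 : (∫ p, f p * ((‖φ (tau p)‖ ^ 2 : ℝ) : ℂ)).re = ∫ p, (f p).re * ‖φ (tau p)‖ ^ 2 := by
    have := integral_re (𝕜 := ℂ) i4
    simp only [RCLike.re_eq_complex_re] at this
    rw [← this]
    refine integral_congr_ae (Filter.Eventually.of_forall fun p => ?_)
    exact Complex.re_mul_ofReal _ _
  have e6 : -∫ p, W p * ‖φ (tau p)‖ ^ 2 ≤ ∫ p, (f p).re * ‖φ (tau p)‖ ^ 2 := by
    rw [← integral_neg]
    refine integral_mono (hW.integrable_mul_continuous cψ sψ).neg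
      (hf.complex_re.integrable_mul_continuous cψ sψ) fun p => ?_
    have := mul_le_mul_of_nonneg_right (hfW p) (sq_nonneg ‖φ (tau p)‖)
    simpa using this
  have e7 := hb.integral_le hW hW0 (ψ := fun p => φ (tau p))
    (cφ.comp contDiff_tau) (hasCompactSupport_comp_tau sφ)
  have e8 : ∫ p : Heis d, ‖hgrad (fun p => φ (tau p)) p‖ ^ 2 =
      c * ∫ x in Set.Ioi 0, x ^ ((d : ℝ) / 2 + 1) * ‖deriv φ x‖ ^ 2 := by
    have hsm : StronglyMeasurable fun x => 16 * x * ‖deriv φ x‖ ^ 2 := by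
      have := cφ.continuous_deriv le_rfl
      exact Continuous.stronglyMeasurable (by fun_prop)
    have := integral_polar (d := d) 2 hsm
    rw [← integral_const_mul]
    calc _ = ∫ p : Heis d, ‖p.1‖ ^ 2 • (16 * tau p * ‖deriv φ (tau p)‖ ^ 2) := by
          refine integral_congr_ae (Filter.Eventually.of_forall fun p => ?_)
          simp only [norm_hgrad_comp_tau_sq (cφ.differentiable one_ne_zero), smul_eq_mul]
          ring
      _ = _ := this
      _ = _ := by
          refine setIntegral_congr_fun measurableSet_Ioi fun x hx => ?_
          simp only [polarDensity_two, smul_eq_mul, Real.rpow_add_one (ne_of_gt hx), hc]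
          ring
  rw [e2, e4, ← Complex.ofReal_inv, ← neg_mul, ← Complex.ofReal_neg, Complex.re_ofReal_mul, e5] at e1
  set S := ∫ x in Set.Ioi 0, x ^ ((d : ℝ) / 2 + 1) * ‖deriv φ x‖ ^ 2
  set B := ∫ x in Set.Ioi 0, x ^ ((d : ℝ) / 2 + 1) * (deriv η x ^ 2 * ‖g x‖ ^ 2)
  have e9 : -(b ^ 2 * (c * S)) ≤ ∫ p, (f p).re * ‖φ (tau p)‖ ^ 2 := by
    rw [← e8]; linarith
  have e10 := mul_le_mul_of_nonneg_left e9 (inv_pos.2 hc0).le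
  have e11 : c⁻¹ * -(b ^ 2 * (c * S)) = -(b ^ 2 * S) := by field_simp
  rw [e11] at e10
  linarith

/-- The weak horizontal gradient of a radial solution is the classical one. -/
lemma grad_eq (h : IsProfile d f u g K m) {G : Heis d → EuclideanSpace ℂ (Fin d ⊕ Fin d)}
    (hG : HasWeakHGrad u G) (i : Fin d ⊕ Fin d) :
    ∀ᵐ p : Heis d, G p i = tauGrad i p • deriv g (tau p) := by
  have lGi : LocallyIntegrable (fun p => G p i) volume := by
    rw [locallyIntegrable_iff]
    intro K hK
    exact (EuclideanSpace.proj (𝕜 := ℂ) i).integrable_comp (hG.locInt_grad.integrableOn_isCompact hK)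
  have hpos : ∀ p ∈ ({0}ᶜ : Set (Heis d)), 0 < tau p := fun p hp => tau_pos hp
  have cD : ContinuousOn (fun p : Heis d => tauGrad i p • deriv g (tau p)) {0}ᶜ :=
    (contDiff_tauGrad (n := 0) i).continuous.continuousOn.smul
      (h.continuousOn_deriv.comp continuous_tau.continuousOn hpos)
  -- Test functions vanish near the origin, where g may be singular. The origin itself is a null
  -- set.
  have key := isOpen_compl_singleton.ae_eq_zero_of_integral_contDiff_smul_eq_zero (μ := volume)
    (f := fun p : Heis d => G p i - tauGrad i p • deriv g (tau p)) (U := {0}ᶜ)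
    ((lGi.locallyIntegrableOn _).sub (cD.locallyIntegrableOn isOpen_compl_singleton.measurableSet))
    fun φ hφ hφc hφs => by
      have hφd := hφ.differentiable (by simp)
      have c1 : ContDiff ℝ 1 fun p => φ p • g (tau p) := by
        refine contDiff_of_tsupport fun p hp => ?_
        have hp0 := hpos p (hφs (tsupport_smul_subset_left _ _ hp))
        exact (hφ.of_le (by norm_cast)).contDiffAt.smul
          ((h.contDiffAt hp0).comp p contDiff_tau.contDiffAt)
      have e1 := integral_hderiv_eq_zero c1 (hφc.smul_right) i
      have e2 : ∀ p, hderiv i (fun p => φ p • g (tau p)) p =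
          hderiv i φ p • g (tau p) + φ p • (tauGrad i p • deriv g (tau p)) := by
        intro p
        by_cases hp : p ∈ tsupport φ
        · have hp0 := hpos p (hφs hp)
          have dg := (h.hasDerivAt_deriv hp0).differentiableAt
          rw [hderiv_smul i (hφd p) (dg.fun_comp' p (differentiable_tau p)),
            hderiv_comp i dg (differentiable_tau p), hderiv_tau, add_comm]
        · have z1 : (fun p => φ p • g (tau p)) =ᶠ[nhds p] fun _ => 0 := by
            filter_upwards [notMem_tsupport_iff_eventuallyEq.1 hp] with q hq
            rw [hq]; simp
          have z2 := notMem_tsupport_iff_eventuallyEq.1 hp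
          unfold hderiv
          rw [z1.fderiv_eq, z2.fderiv_eq, z2.eq_of_nhds]
          simp
      have i1 : Integrable fun p => hderiv i φ p • g (tau p) := by
        have := hG.locInt.integrable_smul_left_of_hasCompactSupport
          (contDiff_hderiv (m := 0) hφ (by simp) i).continuous (hasCompactSupport_hderiv hφc i)
        refine this.congr ?_
        filter_upwards [h.ae_eq] with p hp
        rw [hp]
      have i3 : Integrable fun p => hderiv i (fun p => φ p • g (tau p)) p :=
        (contDiff_hderiv (m := 0) c1 (by simp) i).continuous.integrable_of_hasCompactSupport
          (hasCompactSupport_hderiv hφc.smul_right i)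
      have i2 : Integrable fun p => φ p • (tauGrad i p • deriv g (tau p)) := by
        refine (i3.sub i1).congr (Filter.Eventually.of_forall fun p => ?_)
        simp only [Pi.sub_apply, e2, add_sub_cancel_left]
      have i4 : Integrable fun p => φ p • G p i :=
        lGi.integrable_smul_left_of_hasCompactSupport hφ.continuous hφc
      simp_rw [e2] at e1
      rw [integral_add i1 i2] at e1
      have e3 := hG.integral_eq φ hφ hφc i
      have e4 : ∫ p, hderiv i φ p • g (tau p) = ∫ p, (fderiv ℝ φ p (hfield i p)) • u p := by
        refine integral_congr_ae ?_
        filter_upwards [h.ae_eq] with p hp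
        rw [hp]; rfl
      simp_rw [smul_sub]
      rw [integral_sub i4 i2]
      rw [e4, e3] at e1
      rw [sub_eq_zero]
      exact (neg_add_eq_zero.1 e1)
  have h0 : ∀ᵐ p : Heis d, p ∈ ({0}ᶜ : Set (Heis d)) := by
    have hz : volume {p : Heis d | tau p ≤ 0} = 0 := tau_le_zero le_rfl
    refine measure_mono_null (fun p hp => ?_) hz
    have : p = 0 := by simpa using hp
    rw [this]
    exact tau_zero.le
  filter_upwards [key, h0] with p hp hp0
  exact sub_eq_zero.1 (hp hp0)

lemma integrableOn_deriv_sq (h : IsProfile d f u g K m) (hd : 1 ≤ d)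
    {G : Heis d → EuclideanSpace ℂ (Fin d ⊕ Fin d)} (hG : MemH1 u G) :
    IntegrableOn (fun x => x ^ ((d : ℝ) / 2 + 1) * ‖deriv g x‖ ^ 2) (Set.Ioi 0) := by
  have h1 : Integrable fun p => ‖G p‖ ^ 2 := hG.memLp_grad.integrable_norm_pow two_ne_zero
  have h2 : ∀ᵐ p : Heis d, ‖G p‖ ^ 2 = ‖p.1‖ ^ 2 • (16 * tau p * ‖deriv g (tau p)‖ ^ 2) := by
    filter_upwards [ae_all_iff.2 fun i => h.grad_eq hG.weak i] with p hp
    rw [EuclideanSpace.norm_sq_eq]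
    simp_rw [hp, norm_smul, mul_pow, Real.norm_eq_abs, sq_abs]
    rw [← Finset.sum_mul, sum_tauGrad_sq, smul_eq_mul]
    ring
  have hsm : StronglyMeasurable fun x => 16 * x * ‖deriv g x‖ ^ 2 :=
    ((measurable_id.const_mul 16).mul ((measurable_deriv g).norm.pow_const 2)).stronglyMeasurable
  have h3 := (integrable_polar_iff (d := d) 2 hsm).1 (h1.congr h2)
  refine (IntegrableOn.congr_fun (h3.const_mul (16 * polarConst d 2)⁻¹) (fun x hx => ?_)
    measurableSet_Ioi)
  have := polarConst_pos hd 2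
  simp only [polarDensity_two, smul_eq_mul, Real.rpow_add_one (ne_of_gt hx)]
  field_simp

lemma integrableOn_sq (h : IsProfile d f u g K m) (hd : 1 ≤ d) (hu : MemLp u 2 volume) :
    IntegrableOn (fun x => x ^ (((d : ℝ) - 1) / 2) * ‖g x‖ ^ 2) (Set.Ioi 0) := by
  have h1 : Integrable fun p => ‖u p‖ ^ 2 := hu.integrable_norm_pow two_ne_zero
  have hsm : StronglyMeasurable fun x => ‖g x‖ ^ 2 := (h.measurable.norm.pow_const 2).stronglyMeasurable
  have h3 := (integrable_polar_iff (d := d) 0 hsm).1 (h1.congr (by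
    filter_upwards [h.ae_eq] with p hp
    simp [hp]))
  refine (IntegrableOn.congr_fun (h3.const_mul (polarConst d 0)⁻¹) (fun x hx => ?_)
    measurableSet_Ioi)
  have := polarConst_pos hd 0
  unfold polarDensity
  rw [show (2 * d + 2 + (0 : ℕ) : ℝ) / 4 - 1 = ((d : ℝ) - 1) / 2 by push_cast; ring]
  simp only [smul_eq_mul]
  field_simp

end IsProfile

/-- Cauchy–Schwarz in the form 2|F'| ≤ δ s^a |F'|² + δ⁻¹ s^(-a) with a = d/2 + 1, where δ is left
free. The tail of s^(-a) is (2/d) x^(-d/2), at most 2 x^(-d/2) because d ≥ 1. -/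
lemma norm_sub_le_of_integral_sq_le (hd : 1 ≤ d) {F : ℝ → ℂ} {x y D δ : ℝ} (hx : 0 < x) (hxy : x ≤ y)
    (hδ : 0 < δ) (hF : ∀ s, 0 < s → HasDerivAt F (deriv F s) s)
    (hF' : ContinuousOn (deriv F) (Set.Ioi 0))
    (hi : IntegrableOn (fun s => s ^ ((d : ℝ) / 2 + 1) * ‖deriv F s‖ ^ 2) (Set.Ioi 0))
    (hD : ∫ s in Set.Ioi 0, s ^ ((d : ℝ) / 2 + 1) * ‖deriv F s‖ ^ 2 ≤ D) :
    ‖F y - F x‖ ≤ (δ * D + δ⁻¹ * (2 * x ^ (-((d : ℝ) / 2)))) / 2 := by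
  set a : ℝ := (d : ℝ) / 2 + 1 with ha
  have hd' : (1 : ℝ) ≤ d := by exact_mod_cast hd
  have hsub : Set.Ioi x ⊆ Set.Ioi (0 : ℝ) := Set.Ioi_subset_Ioi hx.le
  have i1 := hi.mono_set hsub
  have i2 : IntegrableOn (fun s : ℝ => s ^ (-a)) (Set.Ioi x) :=
    integrableOn_Ioi_rpow_of_lt (by linarith) hx
  have i3 : IntegrableOn (fun s => (δ * (s ^ a * ‖deriv F s‖ ^ 2) + δ⁻¹ * s ^ (-a)) / 2)
      (Set.Ioi x) := ((i1.const_mul δ).add (i2.const_mul δ⁻¹)).div_const 2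
  have e1 : ∫ s in x..y, deriv F s = F y - F x := by
    refine intervalIntegral.integral_eq_sub_of_hasDerivAt (fun s hs => hF s ?_) ?_
    · rw [Set.uIcc_of_le hxy] at hs; exact hx.trans_le hs.1
    · exact intervalIntegrable_of_Ioi (hF'.locallyIntegrableOn measurableSet_Ioi) hx
        (hx.trans_le hxy)
  have pw : ∀ s, 0 < s → ‖deriv F s‖ ≤ (δ * (s ^ a * ‖deriv F s‖ ^ 2) + δ⁻¹ * s ^ (-a)) / 2 := by
    intro s hs
    set q : ℝ := s ^ a with hq
    have hq0 : 0 < q := Real.rpow_pos_of_pos hs _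
    rw [Real.rpow_neg hs.le, ← hq, ← mul_inv]
    set t := ‖deriv F s‖
    have h1 : 0 < δ * q := mul_pos hδ hq0
    have h2 : 0 ≤ (δ * q * t - 1) ^ 2 * (δ * q)⁻¹ := by positivity
    have h3 : (δ * q * t - 1) ^ 2 * (δ * q)⁻¹ = δ * (q * t ^ 2) + (δ * q)⁻¹ - 2 * t := by
      field_simp; ring
    linarith
  have e2 : ‖∫ s in x..y, deriv F s‖ ≤
      ∫ s in Set.Ioc x y, (δ * (s ^ a * ‖deriv F s‖ ^ 2) + δ⁻¹ * s ^ (-a)) / 2 := by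
    rw [intervalIntegral.integral_of_le hxy]
    refine norm_integral_le_of_norm_le (i3.mono_set Set.Ioc_subset_Ioi_self) ?_
    filter_upwards [ae_restrict_mem measurableSet_Ioc] with s hs
    exact pw s (hx.trans hs.1)
  have e3 : ∫ s in Set.Ioc x y, (δ * (s ^ a * ‖deriv F s‖ ^ 2) + δ⁻¹ * s ^ (-a)) / 2 ≤
      ∫ s in Set.Ioi x, (δ * (s ^ a * ‖deriv F s‖ ^ 2) + δ⁻¹ * s ^ (-a)) / 2 := by
    refine setIntegral_mono_set i3 ?_ Set.Ioc_subset_Ioi_self.eventuallyLE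
    filter_upwards [ae_restrict_mem measurableSet_Ioi] with s hs
    exact (norm_nonneg _).trans (pw s (hx.trans hs))
  have e4 : ∫ s in Set.Ioi x, s ^ a * ‖deriv F s‖ ^ 2 ≤ D := by
    refine (setIntegral_mono_set hi ?_ hsub.eventuallyLE).trans hD
    filter_upwards [ae_restrict_mem measurableSet_Ioi] with s hs
    have := Set.mem_Ioi.1 hs
    simp only [Pi.zero_apply]
    positivity
  have e5 : ∫ s in Set.Ioi x, s ^ (-a) ≤ 2 * x ^ (-((d : ℝ) / 2)) := by
    rw [integral_Ioi_rpow_of_lt (by linarith) hx, show -a + 1 = -((d : ℝ) / 2) by rw [ha]; ring,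
      neg_div_neg_eq, div_le_iff₀ (by linarith)]
    have : 0 ≤ x ^ (-((d : ℝ) / 2)) := Real.rpow_nonneg hx.le _
    nlinarith
  have e6 : ∫ s in Set.Ioi x, (δ * (s ^ a * ‖deriv F s‖ ^ 2) + δ⁻¹ * s ^ (-a)) / 2 =
      (δ * (∫ s in Set.Ioi x, s ^ a * ‖deriv F s‖ ^ 2) + δ⁻¹ * ∫ s in Set.Ioi x, s ^ (-a)) / 2 := by
    rw [integral_div, integral_add (i1.const_mul δ) (i2.const_mul δ⁻¹), integral_const_mul,
      integral_const_mul]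
  rw [← e1]
  refine e2.trans (e3.trans ?_)
  rw [e6]
  have := mul_le_mul_of_nonneg_left e4 hδ.le
  have := mul_le_mul_of_nonneg_left e5 (inv_pos.2 hδ).le
  linarith

/-! ### Logarithmic cutoffs and vanishing of the profile -/

/-- A smooth cutoff on the half line, constant on the logarithmic scale `L`. -/
noncomputable def logCut (L : ℝ) : ℝ → ℝ :=
  (Set.Ioi 0).indicator fun x =>
    (⟨1, 2, one_pos, one_lt_two⟩ : ContDiffBump (0 : ℝ)) (Real.log x / L)

lemma logCut_eq_zero {L x : ℝ} (hL : 0 < L)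
    (hx : x ∉ Set.Ioo (Real.exp (-(2 * L))) (Real.exp (2 * L))) : logCut L x = 0 := by
  unfold logCut
  by_cases h0 : x ∈ Set.Ioi (0 : ℝ)
  · rw [Set.indicator_of_mem h0]
    refine ContDiffBump.zero_of_le_dist _ ?_
    rw [Real.dist_eq, sub_zero, abs_div, abs_of_pos hL, le_div_iff₀ hL]
    by_contra hlt
    rw [not_le, abs_lt] at hlt
    exact hx ⟨(Real.lt_log_iff_exp_lt h0).1 hlt.1, (Real.log_lt_iff_lt_exp h0).1 hlt.2⟩
  · rw [Set.indicator_of_notMem h0]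

lemma logCut_eq_one {L x : ℝ} (hL : 0 < L) (hx : 0 < x) (hxL : |Real.log x| ≤ L) :
    logCut L x = 1 := by
  unfold logCut
  rw [Set.indicator_of_mem (Set.mem_Ioi.2 hx)]
  refine ContDiffBump.one_of_mem_closedBall _ ?_
  rw [Metric.mem_closedBall, Real.dist_eq, sub_zero, abs_div, abs_of_pos hL]
  exact (div_le_one hL).2 hxL

lemma logCut_eventuallyEq {L x : ℝ} (hx : 0 < x) : logCut L =ᶠ[nhds x] fun x =>
    (⟨1, 2, one_pos, one_lt_two⟩ : ContDiffBump (0 : ℝ)) (Real.log x / L) := by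
  filter_upwards [Ioi_mem_nhds hx] with y hy using Set.indicator_of_mem hy _

lemma isTest_logCut {L : ℝ} (hL : 0 < L) : IsTest (logCut L) := by
  have hz : ∀ x, x ∉ Set.Ioo (Real.exp (-(2 * L))) (Real.exp (2 * L)) → logCut L x = 0 :=
    fun x hx => logCut_eq_zero hL hx
  refine IsTest.of_Ioo (contDiff_of_tsupport fun x hx => ?_) (Real.exp_pos _) hz
  have hx0 : 0 < x := (Real.exp_pos _).trans_le (tsupport_subset_Icc hz hx).1
  refine ContDiffAt.congr_of_eventuallyEq ?_ (logCut_eventuallyEq hx0)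
  exact (ContDiffBump.contDiff _).contDiffAt.comp x
    ((Real.contDiffAt_log.2 hx0.ne').div_const L)

/-- As a function of log x the cutoff has slope of order 1/L, hence derivative of order 1/(L x) in
x. -/
lemma exists_deriv_logCut_sq_le : ∃ C, 0 ≤ C ∧ ∀ L x : ℝ, 0 < L → 0 < x →
    deriv (logCut L) x ^ 2 ≤
      (Set.Ici (Real.exp (-(2 * L)))).indicator (fun x => C / (L * x) ^ 2) x := by
  set θ : ContDiffBump (0 : ℝ) := ⟨1, 2, one_pos, one_lt_two⟩ with hθ
  have hc : Continuous (deriv θ) := (θ.contDiff (n := 1)).continuous_deriv le_rfl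
  obtain ⟨C, hC⟩ := hc.bounded_above_of_compact_support θ.hasCompactSupport.deriv
  refine ⟨C ^ 2, sq_nonneg _, fun L x hL hx => ?_⟩
  have hd : HasDerivAt (logCut L) (deriv θ (Real.log x / L) * (x⁻¹ / L)) x := by
    refine HasDerivAt.congr_of_eventuallyEq ?_ (logCut_eventuallyEq hx)
    exact HasDerivAt.comp x (h₂ := θ) (h := fun x => Real.log x / L)
      ((θ.contDiff (n := 1)).differentiable one_ne_zero _).hasDerivAt
      ((Real.hasDerivAt_log hx.ne').div_const L)
  by_cases hxL : x ∈ Set.Ici (Real.exp (-(2 * L)))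
  · rw [Set.indicator_of_mem hxL, hd.deriv, mul_pow, div_eq_mul_inv (C ^ 2),
      show (x⁻¹ / L) ^ 2 = ((L * x) ^ 2)⁻¹ by field_simp]
    refine mul_le_mul_of_nonneg_right ?_ (by positivity)
    have := hC (Real.log x / L)
    rw [Real.norm_eq_abs] at this
    exact sq_le_sq' (neg_le_of_abs_le this) (le_of_abs_le this)
  · rw [Set.indicator_of_notMem hxL]
    have hz : logCut L =ᶠ[nhds x] fun _ => 0 := by
      filter_upwards [Iio_mem_nhds (not_le.1 hxL)] with y hy
      exact logCut_eq_zero hL fun h => absurd h.1 (not_lt.2 (le_of_lt hy))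
    rw [hz.deriv_eq, deriv_const]
    norm_num

namespace IsProfile

variable {f u : Heis d → ℂ} {g K m : ℝ → ℂ}

/-- Finite energy bounds the growth of g at the origin. In `norm_sub_le_of_integral_sq_le` from x to
1, the choice δ = x^(-d/4) balances the two terms. -/
lemma exists_norm_sq_le (h : IsProfile d f u g K m) (hd : 1 ≤ d)
    {G : Heis d → EuclideanSpace ℂ (Fin d ⊕ Fin d)} (hG : MemH1 u G) :
    ∃ C, 0 ≤ C ∧ ∀ x, 0 < x → x ≤ 1 → ‖g x‖ ^ 2 ≤ C * x ^ (-((d : ℝ) / 2)) := by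
  set D := ∫ x in Set.Ioi 0, x ^ ((d : ℝ) / 2 + 1) * ‖deriv g x‖ ^ 2 with hD
  have hD0 : 0 ≤ D := setIntegral_nonneg measurableSet_Ioi fun x hx => by
    have := Set.mem_Ioi.1 hx
    positivity
  refine ⟨(‖g 1‖ + (D / 2 + 1)) ^ 2, sq_nonneg _, fun x hx hx1 => ?_⟩
  set q : ℝ := x ^ (-((d : ℝ) / 4)) with hq
  have hq0 : 0 < q := Real.rpow_pos_of_pos hx _
  have hq1 : 1 ≤ q := Real.one_le_rpow_of_pos_of_le_one_of_nonpos hx hx1 (by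
    have : (0 : ℝ) ≤ d := by positivity
    linarith)
  have hqq : x ^ (-((d : ℝ) / 2)) = q ^ 2 := by
    rw [hq, ← Real.rpow_natCast, ← Real.rpow_mul hx.le]
    congr 1; push_cast; ring
  have h1 := norm_sub_le_of_integral_sq_le hd hx hx1 hq0 (fun s hs => h.hasDerivAt_deriv hs)
    h.continuousOn_deriv (h.integrableOn_deriv_sq hd hG) hD.ge
  rw [hqq] at h1 ⊢
  have h2 : (q * D + q⁻¹ * (2 * q ^ 2)) / 2 = q * (D / 2 + 1) := by field_simp
  rw [h2] at h1
  have h3 : ‖g x‖ ≤ ‖g 1‖ + ‖g 1 - g x‖ := by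
    have := norm_sub_le (g 1) (g 1 - g x)
    rwa [sub_sub_cancel] at this
  have h4 : ‖g x‖ ≤ (‖g 1‖ + (D / 2 + 1)) * q := by
    nlinarith [norm_nonneg (g 1)]
  rw [← mul_pow]
  exact pow_le_pow_left₀ (norm_nonneg _) h4 2

/-- For x ≥ 1 the integrand is at most |g|² x^((d-1)/2) times a constant over L², and u is square
integrable. For x ≤ 1 the growth bound leaves a constant times 1/(L² x), whose integral over
[e^(-2L), 1] is of order 1/L. -/
lemma exists_integral_deriv_logCut_le (h : IsProfile d f u g K m) (hd : 1 ≤ d)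
    {G : Heis d → EuclideanSpace ℂ (Fin d ⊕ Fin d)} (hG : MemH1 u G) :
    ∃ C, 0 ≤ C ∧ ∀ L, 1 ≤ L →
      ∫ x in Set.Ioi 0, x ^ ((d : ℝ) / 2 + 1) * (deriv (logCut L) x ^ 2 * ‖g x‖ ^ 2) ≤ C / L := by
  obtain ⟨C₁, hC₁, h1⟩ := exists_deriv_logCut_sq_le
  obtain ⟨C₂, hC₂, h2⟩ := h.exists_norm_sq_le hd hG
  have i1 := h.integrableOn_sq hd hG.memLp
  set I := ∫ x in Set.Ioi 0, x ^ (((d : ℝ) - 1) / 2) * ‖g x‖ ^ 2 with hI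
  have hI0 : 0 ≤ I := setIntegral_nonneg measurableSet_Ioi fun x hx => by
    have := Set.mem_Ioi.1 hx
    positivity
  refine ⟨C₁ * (I + 2 * C₂), by positivity, fun L hL => ?_⟩
  have hL0 : 0 < L := by linarith
  set ε : ℝ := Real.exp (-(2 * L)) with hε
  have hε0 : 0 < ε := Real.exp_pos _
  have hε1 : ε ≤ 1 := Real.exp_le_one_iff.2 (by linarith)
  have i2 : IntegrableOn (fun x : ℝ => C₂ * x⁻¹) (Set.Icc ε 1) :=
    (continuousOn_const.mul (continuousOn_inv₀.mono fun x hx =>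
      (hε0.trans_le hx.1).ne')).integrableOn_compact isCompact_Icc
  have hsub : Set.Icc ε 1 ⊆ Set.Ioi (0 : ℝ) := fun x hx => hε0.trans_le hx.1
  have i3 : IntegrableOn ((Set.Icc ε 1).indicator fun x : ℝ => C₂ * x⁻¹) (Set.Ioi 0) :=
    ((integrable_indicator_iff measurableSet_Icc).2 i2).integrableOn
  have e1 : ∫ x in Set.Ioi 0, (Set.Icc ε 1).indicator (fun x : ℝ => C₂ * x⁻¹) x = C₂ * (2 * L) := by
    rw [setIntegral_indicator measurableSet_Icc, Set.inter_eq_self_of_subset_right hsub,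
      integral_Icc_eq_integral_Ioc, ← intervalIntegral.integral_of_le hε1,
      intervalIntegral.integral_const_mul, integral_inv_of_pos hε0 one_pos, one_div,
      Real.log_inv, hε, Real.log_exp, neg_neg]
  have pw : ∀ x ∈ Set.Ioi (0 : ℝ), x ^ ((d : ℝ) / 2 + 1) * (deriv (logCut L) x ^ 2 * ‖g x‖ ^ 2) ≤
      C₁ / L ^ 2 * (x ^ (((d : ℝ) - 1) / 2) * ‖g x‖ ^ 2 +
        (Set.Icc ε 1).indicator (fun x : ℝ => C₂ * x⁻¹) x) := by
    intro x hx
    have hx0 : 0 < x := hx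
    have k1 := h1 L x hL0 hx0
    have hp : x ^ ((d : ℝ) / 2 + 1) * (C₁ / (L * x) ^ 2) = C₁ / L ^ 2 * x ^ ((d : ℝ) / 2 - 1) := by
      rw [Real.rpow_add_one hx0.ne', Real.rpow_sub_one hx0.ne']
      field_simp
    have hi0 : 0 ≤ (Set.Icc ε 1).indicator (fun x : ℝ => C₂ * x⁻¹) x :=
      Set.indicator_nonneg (fun y hy => by have := hε0.trans_le hy.1; positivity) _
    by_cases hxε : ε ≤ x
    · rw [Set.indicator_of_mem (Set.mem_Ici.2 hxε)] at k1
      have k2 : x ^ ((d : ℝ) / 2 + 1) * (deriv (logCut L) x ^ 2 * ‖g x‖ ^ 2) ≤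
          C₁ / L ^ 2 * (x ^ ((d : ℝ) / 2 - 1) * ‖g x‖ ^ 2) := by
        have := mul_le_mul_of_nonneg_left (mul_le_mul_of_nonneg_right k1 (sq_nonneg ‖g x‖))
          (Real.rpow_nonneg hx0.le ((d : ℝ) / 2 + 1))
        rwa [← mul_assoc _ (C₁ / _), hp, mul_assoc (C₁ / L ^ 2)] at this
      refine k2.trans (mul_le_mul_of_nonneg_left ?_ (by positivity))
      rcases le_total 1 x with hx1 | hx1
      · have := Real.rpow_le_rpow_of_exponent_le hx1
          (by linarith : (d : ℝ) / 2 - 1 ≤ ((d : ℝ) - 1) / 2)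
        have := mul_le_mul_of_nonneg_right this (sq_nonneg ‖g x‖)
        linarith
      · rw [Set.indicator_of_mem (Set.mem_Icc.2 ⟨hxε, hx1⟩)]
        have k3 := mul_le_mul_of_nonneg_left (h2 x hx0 hx1)
          (Real.rpow_nonneg hx0.le ((d : ℝ) / 2 - 1))
        have k4 : x ^ ((d : ℝ) / 2 - 1) * (C₂ * x ^ (-((d : ℝ) / 2))) = C₂ * x⁻¹ := by
          rw [Real.rpow_sub_one hx0.ne', Real.rpow_neg hx0.le]
          have := (Real.rpow_pos_of_pos hx0 ((d : ℝ) / 2)).ne'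
          field_simp
        have : 0 ≤ x ^ (((d : ℝ) - 1) / 2) * ‖g x‖ ^ 2 := by positivity
        linarith
    · rw [Set.indicator_of_notMem (by simpa using hxε)] at k1
      have : deriv (logCut L) x ^ 2 = 0 := le_antisymm k1 (sq_nonneg _)
      rw [this, zero_mul, mul_zero]
      have : 0 ≤ x ^ (((d : ℝ) - 1) / 2) * ‖g x‖ ^ 2 := by positivity
      positivity
  have e2 : ∫ x in Set.Ioi 0, x ^ ((d : ℝ) / 2 + 1) * (deriv (logCut L) x ^ 2 * ‖g x‖ ^ 2) ≤
      ∫ x in Set.Ioi 0, C₁ / L ^ 2 * (x ^ (((d : ℝ) - 1) / 2) * ‖g x‖ ^ 2 +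
        (Set.Icc ε 1).indicator (fun x : ℝ => C₂ * x⁻¹) x) := by
    refine integral_mono_of_nonneg ?_ ((i1.add i3).const_mul _) ?_
    · filter_upwards [ae_restrict_mem measurableSet_Ioi] with x hx
      have := Set.mem_Ioi.1 hx
      simp only [Pi.zero_apply]
      positivity
    · filter_upwards [ae_restrict_mem measurableSet_Ioi] with x hx using pw x hx
  rw [integral_const_mul, integral_add i1 i3, e1] at e2
  refine e2.trans ?_
  rw [div_mul_eq_mul_div, div_le_div_iff₀ (by positivity) hL0]
  have : C₁ * (I + C₂ * (2 * L)) ≤ C₁ * (I + 2 * C₂) * L := by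
    rw [mul_assoc]
    refine mul_le_mul_of_nonneg_left ?_ hC₁
    nlinarith
  nlinarith

/-- Under a subcritical lower bound for the potential, the profile vanishes. -/
lemma eq_zero (h : IsProfile d f u g K m) (hd : 1 ≤ d) {W : Heis d → ℝ} {b : ℝ} (hb0 : 0 ≤ b)
    (hb1 : b < 1) (hb : FormBounded W b) (hW : LocallyIntegrable W volume) (hW0 : ∀ p, 0 ≤ W p)
    (hf : LocallyIntegrable f volume) (hfW : ∀ p, -W p ≤ (f p).re)
    {G : Heis d → EuclideanSpace ℂ (Fin d ⊕ Fin d)} (hG : MemH1 u G) {x : ℝ} (hx : 0 < x) :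
    g x = 0 := by
  obtain ⟨C, hC, h1⟩ := h.exists_integral_deriv_logCut_le hd hG
  have hb2 : 0 < 1 - b ^ 2 := by nlinarith
  set C' : ℝ := (C / (1 - b ^ 2) + 2 * x ^ (-((d : ℝ) / 2))) / 2 with hC'
  -- The cutoff scale is L = n², so the energy of the cut-off profile is O(n⁻²). Taking δ = n makes
  -- both terms of the pointwise estimate O(1/n).
  have main : ∀ n : ℝ, 1 ≤ n → |Real.log x| ≤ n → ‖g x‖ * n ≤ C' := by
    intro n hn hxn
    have hn0 : 0 < n := by linarith
    have hL : 1 ≤ n ^ 2 := one_le_pow₀ hn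
    have hL0 : 0 < n ^ 2 := by linarith
    have hη := isTest_logCut hL0
    have k1 := (h.caccioppoli hd hb hW hW0 hf hfW hη).trans (h1 _ hL)
    set φ : ℝ → ℂ := fun x => (logCut (n ^ 2) x : ℂ) * g x with hφ
    have cφ : ContDiff ℝ 1 φ := h.contDiff_mul hη
    have k2 : ∫ s in Set.Ioi 0, s ^ ((d : ℝ) / 2 + 1) * ‖deriv φ s‖ ^ 2 ≤
        C / (1 - b ^ 2) / n ^ 2 := by
      rw [div_right_comm, le_div_iff₀ hb2]; linarith
    have hz : ∀ y, y ∉ Set.Ioo (Real.exp (-(2 * n ^ 2))) (Real.exp (2 * n ^ 2)) → φ y = 0 := by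
      intro y hy
      simp only [hφ, logCut_eq_zero hL0 hy, Complex.ofReal_zero, zero_mul]
    have tφ : tsupport φ ⊆ Set.Ioi 0 :=
      (tsupport_subset_Icc hz).trans fun y hy => (Real.exp_pos _).trans_le hy.1
    have sφ : HasCompactSupport φ := hasCompactSupport_of_Ioo hz
    have hpow : ContinuousOn (fun x : ℝ => x ^ ((d : ℝ) / 2 + 1)) (Set.Ioi 0) :=
      continuousOn_id.rpow_const fun x hx => Or.inl (ne_of_gt hx)
    have cφ' := cφ.continuous_deriv le_rfl
    have i1 : IntegrableOn (fun s => s ^ ((d : ℝ) / 2 + 1) * ‖deriv φ s‖ ^ 2) (Set.Ioi 0) :=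
      integrableOn_Ioi_of_continuousOn (hpow.mul (cφ'.norm.pow 2).continuousOn) sφ.deriv
        ((tsupport_deriv_subset).trans tφ)
        fun x hx => by rw [image_eq_zero_of_notMem_tsupport hx]; simp
    -- This y lies beyond the support of φ, so φ y = 0 and the difference is the value at x.
    have k3 := norm_sub_le_of_integral_sq_le hd (F := φ) (y := max x (Real.exp (2 * n ^ 2))) hx
      (le_max_left _ _) hn0 (fun s _ => (cφ.differentiable one_ne_zero s).hasDerivAt)
      cφ'.continuousOn i1 k2
    have hxL : |Real.log x| ≤ n ^ 2 := hxn.trans (by nlinarith)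
    have k4 : φ x = g x := by
      simp only [hφ, logCut_eq_one hL0 hx hxL, Complex.ofReal_one, one_mul]
    rw [hz _ (fun h => absurd h.2 (not_lt.2 (le_max_right _ _))), k4, zero_sub, norm_neg] at k3
    have k5 := mul_le_mul_of_nonneg_right k3 hn0.le
    refine k5.trans (le_of_eq ?_)
    rw [hC']
    field_simp
  by_contra hne
  have hg : 0 < ‖g x‖ := norm_pos_iff.2 hne
  set n : ℝ := max (max 1 |Real.log x|) (C' / ‖g x‖ + 1) with hn
  have h2 := main n ((le_max_left _ _).trans (le_max_left _ _))
    ((le_max_right _ _).trans (le_max_left _ _))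
  have h3 : C' / ‖g x‖ + 1 ≤ n := le_max_right _ _
  have h4 := mul_le_mul_of_nonneg_left h3 hg.le
  rw [mul_add, mul_div_cancel₀ _ hg.ne', mul_one] at h4
  linarith

end IsProfile

end Heis

/-! ### Absence of radial eigenfunctions -/

theorem theorem2p5 (d : ℕ) (hd : 1 ≤ d) (V : Heis d → ℂ) (V' : Heis d → Heis d →L[ℝ] ℂ)
    (hV : LocallyIntegrable V volume) (hV' : Heis.MemW1Loc (d : ℝ≥0∞) V V')
    (b₁ b₂ b₃ : ℝ) (hb₁ : 0 ≤ b₁) (hb₁' : b₁ < 1) (hb₂ : 0 ≤ b₂) (hb₂' : b₂ < 1)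
    (hb₃ : 0 ≤ b₃)
    (hb₃' : b₃ < -(1 / (8 * (d : ℝ))) - (4 * (d : ℝ) + 1) / 2 * √(1 - b₁ ^ 2)
      + √((1 / (8 * (d : ℝ)) + (4 * (d : ℝ) + 1) / 2 * √(1 - b₁ ^ 2)) ^ 2
          + (d : ℝ) * (1 - b₂ ^ 2) * √(1 - b₁ ^ 2)))
    (h₁ : Heis.FormBounded (fun p => max 0 (-(V p).re)) b₁)
    (h₂ : Heis.FormBounded (fun p => max 0 (Heis.radialDerivRho V V' p)) b₂)
    (h₃ : Heis.FormBounded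
      (fun p => Heis.koranyi p ^ 4 / ‖p.1‖ ^ 2 * (V p).im ^ 2) b₃) :
    ¬ ∃ (lam : ℂ) (u : Heis d → ℂ), Heis.IsEigenfunction V lam u ∧ Heis.IsRadial u := by
  rintro ⟨lam, u, ⟨G, hG, hne, hVu, heq⟩, hrad⟩
  have hu : LocallyIntegrable u volume := hG.weak.locInt
  have lf : LocallyIntegrable (fun p => V p - lam) volume := hV.sub (locallyIntegrable_const lam)
  have lfu : LocallyIntegrable (fun p => (V p - lam) * u p) volume := by
    have : LocallyIntegrable (fun p => V p * u p - lam • u p) volume := hVu.sub (hu.smul lam)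
    refine this.congr (Filter.Eventually.of_forall fun p => ?_)
    simp only [smul_eq_mul]
    ring
  have hw : ∀ v : Heis d → ℝ, ContDiff ℝ ∞ v → HasCompactSupport v →
      ∫ p, ((V p - lam) * u p) * (v p : ℂ) = ∫ p, u p * (Heis.hlap v p : ℂ) :=
    fun v hv hvc => Heis.weak_equation hG.weak hVu heq hv hvc
  obtain ⟨g, K, m, hg⟩ := Heis.exists_isProfile hd hu hrad lf lfu hw
  have lV : LocallyIntegrable (fun p => (V p).re) volume := hV.complex_re
  have hmu : ¬ 0 < lam.re := by
    refine Heis.not_pos_of_virial hd hV'.weak h₁ h₂ fun k hk hkc => ?_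
    have h4 := hg.integral_mul_qpoly_eq_zero hne hu lf lfu hw hk.continuous hkc
    have cw : Continuous fun p : Heis d => Heis.qpoly p * k (Heis.tau p) :=
      (Heis.contDiff_qpoly (n := 0)).continuous.mul (hk.continuous.comp Heis.continuous_tau)
    have sw : HasCompactSupport fun p : Heis d => Heis.qpoly p * k (Heis.tau p) :=
      (Heis.hasCompactSupport_comp_tau hkc).mul_left
    have i1 : Integrable fun p =>
        (V p - lam) * ((Heis.qpoly p * k (Heis.tau p) : ℝ) : ℂ) := by
      refine (lf.integrable_smul_left_of_hasCompactSupport cw sw).congr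
        (Filter.Eventually.of_forall fun p => ?_)
      simp only [Complex.real_smul]
      ring
    -- The test weight is real, so the real part of the orthogonality relation involves only Re V
    -- and Re λ.
    have h5 := integral_re (𝕜 := ℂ) i1
    rw [h4] at h5
    simp only [RCLike.re_eq_complex_re, Complex.zero_re, Complex.re_mul_ofReal,
      Complex.sub_re, sub_mul] at h5
    rw [integral_sub (lV.integrable_mul_continuous cw sw)
      ((cw.integrable_of_hasCompactSupport sw).const_mul _), integral_const_mul] at h5
    exact sub_eq_zero.1 h5
  refine hne ?_
  have hz : ∀ᵐ x ∂(volume.restrict (Set.Ioi (0 : ℝ))), g x = 0 := by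
    filter_upwards [ae_restrict_mem measurableSet_Ioi] with x hx
    -- As Re λ ≤ 0, the real part of V - λ is at least Re V, hence at least -[Re V]₋.
    refine hg.eq_zero hd hb₁ hb₁' h₁ lV.neg.max_zero (fun p => le_max_left _ _) lf (fun p => ?_) hG hx
    have := le_max_right 0 (-(V p).re)
    simp only [Complex.sub_re]
    linarith [not_lt.1 hmu]
  filter_upwards [hg.ae_eq, Heis.ae_comp_tau hz] with p e1 e2
  rw [e1, e2]
  rfl
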